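/- Let $B$ (blue) and $R$ (red) be disjoint sets of $n \ge 1$ points each in the plane such that no three points of $P = B \cup R$ lie on a common line. A \emph{$BR$-matching} is a perfect matching of $P$ whose edges, drawn as straight line segments, each join a blue point to a red point and are pairwise disjoint. More generally, a set of straight-line edges is called \emph{plane} if no two distinct edges share a point except for a possible common endpoint; two $BR$-matchings are \emph{compatible} if the union of their edge sets is plane. A \emph{transformation of length $k$} between $BR$-matchings $M$ and $M'$ is a sequence $M = M_0, M_1, \ldots, M_k = M'$ of $BR$-matchings such that $M_{i-1}$ and $M_i$ are compatible for all $1 \le i \le k$; $M$ and $M'$ are \emph{$t$-compatible} if there is a transformation of some length $k \le t$ between them. A \emph{ham-sandwich cut} of a set consisting of $m$ blue and $m$ red points is a straight line with exactly $\lfloor m/2\rfloor$ blue and $\lfloor m/2\rfloor$ red points of the set on one (open) side and exactly $\lceil m/2\rceil$ blue and $\lceil m/2\rceil$ red points on the other. A \emph{ham-sandwich matching} of $P$ is a $BR$-matching obtained by recursion: if $n = 1$, match the two points; if $n \ge 2$, choose a ham-sandwich cut of $P$ and take the union of a ham-sandwich matching of the points on one side and a ham-sandwich matching of the points on the other side.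 Then for every $BR$-matching $M$ of $P$ and every ham-sandwich matching $H$ of $P$, $M$ and $H$ are $n$-compatible. -/

import Mathlib

/-- The Euclidean plane. -/
abbrev Plane : Type := EuclideanSpace ℝ (Fin 2)

/-- `S` is in general position: no three distinct points of `S` lie on a common line. -/
def GeneralPosition (S : Set Plane) : Prop :=
  ∀ p ∈ S, ∀ q ∈ S, ∀ r ∈ S, p ≠ q → p ≠ r → q ≠ r → ¬ Collinear ℝ ({p, q, r} : Set Plane)

/-- The straight line segment that embeds the edge `e`: the convex hull of its endpoints. -/
def edgeSegment (e : Sym2 Plane) : Set Plane :=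
  convexHull ℝ {p : Plane | p ∈ e}

/-- `E` is the edge set of a geometric graph on the point set `S`. -/
def IsGeometricGraph (S : Set Plane) (E : Set (Sym2 Plane)) : Prop :=
  ∀ e ∈ E, ¬ e.IsDiag ∧ ∀ p ∈ e, p ∈ S

/-- No two edges share a point except for a possible common endpoint. -/
def IsPlane (E : Set (Sym2 Plane)) : Prop :=
  ∀ e ∈ E, ∀ f ∈ E, e ≠ f → ∀ x ∈ edgeSegment e ∩ edgeSegment f, x ∈ e ∧ x ∈ f

/-- `M` is (the edge set of) a plane geometric perfect matching on `S`. -/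
structure IsPerfectMatching (S : Set Plane) (M : Set (Sym2 Plane)) : Prop where
  graph : IsGeometricGraph S M
  plane : IsPlane M
  perfect : ∀ p ∈ S, ∃! e, e ∈ M ∧ p ∈ e

/-- Every edge has one endpoint in `B` and the other one in `R`. -/
def IsBichromatic (B R : Set Plane) (E : Set (Sym2 Plane)) : Prop :=
  ∀ e ∈ E, ∃ b ∈ B, ∃ r ∈ R, e = s(b, r)

/-- `M` is a `BR`-matching: a bichromatic plane perfect matching on `B ∪ R`. -/
structure IsBRMatching (B R : Finset Plane) (M : Set (Sym2 Plane)) : Prop where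
  perfectMatching : IsPerfectMatching ((B : Set Plane) ∪ (R : Set Plane)) M
  bichromatic : IsBichromatic (B : Set Plane) (R : Set Plane) M

/-- Two plane geometric graphs on the same point set are compatible if the union of their
edge sets is plane. -/
def Compatible (E₁ E₂ : Set (Sym2 Plane)) : Prop :=
  IsPlane (E₁ ∪ E₂)

/-- There is a transformation of length `k` between `M` and `M'`: a sequence of `BR`-matchings
`M = Ms 0, …, Ms k = M'` in which consecutive matchings are compatible. -/
def HasTransformation (B R : Finset Plane) (k : ℕ) (M M' : Set (Sym2 Plane)) : Prop :=
  ∃ Ms : ℕ → Set (Sym2 Plane), Ms 0 = M ∧ Ms k = M' ∧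
    (∀ i, i ≤ k → IsBRMatching B R (Ms i)) ∧
    ∀ i, i < k → Compatible (Ms i) (Ms (i + 1))

/-- `M` and `M'` are `t`-compatible: there is a transformation of length at most `t`. -/
def TCompatible (B R : Finset Plane) (t : ℕ) (M M' : Set (Sym2 Plane)) : Prop :=
  ∃ k, k ≤ t ∧ HasTransformation B R k M M'

/-- A straight line `{x | ⟪normal, x⟫ = offset}` of the plane, given by an equation. -/
structure PlaneLine where
  normal : Plane
  offset : ℝ
  normal_ne_zero : normal ≠ 0

open Classical in
/-- The points of `S` strictly on the negative side of `ℓ`. -/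
noncomputable def PlaneLine.negPart (ℓ : PlaneLine) (S : Finset Plane) : Finset Plane :=
  S.filter fun p => inner ℝ ℓ.normal p < ℓ.offset

open Classical in
/-- The points of `S` strictly on the positive side of `ℓ`. -/
noncomputable def PlaneLine.posPart (ℓ : PlaneLine) (S : Finset Plane) : Finset Plane :=
  S.filter fun p => ℓ.offset < inner ℝ ℓ.normal p

/-- `ℓ` is a ham-sandwich cut of `B ∪ R`, where `|B| = |R| = n`: exactly `⌊n/2⌋` blue and
`⌊n/2⌋` red points are on one side of `ℓ`, and exactly `⌈n/2⌉` blue and `⌈n/2⌉` red points are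
on the other side (here `⌈n/2⌉ = (n + 1) / 2` in integer division). -/
def IsHamSandwichCut (n : ℕ) (B R : Finset Plane) (ℓ : PlaneLine) : Prop :=
  B.card = n ∧ R.card = n ∧
    (((ℓ.negPart B).card = n / 2 ∧ (ℓ.negPart R).card = n / 2 ∧
        (ℓ.posPart B).card = (n + 1) / 2 ∧ (ℓ.posPart R).card = (n + 1) / 2) ∨
      ((ℓ.posPart B).card = n / 2 ∧ (ℓ.posPart R).card = n / 2 ∧
        (ℓ.negPart B).card = (n + 1) / 2 ∧ (ℓ.negPart R).card = (n + 1) / 2))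

/-- `H` is a ham-sandwich matching of `B ∪ R`: it is obtained by recursively applying
ham-sandwich cuts until only two points, one of each color, remain, which are then matched. -/
inductive IsHamSandwichMatching : Finset Plane → Finset Plane → Set (Sym2 Plane) → Prop
  | pair (b r : Plane) : IsHamSandwichMatching {b} {r} {s(b, r)}
  | cut (n : ℕ) (hn : 2 ≤ n) (B R : Finset Plane) (ℓ : PlaneLine)
      (hℓ : IsHamSandwichCut n B R ℓ) (H₁ H₂ : Set (Sym2 Plane))
      (h₁ : IsHamSandwichMatching (ℓ.negPart B) (ℓ.negPart R) H₁)
      (h₂ : IsHamSandwichMatching (ℓ.posPart B) (ℓ.posPart R) H₂) :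
      IsHamSandwichMatching B R (H₁ ∪ H₂)

/-!
The heart of the argument is the following exchange. Let `ℓ` be a line with as many blue as red
points on each side, and let `M` be a matching with edges that cross `ℓ`. Then there is a compatible
matching with fewer edges across `ℓ` (`exists_compatible_crossNum_lt`). As the sides are balanced,
the edges cross `ℓ` equally often in both directions (`ncard_up_eq_down`), so the number of
crossings is even. For a ham-sandwich cut it is at most `2⌊n / 2⌋`, because one side
has only `⌊n / 2⌋` points of each colour. Thus `⌊n / 2⌋` exchanges suffice to remove all crossings
(`exists_uncrossed`). Both sides are then treated recursively and in parallel, which takes at most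
`⌈n / 2⌉` further steps (`exists_hasTransformation`).

For the exchange, direct each edge from blue to red and label its two sides by `true` (left) and
`false` (right). Cut the plane, inside a large disc, by labelled segments, the *walls*. The edges
cut `ℓ` into gaps. A gap between two equal labels is closed by a wall with this label
(`Gaps.close_all`); only the gaps between different labels remain, and they are fewer than the
crossings because the edges cross `ℓ` in both directions and the label of the outer circle can be
chosen accordingly (`card_gaps_lt`). Then each edge is extended at both ends until it hits an edge,
a wall or the circle, and the extension gets the label of what it hits. An extension that hits a gap
splits it into one part with different labels and one with equal labels, and the latter is closed;
so the number of gaps does not grow (`Gaps.extend_all`).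

Now no wall has a dead end, and so the complement of the walls falls apart into convex cells:
visibility in it is transitive (`segment_subset_of_noDeadEnd`, `Core.visTrans`). Each point of the
matching belongs to exactly one cell, on the side of its extended edge where the label of the edge
and the label of the extension differ. Seen along the boundary of a cell, the label therefore jumps
exactly at the points that belong to the cell, up or down according to their colour. Hence each cell
has as many blue as red points, and on either side of `ℓ` the two numbers differ by at most one
(`Core.balanced`). Match the points within each cell, with as few edges across `ℓ` as possible, and
among those matchings with the smallest total length. The result is plane by the triangle
inequality and compatible with `M` by the convexity of the cells, and at most one of its edges runs
through each gap (`exists_fewer_crossings`).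
-/

namespace LabelledWalls

open Set Filter Topology

/-! ### The cross product of the plane -/

/-- The cross product (determinant) of two vectors of the plane. -/
def cross (a b : Plane) : ℝ := a 0 * b 1 - a 1 * b 0

theorem cross_swap (a b : Plane) : cross a b = - cross b a := by
  simp [cross]; ring

@[simp] theorem cross_self (a : Plane) : cross a a = 0 := by simp [cross]; ring

theorem cross_add_left (a b c : Plane) : cross (a + b) c = cross a c + cross b c := by
  simp [cross]; ring

theorem cross_add_right (a b c : Plane) : cross a (b + c) = cross a b + cross a c := by
  simp [cross]; ring

theorem cross_sub_left (a b c : Plane) : cross (a - b) c = cross a c - cross b c := by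
  simp [cross]; ring

theorem cross_sub_right (a b c : Plane) : cross a (b - c) = cross a b - cross a c := by
  simp [cross]; ring

theorem cross_neg_left (a b : Plane) : cross (-a) b = - cross a b := by
  simp [cross]; ring

theorem cross_neg_right (a b : Plane) : cross a (-b) = - cross a b := by
  simp [cross]; ring

theorem cross_smul_left (t : ℝ) (a b : Plane) : cross (t • a) b = t * cross a b := by
  simp [cross]; ring

theorem cross_smul_right (t : ℝ) (a b : Plane) : cross a (t • b) = t * cross a b := by
  simp [cross]; ring

theorem Continuous.cross {X : Type*} [TopologicalSpace X] {f g : X → Plane} (hf : Continuous f)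
    (hg : Continuous g) : Continuous fun x => cross (f x) (g x) := by
  unfold LabelledWalls.cross; fun_prop

/-- Cramer's rule. -/
theorem cross_smul_eq (d e x : Plane) : cross d e • x = cross x e • d + cross d x • e := by
  ext i; fin_cases i <;> simp [cross] <;> ring

theorem exists_smul_of_cross_eq_zero {d x : Plane} (hd : d ≠ 0) (h : cross d x = 0) :
    ∃ t : ℝ, x = t • d := by
  have : d 0 ≠ 0 ∨ d 1 ≠ 0 := by
    by_contra! h0
    apply hd; ext i; fin_cases i <;> simp [h0]
  simp only [cross] at h
  rcases this with h0 | h0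
  · refine ⟨x 0 / d 0, ?_⟩
    ext i; fin_cases i
    · simp [h0]
    · simp; field_simp; linarith
  · refine ⟨x 1 / d 1, ?_⟩
    ext i; fin_cases i
    · simp; field_simp; linarith
    · simp [h0]

theorem collinear_of_cross_eq_zero {p q r : Plane} (h : cross (q - p) (r - p) = 0) :
    Collinear ℝ ({p, q, r} : Set Plane) := by
  by_cases hq : q - p = 0
  · rw [sub_eq_zero] at hq
    subst hq
    simpa using collinear_pair ℝ q r
  · obtain ⟨t, ht⟩ := exists_smul_of_cross_eq_zero hq h
    rw [collinear_iff_of_mem (p₀ := p) (by simp)]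
    refine ⟨q - p, ?_⟩
    rintro x (rfl | rfl | rfl)
    · exact ⟨0, by simp⟩
    · exact ⟨1, by simp⟩
    · exact ⟨t, by rw [← ht]; simp⟩

/-! ### Points on segments -/

theorem mem_segment_iff {p q x : Plane} :
    x ∈ segment ℝ p q ↔ ∃ t : ℝ, 0 ≤ t ∧ t ≤ 1 ∧ x = p + t • (q - p) := by
  rw [segment_eq_image']
  constructor
  · rintro ⟨t, ⟨h0, h1⟩, rfl⟩; exact ⟨t, h0, h1, rfl⟩
  · rintro ⟨t, h0, h1, rfl⟩; exact ⟨t, ⟨h0, h1⟩, rfl⟩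

theorem mem_openSegment_iff {p q x : Plane} :
    x ∈ openSegment ℝ p q ↔ ∃ t : ℝ, 0 < t ∧ t < 1 ∧ x = p + t • (q - p) := by
  rw [openSegment_eq_image']
  constructor
  · rintro ⟨t, ⟨h0, h1⟩, rfl⟩; exact ⟨t, h0, h1, rfl⟩
  · rintro ⟨t, h0, h1, rfl⟩; exact ⟨t, ⟨h0, h1⟩, rfl⟩

theorem mem_segment_cases {p q x : Plane} (h : x ∈ segment ℝ p q) :
    x = p ∨ x = q ∨ x ∈ openSegment ℝ p q := by
  have := (insert_endpoints_openSegment ℝ p q).symm ▸ h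
  simpa [or_assoc] using this

theorem isCompact_segment (p q : Plane) : IsCompact (segment ℝ p q) := by
  rw [segment_eq_image_lineMap]
  exact isCompact_Icc.image AffineMap.lineMap_continuous

theorem isClosed_segment (p q : Plane) : IsClosed (segment ℝ p q) :=
  (isCompact_segment p q).isClosed

/-! ### Dead ends -/

/-- `x` is not a dead end of `W`: for each line through `x`, with direction `d`, either `W` has
points arbitrarily close to `x` strictly to the left of this line, or `W` contains a neighbourhood
of `x` in this line. So, as far as segments are concerned, the complement of `W` has no angle
exceeding `π` at `x`. -/
def NoDeadEnd (W : Set Plane) (x : Plane) : Prop :=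
  ∀ d : Plane, d ≠ 0 → (∃ᶠ y in 𝓝 x, y ∈ W ∧ 0 < cross d (y - x)) ∨
    ∀ᶠ t : ℝ in 𝓝 0, x + t • d ∈ W

theorem NoDeadEnd.mono {W W' : Set Plane} {x : Plane} (h : NoDeadEnd W x) (hW : W ⊆ W') :
    NoDeadEnd W' x := by
  intro d hd
  rcases h d hd with h | h
  · exact Or.inl (h.mono fun y hy => ⟨hW hy.1, hy.2⟩)
  · exact Or.inr (h.mono fun y hy => hW hy)

theorem tendsto_add_smul (x d : Plane) : Tendsto (fun t : ℝ => x + t • d) (𝓝 0) (𝓝 x) := by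
  have : Continuous (fun t : ℝ => x + t • d) := by fun_prop
  simpa using this.tendsto 0

/-- The points near `x` on the line with direction `e`, where the neighbourhood is measured in
terms of the parameter, are in a segment that has `x` in its relative interior. -/
theorem eventually_add_smul_mem_openSegment {p q x : Plane} (hx : x ∈ openSegment ℝ p q) :
    ∀ᶠ t : ℝ in 𝓝 0, x + t • (q - p) ∈ openSegment ℝ p q := by
  obtain ⟨s, h0, h1, rfl⟩ := mem_openSegment_iff.1 hx
  have h2 : ∀ᶠ t : ℝ in 𝓝 0, s + t ∈ Ioo (0 : ℝ) 1 := by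
    have : Tendsto (fun t : ℝ => s + t) (𝓝 0) (𝓝 s) := by
      have h : Continuous fun t : ℝ => s + t := by fun_prop
      simpa using h.tendsto 0
    exact this.eventually (Ioo_mem_nhds h0 h1)
  filter_upwards [h2] with t ht
  exact mem_openSegment_iff.2 ⟨s + t, ht.1, ht.2, by rw [add_smul, add_assoc]⟩

theorem noDeadEnd_of_mem_openSegment {W : Set Plane} {p q x : Plane} (hpq : p ≠ q)
    (hx : x ∈ openSegment ℝ p q) (hW : segment ℝ p q ⊆ W) : NoDeadEnd W x := by
  intro d hd
  have hev := eventually_add_smul_mem_openSegment hx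
  rcases lt_trichotomy (cross d (q - p)) 0 with h | h | h
  · left
    have h1 : ∀ᶠ t : ℝ in 𝓝[<] 0, x + t • (q - p) ∈ W ∧ 0 < cross d (x + t • (q - p) - x) := by
      filter_upwards [hev.filter_mono nhdsWithin_le_nhds, self_mem_nhdsWithin] with t ht ht0
      refine ⟨hW (openSegment_subset_segment _ _ _ ht), ?_⟩
      rw [add_sub_cancel_left, cross_smul_right]
      exact mul_pos_of_neg_of_neg ht0 h
    exact ((tendsto_add_smul x (q - p)).mono_left nhdsWithin_le_nhds).frequently h1.frequently
  · right
    obtain ⟨s, hs⟩ := exists_smul_of_cross_eq_zero (sub_ne_zero.2 hpq.symm)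
      (x := d) (by rw [cross_swap, h, neg_zero])
    have : Tendsto (fun t : ℝ => t * s) (𝓝 0) (𝓝 0) := by
      have h : Continuous fun t : ℝ => t * s := by fun_prop
      simpa using h.tendsto 0
    filter_upwards [this.eventually hev] with t ht
    rw [hs, smul_smul]
    exact hW (openSegment_subset_segment _ _ _ ht)
  · left
    have h1 : ∀ᶠ t : ℝ in 𝓝[>] 0, x + t • (q - p) ∈ W ∧ 0 < cross d (x + t • (q - p) - x) := by
      filter_upwards [hev.filter_mono nhdsWithin_le_nhds, self_mem_nhdsWithin] with t ht ht0
      refine ⟨hW (openSegment_subset_segment _ _ _ ht), ?_⟩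
      rw [add_sub_cancel_left, cross_smul_right]
      exact mul_pos ht0 h
    exact ((tendsto_add_smul x (q - p)).mono_left nhdsWithin_le_nhds).frequently h1.frequently

/-! ### Matchings and lines -/

/-- A plane perfect matching on a finite set `P` of points in general position, given by the map
`π` that takes each point to its partner, and a line, directed by the unit vector `τ`, that avoids
`P`. The sign `σ` is `1` for blue points and `-1` for red ones. A large disk centred at a point of
the line contains `P`; its complement carries the label `ω`. -/
structure Config where
  P : Finset Plane
  π : Plane → Plane
  σ : Plane → ℤ
  center : Plane
  τ : Plane
  radius : ℝ
  ω : Bool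
  partner_mem : ∀ v ∈ P, π v ∈ P
  partner_partner : ∀ v ∈ P, π (π v) = v
  partner_ne : ∀ v ∈ P, π v ≠ v
  sign_partner : ∀ v ∈ P, σ (π v) = - σ v
  sign_eq : ∀ v ∈ P, σ v = 1 ∨ σ v = -1
  cross_ne : ∀ u ∈ P, ∀ v ∈ P, ∀ w ∈ P, u ≠ v → u ≠ w → v ≠ w → cross (v - u) (w - u) ≠ 0
  disjoint_edges : ∀ u ∈ P, ∀ v ∈ P, u ≠ v → u ≠ π v →
    Disjoint (segment ℝ u (π u)) (segment ℝ v (π v))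
  norm_τ : ‖τ‖ = 1
  cross_τ_ne : ∀ v ∈ P, cross (v - center) τ ≠ 0
  subset_ball : ∀ v ∈ P, v ∈ Metric.ball center radius

namespace Config

variable (c : Config)

/-- The edge of the matching at the point `v`. -/
def edge (v : Plane) : Set Plane := segment ℝ v (c.π v)

/-- The union of the edges of the matching. -/
def edges : Set Plane := ⋃ v ∈ c.P, c.edge v

/-- The disk that contains everything of interest. -/
def Ω : Set Plane := Metric.ball c.center c.radius

/-- Positive to the left of the edge at `v`, directed from blue to red, and negative to its
right. -/
def side (v x : Plane) : ℝ := c.σ v * cross (c.π v - v) (x - v)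

/-- The point with parameter `s` of the line. -/
def line (s : ℝ) : Plane := c.center + s • c.τ

/-- The union of the edges and the plain walls, where `K a` is the union of the plain walls with
label `a`. -/
def walls (K : Bool → Set Plane) : Set Plane := c.edges ∪ (K true ∪ K false)

/-- The label `a` of the wall point `x`, as seen from `o`: the left hand sides of edges (directed
from blue to red) have label `true`, the right hand sides have label `false`. -/
def Lab (K : Bool → Set Plane) (o x : Plane) (a : Bool) : Prop :=
  (x ∉ c.Ω ∧ a = c.ω) ∨ (x ∈ c.Ω ∧ ∃ v ∈ c.P, x ∈ c.edge v ∧ (0 < c.side v o ↔ a = true)) ∨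
    (x ∈ c.Ω ∧ x ∉ c.edges ∧ x ∈ K a)

variable {c}

theorem isOpen_Ω : IsOpen c.Ω := Metric.isOpen_ball

theorem convex_Ω : Convex ℝ c.Ω := convex_ball _ _

theorem tip_mem_Ω {v : Plane} (hv : v ∈ c.P) : v ∈ c.Ω := c.subset_ball v hv

theorem edge_subset_Ω {v : Plane} (hv : v ∈ c.P) : c.edge v ⊆ c.Ω :=
  convex_Ω.segment_subset (tip_mem_Ω hv) (tip_mem_Ω (c.partner_mem v hv))

theorem isClosed_edge (v : Plane) : IsClosed (c.edge v) := isClosed_segment _ _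

theorem isClosed_edges : IsClosed c.edges := by
  unfold edges
  exact c.P.finite_toSet.isClosed_biUnion fun v _ => isClosed_edge v

theorem mem_edges {x : Plane} : x ∈ c.edges ↔ ∃ v ∈ c.P, x ∈ c.edge v := by
  simp [edges]

theorem tip_mem_edge (v : Plane) : v ∈ c.edge v := left_mem_segment _ _ _

theorem edge_partner {v : Plane} (hv : v ∈ c.P) : c.edge (c.π v) = c.edge v := by
  unfold edge; rw [c.partner_partner v hv, segment_symm]

theorem tip_mem_edges {v : Plane} (hv : v ∈ c.P) : v ∈ c.edges :=
  mem_edges.2 ⟨v, hv, tip_mem_edge v⟩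

theorem sign_ne_zero {v : Plane} (hv : v ∈ c.P) : (c.σ v : ℝ) ≠ 0 := by
  rcases c.sign_eq v hv with h | h <;> simp [h]

theorem continuous_side (v : Plane) : Continuous (c.side v) := by
  unfold side
  exact continuous_const.mul (Continuous.cross continuous_const (by fun_prop))

theorem side_add_smul (v x y : Plane) (t : ℝ) :
    c.side v (x + t • (y - x)) = c.side v x + t * (c.side v y - c.side v x) := by
  simp only [side, cross_sub_right, cross_add_right, cross_smul_right]; ring

theorem side_add_smul' (v x y : Plane) (t : ℝ) :
    c.side v (x + t • y) = c.side v x + t * (c.σ v * cross (c.π v - v) y) := by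
  simp only [side, cross_sub_right, cross_add_right, cross_smul_right]; ring

theorem side_partner {v : Plane} (hv : v ∈ c.P) (x : Plane) : c.side (c.π v) x = c.side v x := by
  simp only [side, c.partner_partner v hv, c.sign_partner v hv, Int.cast_neg, cross_sub_left,
    cross_sub_right, cross_self]
  rw [cross_swap (c.π v) v]; ring

theorem side_eq_zero_iff {v x : Plane} (hv : v ∈ c.P) :
    c.side v x = 0 ↔ ∃ t : ℝ, x = v + t • (v - c.π v) := by
  unfold side
  rw [mul_eq_zero, or_iff_right (sign_ne_zero hv)]
  constructor
  · intro h
    obtain ⟨t, ht⟩ := exists_smul_of_cross_eq_zero (sub_ne_zero.2 (c.partner_ne v hv)) h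
    refine ⟨-t, ?_⟩
    rw [neg_smul, ← smul_neg, neg_sub, ← ht]; abel
  · rintro ⟨t, rfl⟩
    rw [add_sub_cancel_left, cross_smul_right, ← neg_sub, cross_neg_left, cross_self, neg_zero,
      mul_zero]

theorem side_of_mem_edge {v x : Plane} (hx : x ∈ c.edge v) : c.side v x = 0 := by
  obtain ⟨t, -, -, rfl⟩ := mem_segment_iff.1 hx
  simp [side, cross_smul_right]

theorem side_tip_ne {u v : Plane} (hv : v ∈ c.P) (hu : u ∈ c.P) (h1 : u ≠ v) (h2 : u ≠ c.π v) :
    c.side v u ≠ 0 := by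
  unfold side
  exact mul_ne_zero (sign_ne_zero hv) (c.cross_ne v hv (c.π v) (c.partner_mem v hv) u hu
    (c.partner_ne v hv).symm h1.symm h2.symm)

theorem eq_or_eq_partner {u v x : Plane} (hu : u ∈ c.P) (hv : v ∈ c.P) (hxu : x ∈ c.edge u)
    (hxv : x ∈ c.edge v) : u = v ∨ u = c.π v := by
  by_contra! h
  exact (c.disjoint_edges u hu v hv h.1 h.2).le_bot ⟨hxu, hxv⟩

theorem edge_eq {u v x : Plane} (hu : u ∈ c.P) (hv : v ∈ c.P) (hxu : x ∈ c.edge u)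
    (hxv : x ∈ c.edge v) : c.edge u = c.edge v := by
  rcases eq_or_eq_partner hu hv hxu hxv with rfl | rfl
  · rfl
  · exact edge_partner hv

theorem side_eq {u v x : Plane} (hu : u ∈ c.P) (hv : v ∈ c.P) (hxu : x ∈ c.edge u)
    (hxv : x ∈ c.edge v) : c.side u = c.side v := by
  rcases eq_or_eq_partner hu hv hxu hxv with rfl | rfl
  · rfl
  · exact funext fun y => side_partner hv y

/-- The relative interior of an edge does not contain points of `P`. -/
theorem tip_of_mem_edge {u v : Plane} (hu : u ∈ c.P) (hv : v ∈ c.P) (h : u ∈ c.edge v) :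
    u = v ∨ u = c.π v :=
  eq_or_eq_partner hu hv (tip_mem_edge u) h

theorem not_mem_P_of_mem_openSegment {v x : Plane} (hv : v ∈ c.P)
    (hx : x ∈ openSegment ℝ v (c.π v)) : x ∉ c.P := by
  intro hxP
  have h := tip_of_mem_edge hxP hv (openSegment_subset_segment _ _ _ hx)
  have hne : v ≠ c.π v := (c.partner_ne v hv).symm
  rcases h with rfl | h
  · exact hne (left_mem_openSegment_iff.1 hx)
  · rw [h] at hx
    exact hne (right_mem_openSegment_iff.1 hx)

/-- Near a point of an edge, no other edges are present. -/
theorem eventually_edges_near {v x : Plane} (hv : v ∈ c.P) (hx : x ∈ c.edge v) :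
    ∀ᶠ y in 𝓝 x, y ∈ c.edges → y ∈ c.edge v := by
  have h : ∀ u ∈ c.P, ∀ᶠ y in 𝓝 x, y ∈ c.edge u → y ∈ c.edge v := by
    intro u hu
    by_cases hxu : x ∈ c.edge u
    · rw [edge_eq hu hv hxu hx]; simp
    · filter_upwards [(isClosed_edge u).isOpen_compl.mem_nhds hxu] with y hy hy'
      exact absurd hy' hy
  filter_upwards [(c.P.eventually_all).2 h] with y hy hy'
  obtain ⟨u, hu, hyu⟩ := mem_edges.1 hy'
  exact hy u hu hyu

theorem walls_mono {K K' : Bool → Set Plane} (h : ∀ a, K a ⊆ K' a) : c.walls K ⊆ c.walls K' :=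
  union_subset_union_right _ (union_subset_union (h _) (h _))

theorem mem_walls_of_mem {K : Bool → Set Plane} {a : Bool} {x : Plane} (h : x ∈ K a) :
    x ∈ c.walls K := by
  cases a
  · exact Or.inr (Or.inr h)
  · exact Or.inr (Or.inl h)

theorem mem_walls_iff {K : Bool → Set Plane} {x : Plane} :
    x ∈ c.walls K ↔ x ∈ c.edges ∨ ∃ a, x ∈ K a := by
  simp [walls, or_comm]

theorem Lab.mono {K K' : Bool → Set Plane} (h : ∀ a, K a ⊆ K' a) {o x : Plane} {a : Bool}
    (hl : c.Lab K o x a) : c.Lab K' o x a := by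
  rcases hl with hl | hl | hl
  · exact Or.inl hl
  · exact Or.inr (Or.inl hl)
  · exact Or.inr (Or.inr ⟨hl.1, hl.2.1, h _ hl.2.2⟩)

theorem Lab.mem_walls {K : Bool → Set Plane} {o x : Plane} {a : Bool} (hl : c.Lab K o x a)
    (hx : x ∈ c.Ω) : x ∈ c.walls K := by
  rcases hl with hl | ⟨-, v, hv, hxv, -⟩ | hl
  · exact absurd hx hl.1
  · exact Or.inl (mem_edges.2 ⟨v, hv, hxv⟩)
  · exact mem_walls_of_mem hl.2.2

theorem exists_lab {K : Bool → Set Plane} (o : Plane) {x : Plane} (h : x ∈ c.Ω → x ∈ c.walls K) :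
    ∃ a, c.Lab K o x a := by
  by_cases hx : x ∈ c.Ω
  · by_cases hM : x ∈ c.edges
    · obtain ⟨v, hv, hxv⟩ := mem_edges.1 hM
      exact ⟨decide (0 < c.side v o), Or.inr (Or.inl ⟨hx, v, hv, hxv, by simp⟩)⟩
    · rcases mem_walls_iff.1 (h hx) with h | ⟨a, ha⟩
      · exact absurd h hM
      · exact ⟨a, Or.inr (Or.inr ⟨hx, hM, ha⟩)⟩
  · exact ⟨c.ω, Or.inl ⟨hx, rfl⟩⟩

/-- The label at `x ∈ edge v` depends only on the side of the observer. -/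
theorem Lab.side_iff {K : Bool → Set Plane} {o x v : Plane} {a : Bool} (hl : c.Lab K o x a)
    (hv : v ∈ c.P) (hx : x ∈ c.edge v) : 0 < c.side v o ↔ a = true := by
  rcases hl with hl | ⟨-, u, hu, hxu, h⟩ | hl
  · exact absurd (edge_subset_Ω hv hx) hl.1
  · rwa [side_eq hu hv hxu hx] at h
  · exact absurd (mem_edges.2 ⟨v, hv, hx⟩) hl.2.1

theorem Lab.eq_of_not_mem {K : Bool → Set Plane} {o x : Plane} {a : Bool} (hl : c.Lab K o x a)
    (hx : x ∉ c.Ω) : a = c.ω := by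
  rcases hl with hl | hl | hl
  · exact hl.2
  · exact absurd hl.1 hx
  · exact absurd hl.1 hx

theorem Lab.mem_of_not_mem_edges {K : Bool → Set Plane} {o x : Plane} {a : Bool}
    (hl : c.Lab K o x a) (hx : x ∈ c.Ω) (hM : x ∉ c.edges) : x ∈ K a := by
  rcases hl with hl | ⟨-, v, hv, hxv, -⟩ | hl
  · exact absurd hx hl.1
  · exact absurd (mem_edges.2 ⟨v, hv, hxv⟩) hM
  · exact hl.2.2

/-- On a segment that ends at the line of the edge at `v`, the side does not change. -/
theorem side_pos_iff_of_mem_segment {v o x y : Plane} (hx : c.side v x = 0)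
    (hy : y ∈ segment ℝ o x) (h0 : c.side v y ≠ 0) : 0 < c.side v y ↔ 0 < c.side v o := by
  obtain ⟨t, -, h1, rfl⟩ := mem_segment_iff.1 hy
  rw [side_add_smul, hx] at h0 ⊢
  have ht : t ≠ 1 := by rintro rfl; apply h0; ring
  have h2 : 0 < 1 - t := sub_pos.2 (lt_of_le_of_ne h1 ht)
  have : c.side v o + t * (0 - c.side v o) = (1 - t) * c.side v o := by ring
  rw [this]
  exact mul_pos_iff_of_pos_left h2

/-! ### Systems of labelled walls -/

/-- `K` is a consistent system of labelled plain walls for the matching of `c`, in which the edges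
of the matching have been extended beyond the points of `D`. The labels of plain walls agree where
they meet, apart from edges of the matching (and plain walls only leave `Ω` with label `ω`), and
agree with the label of the side of an edge which they meet (`side`). Near a point of `D`, there is
nothing but its edge and the extension thereof (`door`). Dead ends are the remaining points of
`P` only. -/
structure Core (c : Config) (K : Bool → Set Plane) (D : Finset Plane) : Prop where
  closed : ∀ a, IsClosed (K a)
  out : ∀ a, ∀ x ∉ c.Ω, x ∈ K a → a = c.ω
  uniq : ∀ x ∈ c.Ω, x ∉ c.edges → ∀ a b, x ∈ K a → x ∈ K b → a = b
  side : ∀ v ∈ c.P, ∀ x ∈ openSegment ℝ v (c.π v), ∀ a, ∀ᶠ y in 𝓝 x, y ∈ K a →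
    c.side v y ≠ 0 → (0 < c.side v y ↔ a = true)
  fresh : ∀ v ∈ c.P, v ∉ D → ∀ a, v ∉ K a
  door : ∀ v ∈ c.P, v ∈ D → ∃ a, (∀ᶠ t : ℝ in 𝓝[≥] 0, v + t • (v - c.π v) ∈ K a) ∧
    ∀ᶠ y in 𝓝 v, ∀ a', y ∈ K a' → a' = a ∧ ∃ t : ℝ, 0 ≤ t ∧ y = v + t • (v - c.π v)
  noDeadEnd : ∀ x ∈ c.Ω, x ∈ c.walls K → (x ∈ c.P → x ∈ D) → NoDeadEnd (c.walls K) x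

theorem Core.isClosed_walls {K : Bool → Set Plane} {D : Finset Plane} (h : Core c K D) :
    IsClosed (c.walls K) :=
  isClosed_edges.union ((h.closed _).union (h.closed _))

theorem core_empty : Core c (fun _ => ∅) ∅ where
  closed _ := isClosed_empty
  out _ _ _ h := absurd h (notMem_empty _)
  uniq _ _ _ _ _ h := absurd h (notMem_empty _)
  side _ _ _ _ _ := by simp
  fresh _ _ _ _ := notMem_empty _
  door _ _ h := absurd h (Finset.notMem_empty _)
  noDeadEnd x _ hx hP := by
    rcases mem_walls_iff.1 hx with h | ⟨a, h⟩
    · obtain ⟨v, hv, hxv⟩ := mem_edges.1 h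
      have hxP : x ∉ c.P := fun h => Finset.notMem_empty _ (hP h)
      refine noDeadEnd_of_mem_openSegment (c.partner_ne v hv).symm (p := v) (q := c.π v) ?_ ?_
      · rcases mem_segment_cases hxv with rfl | rfl | h
        · exact absurd hv hxP
        · exact absurd (c.partner_mem v hv) hxP
        · exact h
      · exact fun y hy => Or.inl (mem_edges.2 ⟨v, hv, hy⟩)
    · exact absurd h (notMem_empty _)

/-- The system of plain walls `K` with an additional wall from `p` to `q` with label `a`. -/
def addWall (K : Bool → Set Plane) (a : Bool) (p q : Plane) : Bool → Set Plane :=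
  fun b => {x | x ∈ K b ∨ (b = a ∧ x ∈ segment ℝ p q)}

theorem subset_addWall (K : Bool → Set Plane) (a : Bool) (p q : Plane) (b : Bool) :
    K b ⊆ addWall K a p q b := fun _ hx => Or.inl hx

theorem segment_subset_addWall (K : Bool → Set Plane) (a : Bool) (p q : Plane) :
    segment ℝ p q ⊆ addWall K a p q a := fun _ hx => Or.inr ⟨rfl, hx⟩

theorem mem_walls_addWall {K : Bool → Set Plane} {a : Bool} {p q x : Plane} :
    x ∈ c.walls (addWall K a p q) ↔ x ∈ c.walls K ∨ x ∈ segment ℝ p q := by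
  simp only [mem_walls_iff, addWall, mem_ofPred_eq]
  constructor
  · rintro (h | ⟨b, h | h⟩)
    · exact Or.inl (Or.inl h)
    · exact Or.inl (Or.inr ⟨b, h⟩)
    · exact Or.inr h.2
  · rintro ((h | ⟨b, h⟩) | h)
    · exact Or.inl h
    · exact Or.inr ⟨b, Or.inl h⟩
    · exact Or.inr ⟨a, Or.inr ⟨rfl, h⟩⟩

/-- A wall may be added from `p` to `q` across free space, if its label agrees with what it hits at
`q`, and likewise at `p`, or if it is the extension of the edge at `p` (and the first one). -/
theorem Core.addWall {K : Bool → Set Plane} {D D' : Finset Plane} (h : Core c K D)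
    {p q : Plane} {a : Bool} (hpq : p ≠ q)
    (hfree : ∀ x ∈ openSegment ℝ p q, x ∈ c.Ω ∧ x ∉ c.walls K)
    (hqP : q ∉ c.P) (hq : c.Lab K p q a)
    (hp : (p ∉ c.P ∧ c.Lab K q p a ∧ D' = D) ∨
      (p ∈ c.P ∧ p ∉ D ∧ (∃ t : ℝ, 0 < t ∧ q = p + t • (p - c.π p)) ∧ D' = insert p D)) :
    Core c (Config.addWall K a p q) D' := by
  have tips : ∀ v ∈ c.P, v ∈ segment ℝ p q → v = p := by
    intro v hv hvs
    rcases mem_segment_cases hvs with rfl | rfl | h1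
    · rfl
    · exact absurd hv hqP
    · exact absurd (Or.inl (tip_mem_edges hv)) (hfree v h1).2
  have hDD : D ⊆ D' := by
    rcases hp with ⟨-, -, rfl⟩ | ⟨-, -, -, rfl⟩
    · exact Finset.Subset.refl _
    · exact Finset.subset_insert _ _
  constructor
  case closed =>
    intro b
    by_cases hb : b = a
    · have : Config.addWall K a p q b = K b ∪ segment ℝ p q := by
        ext x; simp [Config.addWall, hb]
      rw [this]; exact (h.closed b).union (isClosed_segment p q)
    · have : Config.addWall K a p q b = K b := by
        ext x; simp [Config.addWall, hb]
      rw [this]; exact h.closed b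
  case out =>
    rintro b x hx (hxK | ⟨rfl, hxs⟩)
    · exact h.out b x hx hxK
    · rcases mem_segment_cases hxs with rfl | rfl | h1
      · rcases hp with ⟨-, hl, -⟩ | ⟨hpP, -⟩
        · exact hl.eq_of_not_mem hx
        · exact absurd (tip_mem_Ω hpP) hx
      · exact hq.eq_of_not_mem hx
      · exact absurd (hfree x h1).1 hx
  case uniq =>
    intro x hx hxM
    have key : ∀ b, x ∈ segment ℝ p q → x ∈ K b → b = a := by
      intro b hxs hxb
      rcases mem_segment_cases hxs with rfl | rfl | h1
      · rcases hp with ⟨-, hl, -⟩ | ⟨hpP, -⟩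
        · exact h.uniq x hx hxM _ _ hxb (hl.mem_of_not_mem_edges hx hxM)
        · exact absurd (tip_mem_edges hpP) hxM
      · exact h.uniq x hx hxM _ _ hxb (hq.mem_of_not_mem_edges hx hxM)
      · exact absurd (mem_walls_of_mem hxb) (hfree x h1).2
    rintro b b' (h1 | ⟨rfl, h1⟩) (h2 | ⟨rfl, h2⟩)
    · exact h.uniq x hx hxM _ _ h1 h2
    · exact key _ h2 h1
    · exact (key _ h1 h2).symm
    · rfl
  case side =>
    intro v hv x hx b
    have hxP := not_mem_P_of_mem_openSegment hv hx
    have hxv : x ∈ c.edge v := openSegment_subset_segment _ _ _ hx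
    by_cases hxs : x ∈ segment ℝ p q
    · -- The new wall can meet the edge in one of its ends only. So it does not change sides.
      have key : ∀ y ∈ segment ℝ p q, c.side v y ≠ 0 → (0 < c.side v y ↔ a = true) := by
        intro y hy h0
        rcases mem_segment_cases hxs with rfl | rfl | h1
        · rcases hp with ⟨-, hl, -⟩ | ⟨hpP, -⟩
          · rw [segment_symm] at hy
            rw [side_pos_iff_of_mem_segment (side_of_mem_edge hxv) hy h0]
            exact hl.side_iff hv hxv
          · exact absurd hpP hxP
        · rw [side_pos_iff_of_mem_segment (side_of_mem_edge hxv) hy h0]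
          exact hq.side_iff hv hxv
        · exact absurd (Or.inl (mem_edges.2 ⟨v, hv, hxv⟩)) (hfree x h1).2
      filter_upwards [h.side v hv x hx b] with y hy
      rintro (hyK | ⟨rfl, hys⟩) h0
      · exact hy hyK h0
      · exact key y hys h0
    · filter_upwards [h.side v hv x hx b, (isClosed_segment p q).isOpen_compl.mem_nhds hxs]
        with y hy hys
      rintro (hyK | ⟨-, hy'⟩) h0
      · exact hy hyK h0
      · exact absurd hy' hys
  case fresh =>
    rintro v hv hvD b (hvK | ⟨-, hvs⟩)
    · exact h.fresh v hv (fun h => hvD (hDD h)) b hvK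
    · obtain rfl := tips v hv hvs
      rcases hp with ⟨hpP, -⟩ | ⟨-, -, -, rfl⟩
      · exact hpP hv
      · exact hvD (Finset.mem_insert_self _ _)
  case door =>
    intro v hv hvD
    by_cases hvD0 : v ∈ D
    · obtain ⟨b, h1, h2⟩ := h.door v hv hvD0
      have hvs : v ∉ segment ℝ p q := by
        intro hvs
        obtain rfl := tips v hv hvs
        rcases hp with ⟨hpP, -⟩ | ⟨-, hpD, -⟩
        · exact hpP hv
        · exact hpD hvD0
      refine ⟨b, h1.mono fun t ht => Or.inl ht, ?_⟩
      filter_upwards [h2, (isClosed_segment p q).isOpen_compl.mem_nhds hvs] with y hy hys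
      rintro b' (hyK | ⟨-, hy'⟩)
      · exact hy b' hyK
      · exact absurd hy' hys
    · rcases hp with ⟨-, -, rfl⟩ | ⟨hpP, hpD, ⟨t, ht, rfl⟩, rfl⟩
      · exact absurd hvD hvD0
      · obtain rfl : v = p := by
          rcases Finset.mem_insert.1 hvD with h | h
          · exact h
          · exact absurd h hvD0
        refine ⟨a, ?_, ?_⟩
        · have : Iic t ∈ 𝓝[≥] (0 : ℝ) := mem_nhdsWithin_of_mem_nhds (Iic_mem_nhds ht)
          filter_upwards [this, self_mem_nhdsWithin] with s hs hs0
          refine Or.inr ⟨rfl, mem_segment_iff.2 ⟨s / t, div_nonneg hs0 ht.le,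
            (div_le_one ht).2 hs, ?_⟩⟩
          rw [add_sub_cancel_left, smul_smul, div_mul_cancel₀ _ ht.ne']
        · -- By `fresh`, the older plain walls keep away from `v`.
          have hev : ∀ᶠ y in 𝓝 v, ∀ b, y ∉ K b :=
            eventually_all.2 fun b => (h.closed b).isOpen_compl.mem_nhds (h.fresh v hv hpD b)
          filter_upwards [hev] with y hy
          rintro b' (hyK | ⟨rfl, hys⟩)
          · exact absurd hyK (hy b')
          · refine ⟨rfl, ?_⟩
            obtain ⟨s, h0, -, rfl⟩ := mem_segment_iff.1 hys
            exact ⟨s * t, by positivity, by rw [add_sub_cancel_left, smul_smul]⟩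
  case noDeadEnd =>
    intro x hx hxW hxP
    have hmono : c.walls K ⊆ c.walls (Config.addWall K a p q) := walls_mono (subset_addWall K a p q)
    by_cases hxp : x = p ∧ x ∈ c.P
    · obtain ⟨rfl, hxP'⟩ := hxp
      rcases hp with ⟨hpP, -⟩ | ⟨hpP, hpD, ⟨t, ht, rfl⟩, rfl⟩
      · exact absurd hxP' hpP
      · -- The point `x` is an interior point of the segment formed by its edge and the new wall.
        set d := x - c.π x with hd
        have hd0 : d ≠ 0 := sub_ne_zero.2 (c.partner_ne x hxP').symm
        have e1 : x + t • d - c.π x = (1 + t) • d := by rw [add_smul, one_smul, hd]; abel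
        have hx' : x = c.π x + (1 / (1 + t)) • (x + t • d - c.π x) := by
          rw [e1, smul_smul, one_div, inv_mul_cancel₀ (by positivity), one_smul, hd]; abel
        refine noDeadEnd_of_mem_openSegment (p := c.π x) (q := x + t • d) ?_ ?_ ?_
        · intro h0
          rw [← h0, sub_self] at e1
          exact smul_ne_zero (by positivity) hd0 e1.symm
        · refine mem_openSegment_iff.2 ⟨1 / (1 + t), by positivity, ?_, hx'⟩
          rw [div_lt_one (by positivity)]; linarith
        · intro y hy
          obtain ⟨s, hs0, hs1, rfl⟩ := mem_segment_iff.1 hy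
          rw [mem_walls_addWall]
          rw [e1]
          rcases le_total (s * (1 + t)) 1 with hs | hs
          · left; left
            refine mem_edges.2 ⟨c.π x, c.partner_mem x hxP', ?_⟩
            unfold edge
            rw [c.partner_partner x hxP']
            exact mem_segment_iff.2 ⟨s * (1 + t), by positivity, hs, by rw [smul_smul]⟩
          · right
            refine mem_segment_iff.2 ⟨(s * (1 + t) - 1) / t, div_nonneg (by linarith) ht.le, ?_, ?_⟩
            · rw [div_le_one ht]; nlinarith
            · rw [add_sub_cancel_left, smul_smul, smul_smul, div_mul_cancel₀ _ ht.ne', sub_smul,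
                one_smul, hd]
              abel
    · have hold : x ∈ c.walls K → NoDeadEnd (c.walls (Config.addWall K a p q)) x := by
        intro hxW
        refine (h.noDeadEnd x hx hxW fun hxP' => ?_).mono hmono
        have := hxP hxP'
        rcases hp with ⟨-, -, rfl⟩ | ⟨-, -, -, rfl⟩
        · exact this
        · rcases Finset.mem_insert.1 this with rfl | h
          · exact absurd ⟨rfl, hxP'⟩ hxp
          · exact h
      rcases mem_walls_addWall.1 hxW with hxW | hxs
      · exact hold hxW
      · rcases mem_segment_cases hxs with rfl | rfl | h1
        · rcases hp with ⟨-, hl, -⟩ | ⟨hpP, -⟩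
          · exact hold (hl.mem_walls hx)
          · exact absurd ⟨rfl, hpP⟩ hxp
        · exact hold (hq.mem_walls hx)
        · exact noDeadEnd_of_mem_openSegment hpq h1
            ((segment_subset_addWall K a p q).trans fun y hy => mem_walls_of_mem hy)

/-! ### Gaps of the line -/

theorem τ_ne_zero : c.τ ≠ 0 := by
  intro h; have := c.norm_τ; simp [h] at this

theorem line_injective : Function.Injective c.line := by
  intro s t h
  have : (s - t) • c.τ = 0 := by
    rw [sub_smul, sub_eq_zero]; exact add_left_cancel h
  exact sub_eq_zero.1 ((smul_eq_zero.1 this).resolve_right τ_ne_zero)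

theorem cross_line (s : ℝ) : cross (c.line s - c.center) c.τ = 0 := by
  simp [line, cross_smul_left]

theorem line_not_mem_P (s : ℝ) : c.line s ∉ c.P := fun h => c.cross_τ_ne _ h (cross_line s)

theorem line_add_smul (s t u : ℝ) :
    c.line s + u • (c.line t - c.line s) = c.line (s + u * (t - s)) := by
  simp only [line, add_smul, mul_smul, sub_smul, smul_sub, smul_add]; abel

theorem line_mem_segment {s t u : ℝ} (hst : s < t) :
    c.line u ∈ segment ℝ (c.line s) (c.line t) ↔ s ≤ u ∧ u ≤ t := by
  have h0 : 0 < t - s := sub_pos.2 hst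
  rw [mem_segment_iff]
  constructor
  · rintro ⟨r, h1, h2, h3⟩
    rw [line_add_smul] at h3
    rw [line_injective h3]
    constructor <;> nlinarith
  · rintro ⟨h1, h2⟩
    refine ⟨(u - s) / (t - s), div_nonneg (by linarith) h0.le, (div_le_one h0).2 (by linarith), ?_⟩
    rw [line_add_smul, div_mul_cancel₀ _ h0.ne']; congr 1; ring

theorem exists_of_mem_openSegment_line {s t : ℝ} (hst : s < t) {x : Plane}
    (hx : x ∈ openSegment ℝ (c.line s) (c.line t)) : ∃ u ∈ Ioo s t, x = c.line u := by
  obtain ⟨r, h1, h2, rfl⟩ := mem_openSegment_iff.1 hx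
  refine ⟨_, ⟨?_, ?_⟩, line_add_smul s t r⟩ <;> nlinarith

/-- The line of an edge meets the given line at most once. -/
theorem line_eq_of_side_eq_zero {v : Plane} (hv : v ∈ c.P) {s t : ℝ}
    (hs : c.side v (c.line s) = 0) (ht : c.side v (c.line t) = 0) : s = t := by
  by_contra hst
  obtain ⟨r, hr⟩ := (side_eq_zero_iff hv).1 hs
  obtain ⟨r', hr'⟩ := (side_eq_zero_iff hv).1 ht
  have h1 : (s - t) • c.τ = (r - r') • (v - c.π v) := by
    have : c.line s - c.line t = (r - r') • (v - c.π v) := by rw [hr, hr', sub_smul]; abel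
    rw [← this]; simp only [line, sub_smul]; abel
  have h2 : c.τ = ((s - t)⁻¹ * (r - r')) • (v - c.π v) := by
    rw [mul_smul, ← h1, smul_smul, inv_mul_cancel₀ (sub_ne_zero.2 hst), one_smul]
  have h3 : v - c.center = s • c.τ - r • (v - c.π v) := by
    have : v = c.line s - r • (v - c.π v) := by rw [hr]; abel
    nth_rewrite 1 [this]; simp only [line]; abel
  apply c.cross_τ_ne v hv
  rw [h3, cross_sub_left, cross_smul_left, cross_self, h2, cross_smul_left, cross_smul_right,
    cross_self]
  simp

/-- The open intervals `(α j, β j)`, `j ∈ J`, of the line are the components of what the walls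
leave of the line within `Ω`. The label at the lower end of the gap `j` is `A j`, at its upper end
it is `A' j`. -/
structure Gaps (c : Config) (K : Bool → Set Plane) {ι : Type*} (A A' : ι → Bool) (J : Finset ι)
    (α β : ι → ℝ) : Prop where
  lt : ∀ j ∈ J, α j < β j
  free : ∀ j ∈ J, ∀ s ∈ Ioo (α j) (β j), c.line s ∈ c.Ω ∧ c.line s ∉ c.walls K
  cover : ∀ s, c.line s ∈ c.Ω → c.line s ∉ c.walls K → ∃ j ∈ J, s ∈ Ioo (α j) (β j)
  low : ∀ j ∈ J, ∀ s ∈ Ioo (α j) (β j), c.Lab K (c.line s) (c.line (α j)) (A j)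
  up : ∀ j ∈ J, ∀ s ∈ Ioo (α j) (β j), c.Lab K (c.line s) (c.line (β j)) (A' j)
  disjoint : ∀ i ∈ J, ∀ j ∈ J, i ≠ j → Disjoint (Ioo (α i) (β i)) (Ioo (α j) (β j))

section

variable {K : Bool → Set Plane} {ι : Type*} {A A' : ι → Bool} {J : Finset ι} {α β : ι → ℝ}
  {D : Finset Plane}

theorem Lab.line_not_free {o : Plane} {a : Bool} {s : ℝ} (h : c.Lab K o (c.line s) a) :
    ¬ (c.line s ∈ c.Ω ∧ c.line s ∉ c.walls K) := fun h' => h'.2 (h.mem_walls h'.1)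

theorem Gaps.mid_mem (hG : Gaps c K A A' J α β) {j : ι} (hj : j ∈ J) :
    (α j + β j) / 2 ∈ Ioo (α j) (β j) := by
  have := hG.lt j hj
  constructor <;> linarith

/-- Intervals of `J` that meet the closure of the interval `j` coincide with it. -/
theorem Gaps.eq_of_mem_Icc (hG : Gaps c K A A' J α β) {i j : ι} (hi : i ∈ J) (hj : j ∈ J) {s : ℝ}
    (hs : s ∈ Ioo (α i) (β i)) (hs' : s ∈ Icc (α j) (β j)) : i = j := by
  by_contra hij
  have hf := hG.free i hi s hs
  rcases eq_or_lt_of_le hs'.1 with rfl | h1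
  · exact (hG.low j hj _ (hG.mid_mem hj)).line_not_free hf
  rcases eq_or_lt_of_le hs'.2 with rfl | h2
  · exact (hG.up j hj _ (hG.mid_mem hj)).line_not_free hf
  exact Set.disjoint_left.1 (hG.disjoint i hi j hj hij) hs ⟨h1, h2⟩

/-- A gap whose ends have the same label can be closed. -/
theorem Gaps.close [DecidableEq ι] (hK : Core c K D) (hG : Gaps c K A A' J α β) {j : ι}
    (hj : j ∈ J) (hA : A j = A' j) :
    ∃ K', Core c K' D ∧ Gaps c K' A A' (J.erase j) α β := by
  have hlt := hG.lt j hj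
  have hmid := hG.mid_mem hj
  have lowLab := hG.low j hj _ hmid
  have upLab := hG.up j hj _ hmid
  rw [← hA] at upLab
  -- The label at an end of the gap is the same for an observer in the gap or at its other end.
  have change : ∀ {s t u : ℝ}, s ≠ t → c.Lab K (c.line s) (c.line t) (A j) →
      c.line s ∈ openSegment ℝ (c.line u) (c.line t) → c.Lab K (c.line u) (c.line t) (A j) := by
    intro s t u hst hl hs
    rcases hl with hl | ⟨hΩ, v, hv, hxv, hl⟩ | hl
    · exact Or.inl hl
    · refine Or.inr (Or.inl ⟨hΩ, v, hv, hxv, ?_⟩)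
      rw [← hl, side_pos_iff_of_mem_segment (side_of_mem_edge hxv)
        (openSegment_subset_segment _ _ _ hs)
        fun h0 => hst (line_eq_of_side_eq_zero hv h0 (side_of_mem_edge hxv))]
    · exact Or.inr (Or.inr hl)
  have free : ∀ x ∈ openSegment ℝ (c.line (α j)) (c.line (β j)), x ∈ c.Ω ∧ x ∉ c.walls K := by
    intro x hx
    obtain ⟨s, hs, rfl⟩ := exists_of_mem_openSegment_line hlt hx
    exact hG.free j hj s hs
  have hmem : c.line ((α j + β j) / 2) ∈ openSegment ℝ (c.line (α j)) (c.line (β j)) := by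
    refine mem_openSegment_iff.2 ⟨1 / 2, by norm_num, by norm_num, ?_⟩
    rw [line_add_smul]; congr 1; ring
  have upLab' : c.Lab K (c.line (α j)) (c.line (β j)) (A j) := change hmid.2.ne upLab hmem
  have lowLab' : c.Lab K (c.line (β j)) (c.line (α j)) (A j) :=
    change hmid.1.ne' lowLab (by rwa [openSegment_symm])
  refine ⟨addWall K (A j) (c.line (α j)) (c.line (β j)), ?_, ?_⟩
  · exact hK.addWall (fun h => hlt.ne (line_injective h)) free (line_not_mem_P _) upLab'
      (Or.inl ⟨line_not_mem_P _, lowLab', rfl⟩)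
  · constructor
    case lt => exact fun i hi => hG.lt i (Finset.mem_of_mem_erase hi)
    case free =>
      intro i hi s hs
      have hi' := Finset.mem_of_mem_erase hi
      refine ⟨(hG.free i hi' s hs).1, fun h => ?_⟩
      rcases mem_walls_addWall.1 h with h | h
      · exact (hG.free i hi' s hs).2 h
      · exact Finset.ne_of_mem_erase hi (hG.eq_of_mem_Icc hi' hj hs ((line_mem_segment hlt).1 h))
    case cover =>
      intro s hs hsK
      rw [mem_walls_addWall, not_or, line_mem_segment hlt] at hsK
      obtain ⟨i, hi, his⟩ := hG.cover s hs hsK.1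
      refine ⟨i, Finset.mem_erase.2 ⟨?_, hi⟩, his⟩
      rintro rfl
      exact hsK.2 ⟨his.1.le, his.2.le⟩
    case low =>
      exact fun i hi s hs =>
        (hG.low i (Finset.mem_of_mem_erase hi) s hs).mono (subset_addWall _ _ _ _)
    case up =>
      exact fun i hi s hs =>
        (hG.up i (Finset.mem_of_mem_erase hi) s hs).mono (subset_addWall _ _ _ _)
    case disjoint =>
      exact fun i hi k hk =>
        hG.disjoint i (Finset.mem_of_mem_erase hi) k (Finset.mem_of_mem_erase hk)

/-- All gaps whose ends have the same label can be closed. -/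
theorem Gaps.close_all [DecidableEq ι] (hK : Core c K D) (hG : Gaps c K A A' J α β) :
    ∃ K', Core c K' D ∧ Gaps c K' A A' (J.filter fun j => A j ≠ A' j) α β := by
  have key : ∀ T : Finset ι, T ⊆ J.filter (fun j => A j = A' j) →
      ∃ K', Core c K' D ∧ Gaps c K' A A' (J \ T) α β := by
    intro T
    induction T using Finset.induction_on with
    | empty => exact fun _ => ⟨K, hK, by simpa using hG⟩
    | insert j T hjT ih =>
      intro hT
      obtain ⟨K', hK', hG'⟩ := ih fun i hi => hT (Finset.mem_insert_of_mem hi)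
      have hj := Finset.mem_filter.1 (hT (Finset.mem_insert_self j T))
      obtain ⟨K'', hK'', hG''⟩ := hG'.close hK' (j := j) (Finset.mem_sdiff.2 ⟨hj.1, hjT⟩) hj.2
      refine ⟨K'', hK'', ?_⟩
      rwa [Finset.sdiff_insert]
  obtain ⟨K', hK', hG'⟩ := key _ Finset.Subset.rfl
  refine ⟨K', hK', ?_⟩
  convert hG' using 1
  ext j
  simp only [Finset.mem_filter, Finset.mem_sdiff]
  tauto

/-- New walls that fill all of the gap `j` but the interval `(α', β')`. -/
theorem Gaps.shrink [DecidableEq ι] (hG : Gaps c K A A' J α β) {K' : Bool → Set Plane}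
    (hKK' : ∀ a, K a ⊆ K' a) {j : ι} (hj : j ∈ J) {α' β' : ℝ} (h1 : α j ≤ α') (h2 : α' < β')
    (h3 : β' ≤ β j)
    (hnew : ∀ s, c.line s ∈ c.walls K' → c.line s ∈ c.walls K ∨
      (s ∈ Icc (α j) (β j) ∧ s ∉ Ioo α' β'))
    (hfill : ∀ s ∈ Ioo (α j) (β j), s ∉ Ioo α' β' → c.line s ∈ c.walls K')
    (hlow : ∀ s ∈ Ioo α' β', c.Lab K' (c.line s) (c.line α') (A j))
    (hup : ∀ s ∈ Ioo α' β', c.Lab K' (c.line s) (c.line β') (A' j)) :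
    Gaps c K' A A' J (Function.update α j α') (Function.update β j β') := by
  have hsub : ∀ i, Ioo (Function.update α j α' i) (Function.update β j β' i) ⊆ Ioo (α i) (β i) := by
    intro i
    by_cases hij : i = j
    · subst hij; simpa using Ioo_subset_Ioo h1 h3
    · simp [hij]
  constructor
  case lt =>
    intro i hi
    by_cases hij : i = j
    · subst hij; simpa using h2
    · simpa [hij] using hG.lt i hi
  case free =>
    intro i hi s hs
    have hs' := hsub i hs
    refine ⟨(hG.free i hi s hs').1, fun h => ?_⟩
    rcases hnew s h with h | ⟨h, h'⟩
    · exact (hG.free i hi s hs').2 h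
    · obtain rfl := hG.eq_of_mem_Icc hi hj hs' h
      exact h' (by simpa using hs)
  case cover =>
    intro s hs hsK
    obtain ⟨i, hi, his⟩ := hG.cover s hs fun h => hsK (walls_mono hKK' h)
    refine ⟨i, hi, ?_⟩
    by_cases hij : i = j
    · subst hij
      by_contra h
      exact hsK (hfill s his (by simpa using h))
    · simpa [hij] using his
  case low =>
    intro i hi s hs
    by_cases hij : i = j
    · subst hij; simpa using hlow s (by simpa using hs)
    · have := (hG.low i hi s (hsub i hs)).mono hKK'
      simpa [hij] using this
  case up =>
    intro i hi s hs
    by_cases hij : i = j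
    · subst hij; simpa using hup s (by simpa using hs)
    · have := (hG.up i hi s (hsub i hs)).mono hKK'
      simpa [hij] using this
  case disjoint =>
    exact fun i hi k hk hik => (hG.disjoint i hi k hk hik).mono (hsub i) (hsub k)

/-! ### Extending the edges -/

/-- The first hit of the ray that extends the edge at `v`. -/
theorem exists_first_hit (hK : Core c K D) {v : Plane} (hv : v ∈ c.P) (hvD : v ∉ D) :
    ∃ t : ℝ, 0 < t ∧ (v + t • (v - c.π v) ∈ c.Ω → v + t • (v - c.π v) ∈ c.walls K) ∧
      ∀ s, 0 < s → s < t → v + s • (v - c.π v) ∈ c.Ω ∧ v + s • (v - c.π v) ∉ c.walls K := by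
  set d := v - c.π v with hd
  have hd0 : d ≠ 0 := sub_ne_zero.2 (c.partner_ne v hv).symm
  set Z : Set Plane := c.walls K ∪ c.Ωᶜ with hZ
  have hZc : IsClosed Z := hK.isClosed_walls.union isOpen_Ω.isClosed_compl
  have hcont : Continuous fun t : ℝ => v + t • d := by fun_prop
  -- Near `v`, there is only its edge, which the ray does not meet.
  have hnear : ∀ᶠ y in 𝓝 v, y ∈ Z → y ∈ c.edge v := by
    have hev : ∀ᶠ y in 𝓝 v, ∀ b, y ∉ K b :=
      eventually_all.2 fun b => (hK.closed b).isOpen_compl.mem_nhds (hK.fresh v hv hvD b)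
    filter_upwards [hev, eventually_edges_near hv (tip_mem_edge v),
      isOpen_Ω.mem_nhds (tip_mem_Ω hv)] with y h1 h2 h3 hy
    rcases hy with hy | hy
    · rcases mem_walls_iff.1 hy with hy | ⟨a, hy⟩
      · exact h2 hy
      · exact absurd hy (h1 a)
    · exact absurd h3 hy
  have hnot : ∀ t : ℝ, 0 < t → v + t • d ∉ c.edge v := by
    intro t ht h
    obtain ⟨s, hs, -, h⟩ := mem_segment_iff.1 h
    have : (t + s) • d = 0 := by
      have h' := add_left_cancel h
      rw [add_smul, h', ← smul_add, hd]; simp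
    exact smul_ne_zero (by positivity) hd0 this
  obtain ⟨δ, hδ, hδZ⟩ : ∃ δ : ℝ, 0 < δ ∧ ∀ t, 0 < t → t < δ → v + t • d ∉ Z := by
    obtain ⟨δ, hδ, h⟩ := Metric.eventually_nhds_iff.1 ((tendsto_add_smul v d).eventually hnear)
    refine ⟨δ, hδ, fun t ht htδ htZ => hnot t ht (h ?_ htZ)⟩
    rw [Real.dist_eq, sub_zero, abs_of_pos ht]; exact htδ
  -- The ray leaves the disk.
  obtain ⟨t₁, ht₁, ht₁Z⟩ : ∃ t₁ : ℝ, 0 < t₁ ∧ v + t₁ • d ∈ Z := by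
    have hr : 0 < c.radius := Metric.pos_of_mem_ball (tip_mem_Ω hv)
    have hn : 0 < ‖d‖ := norm_pos_iff.2 hd0
    refine ⟨(c.radius + ‖v - c.center‖) / ‖d‖, by positivity, Or.inr fun h => ?_⟩
    have h' : ‖v + ((c.radius + ‖v - c.center‖) / ‖d‖) • d - c.center‖ < c.radius := by
      simpa [Ω, dist_eq_norm] using h
    have h1 : ((c.radius + ‖v - c.center‖) / ‖d‖) • d =
      (v + ((c.radius + ‖v - c.center‖) / ‖d‖) • d - c.center) - (v - c.center) := by abel
    have h2 := norm_sub_le (v + ((c.radius + ‖v - c.center‖) / ‖d‖) • d - c.center) (v - c.center)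
    rw [← h1, norm_smul, Real.norm_of_nonneg (by positivity), div_mul_cancel₀ _ hn.ne'] at h2
    linarith
  have hδt : δ ≤ t₁ := by
    by_contra! h
    exact hδZ t₁ ht₁ h ht₁Z
  obtain ⟨t, ⟨ht, htZ⟩, hmin⟩ := (isCompact_Icc (a := δ) (b := t₁)).inter_right
    (hZc.preimage hcont) |>.exists_isLeast ⟨t₁, ⟨hδt, le_rfl⟩, ht₁Z⟩
  refine ⟨t, hδ.trans_le ht.1, fun h => ?_, fun s hs hst => ?_⟩
  · rcases htZ with h' | h'
    · exact h'
    · exact absurd h h'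
  · have hsZ : v + s • d ∉ Z := by
      intro hsZ
      by_cases hsδ : s < δ
      · exact hδZ s hs hsδ hsZ
      · exact absurd (hmin ⟨⟨not_lt.1 hsδ, hst.le.trans ht.2⟩, hsZ⟩) (not_le.2 hst)
    rw [hZ, mem_union, not_or, notMem_compl_iff] at hsZ
    exact hsZ.symm

/-- The edge at `v` can be extended up to the first hit. If the extension crosses a gap, then its
label agrees with the label at one of the ends of the gap, and the part of the gap on this side of
the crossing is filled. -/
theorem Gaps.extend [DecidableEq ι] (hK : Core c K D) (hG : Gaps c K A A' J α β)
    (hA : ∀ j ∈ J, A j ≠ A' j) {v : Plane} (hv : v ∈ c.P) (hvD : v ∉ D) :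
    ∃ K' α' β', Core c K' (insert v D) ∧ Gaps c K' A A' J α' β' := by
  obtain ⟨t, ht, hhit, hfree⟩ := exists_first_hit hK hv hvD
  have hd0 : v - c.π v ≠ 0 := sub_ne_zero.2 (c.partner_ne v hv).symm
  set h := v + t • (v - c.π v) with hh
  have hside : ∀ x ∈ segment ℝ v h, c.side v x = 0 := by
    intro x hx
    obtain ⟨r, -, -, rfl⟩ := mem_segment_iff.1 hx
    exact (side_eq_zero_iff hv).2 ⟨r * t, by rw [hh, add_sub_cancel_left, smul_smul]⟩
  have hhP : h ∉ c.P := by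
    intro hP
    refine side_tip_ne hv hP ?_ ?_ (hside h (right_mem_segment _ _ _))
    · rw [hh]; simpa using ⟨ht.ne', hd0⟩
    · intro h0
      have : (1 + t) • (v - c.π v) = 0 := by
        rw [add_smul, one_smul, sub_add_eq_add_sub, ← hh, h0, sub_self]
      exact smul_ne_zero (by positivity) hd0 this
  obtain ⟨a, ha⟩ := exists_lab (c := c) (K := K) v hhit
  have hvh : v ≠ h := by
    intro h0; rw [← h0] at hhP; exact hhP hv
  have hfree' : ∀ x ∈ openSegment ℝ v h, x ∈ c.Ω ∧ x ∉ c.walls K := by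
    intro x hx
    obtain ⟨r, hr0, hr1, rfl⟩ := mem_openSegment_iff.1 hx
    rw [hh, add_sub_cancel_left, smul_smul]
    exact hfree _ (by positivity) (by nlinarith)
  have hK₁ : Core c (addWall K a v h) (insert v D) :=
    hK.addWall hvh hfree' hhP ha (Or.inr ⟨hv, hvD, ⟨t, ht, hh⟩, rfl⟩)
  have hmono₁ := subset_addWall K a v h
  by_cases hcr : ∃ j ∈ J, ∃ s ∈ Ioo (α j) (β j), c.line s ∈ segment ℝ v h
  · obtain ⟨j, hj, s₀, hs₀, hs₀h⟩ := hcr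
    have huniq : ∀ s, c.line s ∈ segment ℝ v h → s = s₀ := fun s hs =>
      line_eq_of_side_eq_zero hv (hside _ hs) (hside _ hs₀h)
    have hs₀f := hG.free j hj s₀ hs₀
    have hs₀K : c.line s₀ ∈ addWall K a v h a := segment_subset_addWall K a v h hs₀h
    have hs₀M : c.line s₀ ∉ c.edges := fun h => hs₀f.2 (Or.inl h)
    have hs₀L : ∀ o, c.Lab (addWall K a v h) o (c.line s₀) a := fun o =>
      Or.inr (Or.inr ⟨hs₀f.1, hs₀M, hs₀K⟩)
    have hfr : ∀ s ∈ Ioo (α j) (β j), s ≠ s₀ →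
        c.line s ∈ c.Ω ∧ c.line s ∉ c.walls (addWall K a v h) := by
      intro s hs hne
      have := hG.free j hj s hs
      refine ⟨this.1, fun h => ?_⟩
      rcases mem_walls_addWall.1 h with h | h
      · exact this.2 h
      · exact hne (huniq s h)
    -- As the ends of the gap have different labels, the label `a` of the extension is one of
    -- them. A wall with label `a` fills the gap from this end to the crossing. What remains is a
    -- gap with the same labels at its ends.
    have haA : a = A j ∨ a = A' j := by
      have := hA j hj
      revert this; cases a <;> cases A j <;> cases A' j <;> simp
    rcases haA with rfl | rfl
    · have hlt : α j < s₀ := hs₀.1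
      refine ⟨addWall (addWall K (A j) v h) (A j) (c.line (α j)) (c.line s₀), _, _, ?_,
        hG.shrink (fun b => (hmono₁ b).trans (subset_addWall _ _ _ _ b)) hj hlt.le hs₀.2 le_rfl
          ?_ ?_ ?_ ?_⟩
      · refine hK₁.addWall (fun h => hlt.ne (line_injective h)) ?_ (line_not_mem_P _) (hs₀L _)
          (Or.inl ⟨line_not_mem_P _, (hG.low j hj s₀ hs₀).mono hmono₁, rfl⟩)
        intro x hx
        obtain ⟨s, hs, rfl⟩ := exists_of_mem_openSegment_line hlt hx
        exact hfr s ⟨hs.1, hs.2.trans hs₀.2⟩ hs.2.ne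
      · intro s hs
        rcases mem_walls_addWall.1 hs with hs | hs
        · rcases mem_walls_addWall.1 hs with hs | hs
          · exact Or.inl hs
          · rw [huniq s hs]; exact Or.inr ⟨Ioo_subset_Icc_self hs₀, fun h => lt_irrefl _ h.1⟩
        · have := (line_mem_segment hlt).1 hs
          exact Or.inr ⟨⟨this.1, this.2.trans hs₀.2.le⟩, fun h => not_lt.2 this.2 h.1⟩
      · intro s hs hs'
        refine mem_walls_addWall.2 (Or.inr ((line_mem_segment hlt).2 ⟨hs.1.le, ?_⟩))
        by_contra! h
        exact hs' ⟨h, hs.2⟩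
      · exact fun s _ => (hs₀L _).mono (subset_addWall _ _ _ _)
      · exact fun s hs => ((hG.up j hj s ⟨hs₀.1.trans hs.1, hs.2⟩).mono hmono₁).mono
          (subset_addWall _ _ _ _)
    · have hlt : s₀ < β j := hs₀.2
      refine ⟨addWall (addWall K (A' j) v h) (A' j) (c.line (β j)) (c.line s₀), _, _, ?_,
        hG.shrink (fun b => (hmono₁ b).trans (subset_addWall _ _ _ _ b)) hj le_rfl hs₀.1 hlt.le
          ?_ ?_ ?_ ?_⟩
      · refine hK₁.addWall (fun h => hlt.ne' (line_injective h)) ?_ (line_not_mem_P _) (hs₀L _)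
          (Or.inl ⟨line_not_mem_P _, (hG.up j hj s₀ hs₀).mono hmono₁, rfl⟩)
        intro x hx
        rw [openSegment_symm] at hx
        obtain ⟨s, hs, rfl⟩ := exists_of_mem_openSegment_line hlt hx
        exact hfr s ⟨hs₀.1.trans hs.1, hs.2⟩ hs.1.ne'
      · intro s hs
        rcases mem_walls_addWall.1 hs with hs | hs
        · rcases mem_walls_addWall.1 hs with hs | hs
          · exact Or.inl hs
          · rw [huniq s hs]; exact Or.inr ⟨Ioo_subset_Icc_self hs₀, fun h => lt_irrefl _ h.2⟩
        · rw [segment_symm] at hs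
          have := (line_mem_segment hlt).1 hs
          exact Or.inr ⟨⟨hs₀.1.le.trans this.1, this.2⟩, fun h => not_lt.2 this.1 h.2⟩
      · intro s hs hs'
        refine mem_walls_addWall.2 (Or.inr ?_)
        rw [segment_symm]
        refine (line_mem_segment hlt).2 ⟨?_, hs.2.le⟩
        by_contra! h
        exact hs' ⟨hs.1, h⟩
      · exact fun s hs => ((hG.low j hj s ⟨hs.1, hs.2.trans hs₀.2⟩).mono hmono₁).mono
          (subset_addWall _ _ _ _)
      · exact fun s _ => (hs₀L _).mono (subset_addWall _ _ _ _)
  · push Not at hcr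
    refine ⟨addWall K a v h, α, β, hK₁, hG.lt, fun j hj s hs => ?_, fun s hs hsK => ?_,
      fun j hj s hs => (hG.low j hj s hs).mono hmono₁,
      fun j hj s hs => (hG.up j hj s hs).mono hmono₁, hG.disjoint⟩
    · have := hG.free j hj s hs
      refine ⟨this.1, fun h => ?_⟩
      rcases mem_walls_addWall.1 h with h | h
      · exact this.2 h
      · exact hcr j hj s hs h
    · exact hG.cover s hs fun h => hsK (walls_mono hmono₁ h)

/-- All edges can be extended in both directions. -/
theorem Gaps.extend_all [DecidableEq ι] (hK : Core c K ∅) (hG : Gaps c K A A' J α β)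
    (hA : ∀ j ∈ J, A j ≠ A' j) :
    ∃ K' α' β', Core c K' c.P ∧ Gaps c K' A A' J α' β' := by
  have key : ∀ D : Finset Plane, D ⊆ c.P → ∃ K' α' β', Core c K' D ∧ Gaps c K' A A' J α' β' := by
    intro D
    induction D using Finset.induction_on with
    | empty => exact fun _ => ⟨K, α, β, hK, hG⟩
    | insert v D hvD ih =>
      intro hD
      obtain ⟨K', α', β', hK', hG'⟩ := ih fun u hu => hD (Finset.mem_insert_of_mem hu)
      exact hG'.extend hK' hA (hD (Finset.mem_insert_self v D)) hvD
  exact key c.P Finset.Subset.rfl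

end

end Config

/-! ### Cells -/

/-- Without dead ends, visibility is transitive: rotate the segment from `x` to `y` about `x` into
the segment from `x` to `z`. The first wall that it hits could only be touched from one side, so
that this wall covers a neighbourhood of the point of contact in the segment. -/
theorem segment_subset_of_noDeadEnd {Ω W : Set Plane} (hΩ : Convex ℝ Ω) (hW : IsClosed W)
    (hN : ∀ x ∈ Ω, x ∈ W → NoDeadEnd W x) {x y z : Plane} (hxy : segment ℝ x y ⊆ Ω \ W)
    (hyz : segment ℝ y z ⊆ Ω \ W) : segment ℝ x z ⊆ Ω \ W := by
  have hx : x ∈ Ω \ W := hxy (left_mem_segment _ _ _)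
  have hy : y ∈ Ω \ W := hxy (right_mem_segment _ _ _)
  have hz : z ∈ Ω \ W := hyz (right_mem_segment _ _ _)
  intro w₀ hw₀
  refine ⟨hΩ.segment_subset hx.1 hz.1 hw₀, fun hw₀W => ?_⟩
  -- `f (t, s)` is the point with parameter `s` of the segment from `x` to the point with parameter
  -- `t` of the segment from `y` to `z`. The first of these segments that meets a wall is the one
  -- for `t₀`, and `s₀` is the parameter of the first wall point on it.
  let f : ℝ × ℝ → Plane := fun p => x + p.2 • (y + p.1 • (z - y) - x)
  have hf : Continuous f := by fun_prop
  have hmemyz : ∀ t : ℝ, 0 ≤ t → t ≤ 1 → y + t • (z - y) ∈ Ω \ W := fun t h0 h1 =>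
    hyz (mem_segment_iff.2 ⟨t, h0, h1, rfl⟩)
  set E : Set (ℝ × ℝ) := (Icc 0 1 ×ˢ Icc 0 1) ∩ f ⁻¹' W with hE
  have hEc : IsCompact E := (isCompact_Icc.prod isCompact_Icc).inter_right (hW.preimage hf)
  have hEne : E.Nonempty := by
    obtain ⟨s, h0, h1, rfl⟩ := mem_segment_iff.1 hw₀
    refine ⟨(1, s), ⟨⟨by norm_num, by norm_num⟩, ⟨h0, h1⟩⟩, ?_⟩
    simpa [f] using hw₀W
  obtain ⟨t₀, ⟨⟨t₀', s₁⟩, hp, rfl⟩, hmin⟩ :=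
    (hEc.image continuous_fst).exists_isLeast (hEne.image _)
  simp only at hmin
  set t₀ := t₀' with ht₀
  have ht0 : 0 ≤ t₀ := hp.1.1.1
  have ht1 : t₀ ≤ 1 := hp.1.1.2
  obtain ⟨s₀, ⟨⟨hs0, hs1⟩, hs₀W⟩, hsmin⟩ := (isCompact_Icc (a := (0 : ℝ)) (b := 1)).inter_right
    (hW.preimage (show Continuous fun s : ℝ => f (t₀, s) by fun_prop)) |>.exists_isLeast
    ⟨s₁, hp.1.2, hp.2⟩
  have hs₀W' : f (t₀, s₀) ∈ W := hs₀W
  set d := y + t₀ • (z - y) - x with hd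
  have hfd : ∀ s, f (t₀, s) = x + s • d := fun s => rfl
  rw [hfd] at hs₀W'
  have hs0' : 0 < s₀ := by
    refine lt_of_le_of_ne hs0 fun h => hx.2 ?_
    rw [← h] at hs₀W'; simpa using hs₀W'
  have hs1' : s₀ < 1 := by
    refine lt_of_le_of_ne hs1 fun h => (hmemyz t₀ ht0 ht1).2 ?_
    rw [h] at hs₀W'; simpa [hd] using hs₀W'
  have hpΩ : x + s₀ • d ∈ Ω := by
    refine hΩ.segment_subset hx.1 (hmemyz t₀ ht0 ht1).1 (mem_segment_iff.2 ⟨s₀, hs0, hs1, rfl⟩)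
  have hd0 : d ≠ 0 := by
    intro h; rw [h] at hs₀W'; exact hx.2 (by simpa using hs₀W')
  -- The wall does not cover a neighbourhood of the point of contact in the segment.
  have hbefore : ¬ ∀ᶠ u : ℝ in 𝓝 0, x + s₀ • d + u • d ∈ W := by
    intro h
    have h1 : ∀ᶠ u : ℝ in 𝓝[<] 0, x + s₀ • d + u • d ∈ W ∧ -s₀ < u ∧ u < 0 :=
      (h.filter_mono nhdsWithin_le_nhds).and (((eventually_gt_nhds (by linarith)).filter_mono
        nhdsWithin_le_nhds).and self_mem_nhdsWithin)
    obtain ⟨u, hu, hu1, hu2⟩ := h1.exists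
    have : s₀ ≤ s₀ + u := hsmin ⟨⟨by linarith, by linarith⟩, by
      rw [mem_preimage, hfd, add_smul, ← add_assoc]; exact hu⟩
    linarith
  by_cases hD : cross d (y - x) = 0
  · -- If the segments are collinear, the point of contact is on one of the given segments.
    obtain ⟨r, hr⟩ := exists_smul_of_cross_eq_zero hd0 hD
    by_cases hrs : s₀ ≤ r
    · refine (hxy (mem_segment_iff.2 ⟨s₀ / r, div_nonneg hs0 (hs0.trans hrs),
        (div_le_one (by linarith)).2 hrs, ?_⟩)).2 hs₀W'
      rw [hr, smul_smul, div_mul_cancel₀ _ (by linarith)]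
    · have hr1 : 0 < 1 - r := by linarith
      refine (hyz (mem_segment_iff.2 ⟨(s₀ - r) / (1 - r) * t₀, ?_, ?_, ?_⟩)).2 hs₀W'
      · have : 0 ≤ s₀ - r := by linarith
        positivity
      · have : (s₀ - r) / (1 - r) ≤ 1 := (div_le_one hr1).2 (by linarith)
        have : 0 ≤ (s₀ - r) / (1 - r) := div_nonneg (by linarith) hr1.le
        nlinarith
      · have e1 : t₀ • (z - y) = (1 - r) • d := by
          rw [sub_smul, one_smul, ← hr, hd]; abel
        have e2 : y = x + r • d := by rw [← hr]; abel
        rw [mul_smul, e1, smul_smul, div_mul_cancel₀ _ hr1.ne', sub_smul]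
        rw [eq_sub_of_add_eq e2.symm]; abel
  · -- Coordinates with respect to `d` and `y - x`.
    have hcoord : ∀ w, w = x + (cross (w - x) (y - x) / cross d (y - x)) • d +
        (cross d (w - x) / cross d (y - x)) • (y - x) := by
      intro w
      have := cross_smul_eq d (y - x) (w - x)
      have h2 : w - x = (cross d (y - x))⁻¹ • (cross d (y - x) • (w - x)) := by
        rw [smul_smul, inv_mul_cancel₀ hD, one_smul]
      rw [this, smul_add, smul_smul, smul_smul, inv_mul_eq_div, inv_mul_eq_div] at h2
      rw [add_assoc, ← h2]; abel
    have hcontA : Continuous fun w : Plane => cross (w - x) (y - x) / cross d (y - x) :=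
      (Continuous.cross (by fun_prop) continuous_const).div_const _
    have hcontB : Continuous fun w : Plane => cross d (w - x) / cross d (y - x) :=
      (Continuous.cross continuous_const (by fun_prop)).div_const _
    have hA0 : cross (x + s₀ • d - x) (y - x) / cross d (y - x) = s₀ := by
      rw [add_sub_cancel_left, cross_smul_left, mul_div_cancel_right₀ _ hD]
    have hB0 : cross d (x + s₀ • d - x) / cross d (y - x) = 0 := by
      rw [add_sub_cancel_left, cross_smul_right, cross_self]; simp
    -- On the side of `y`, the neighbourhood of the point of contact has been swept by earlier
    -- segments.
    have hswept : ∀ᶠ w in 𝓝 (x + s₀ • d), 0 < cross d (w - x) / cross d (y - x) → w ∉ W := by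
      have t1 := hcontA.tendsto (x + s₀ • d)
      have t2 := hcontB.tendsto (x + s₀ • d)
      have t3 := t1.add t2
      simp only [hA0, hB0, add_zero] at t1 t3
      have e1 := t1.eventually (eventually_gt_nhds hs0')
      have e2 := t3.eventually (eventually_lt_nhds hs1')
      filter_upwards [e1, e2] with w ha hab hb hwW
      set a := cross (w - x) (y - x) / cross d (y - x) with hadef
      set b := cross d (w - x) / cross d (y - x) with hbdef
      have hw := hcoord w
      rw [← hadef, ← hbdef] at hw
      have hab0 : 0 < a + b := by linarith
      have hρ : a / (a + b) < 1 := (div_lt_one hab0).2 (by linarith)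
      have hρ0 : 0 < a / (a + b) := by positivity
      have ht0' : 0 < t₀ := by
        refine lt_of_le_of_ne ht0 fun h => ?_
        refine (hxy (mem_segment_iff.2 ⟨s₀, hs0, hs1, rfl⟩)).2 ?_
        have : d = y - x := by rw [hd, ← h]; simp
        rwa [← this]
      have hmem : ((a / (a + b)) * t₀, a + b) ∈ E := by
        refine ⟨⟨⟨by positivity, by nlinarith⟩, ⟨hab0.le, hab.le⟩⟩, ?_⟩
        rw [mem_preimage]
        convert hwW using 1
        rw [hw]
        simp only [f]
        have e3 : y + (a / (a + b) * t₀) • (z - y) - x =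
            (1 - a / (a + b)) • (y - x) + (a / (a + b)) • d := by
          rw [hd, mul_smul, sub_smul, one_smul]
          simp only [smul_sub, smul_add]; abel
        rw [e3, smul_add, smul_smul, smul_smul, mul_sub, mul_one, mul_div_cancel₀ _ hab0.ne']
        rw [add_sub_cancel_left]; abel
      have := hmin (mem_image_of_mem Prod.fst hmem)
      simp only at this
      nlinarith
    rcases lt_or_gt_of_ne hD with hD' | hD'
    · rcases hN _ hpΩ hs₀W' (-d) (neg_ne_zero.2 hd0) with h | h
      · obtain ⟨w, ⟨hwW, hw⟩, hw'⟩ := (h.and_eventually hswept).exists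
        refine hw' ?_ hwW
        have : cross (-d) (w - (x + s₀ • d)) = - cross d (w - x) := by
          rw [cross_neg_left, ← sub_sub, cross_sub_right d (w - x), cross_smul_right, cross_self]
          ring
        rw [this] at hw
        exact div_pos_of_neg_of_neg (by linarith) hD'
      · apply hbefore
        have hneg : Tendsto (fun u : ℝ => -u) (𝓝 0) (𝓝 0) := by
          simpa using (continuous_neg (G := ℝ)).tendsto 0
        filter_upwards [hneg.eventually h] with u hu
        simpa using hu
    · rcases hN _ hpΩ hs₀W' d hd0 with h | h
      · obtain ⟨w, ⟨hwW, hw⟩, hw'⟩ := (h.and_eventually hswept).exists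
        refine hw' ?_ hwW
        have : cross d (w - (x + s₀ • d)) = cross d (w - x) := by
          rw [← sub_sub, cross_sub_right d (w - x), cross_smul_right, cross_self]
          ring
        rw [this] at hw
        exact div_pos hw hD'
      · exact hbefore h

/-- The set of points of `U` visible from `o`. -/
def cell (U : Set Plane) (o : Plane) : Set Plane := {y | segment ℝ o y ⊆ U}

section cell

variable {U : Set Plane}

theorem cell_subset (o : Plane) : cell U o ⊆ U := fun _ hy => hy (right_mem_segment _ _ _)

theorem mem_cell_self {o : Plane} (ho : o ∈ U) : o ∈ cell U o := by
  simpa [cell, segment_same] using ho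

theorem mem_cell_comm {x y : Plane} : x ∈ cell U y ↔ y ∈ cell U x := by
  simp only [cell, mem_ofPred_eq, segment_symm]

theorem isOpen_cell (hU : IsOpen U) (o : Plane) : IsOpen (cell U o) := by
  rw [Metric.isOpen_iff]
  intro y hy
  obtain ⟨δ, hδ, h⟩ := (isCompact_segment o y).exists_thickening_subset_open hU hy
  refine ⟨δ, hδ, fun y' hy' => ?_⟩
  intro w hw
  obtain ⟨t, h0, h1, rfl⟩ := mem_segment_iff.1 hw
  refine h (Metric.mem_thickening_iff.2 ⟨o + t • (y - o), mem_segment_iff.2 ⟨t, h0, h1, rfl⟩, ?_⟩)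
  rw [dist_eq_norm]
  have : o + t • (y' - o) - (o + t • (y - o)) = t • (y' - y) := by
    simp only [smul_sub]; abel
  rw [this, norm_smul, Real.norm_of_nonneg h0, ← dist_eq_norm]
  have h3 : dist y' y < δ := hy'
  have h4 : 0 ≤ dist y' y := dist_nonneg
  nlinarith

/-- Visibility within `U` is transitive. -/
def VisTrans (U : Set Plane) : Prop :=
  ∀ ⦃x y z : Plane⦄, y ∈ cell U x → z ∈ cell U y → z ∈ cell U x

theorem VisTrans.cell_eq (hT : VisTrans U) {x y : Plane} (h : y ∈ cell U x) :
    cell U y = cell U x := by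
  ext z
  exact ⟨fun hz => hT h hz, fun hz => hT (mem_cell_comm.1 h) hz⟩

theorem VisTrans.convex_cell (hT : VisTrans U) (o : Plane) : Convex ℝ (cell U o) := by
  rw [convex_iff_segment_subset]
  intro y hy z hz w hw
  have h1 : z ∈ cell U y := hT (mem_cell_comm.1 hy) hz
  have h2 : w ∈ cell U y := fun u hu =>
    h1 ((convex_segment y z).segment_subset (left_mem_segment ℝ y z) hw hu)
  exact hT hy h2

/-- Points of the closure of a cell that are not in this cell are not in `U`. -/
theorem VisTrans.not_mem_of_mem_closure (hT : VisTrans U) (hU : IsOpen U) {o x : Plane}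
    (hx : x ∈ closure (cell U o)) (hxo : x ∉ cell U o) : x ∉ U := by
  intro hxU
  obtain ⟨ε, hε, hball⟩ := Metric.isOpen_iff.1 hU x hxU
  obtain ⟨y, hy, hxy⟩ := Metric.mem_closure_iff.1 hx ε hε
  refine hxo (hT hy fun w hw => hball ?_)
  exact (convex_ball x ε).segment_subset (by rwa [Metric.mem_ball, dist_comm])
    (Metric.mem_ball_self hε) hw

/-- The segment from a point of a cell to a point of its closure stays in the cell. -/
theorem VisTrans.openSegment_subset (hT : VisTrans U) (hU : IsOpen U) {o x y : Plane}
    (hx : x ∈ cell U o) (hy : y ∈ closure (cell U o)) : openSegment ℝ x y ⊆ cell U o := by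
  have h := (hT.convex_cell o).openSegment_interior_closure_subset_interior
    (by rwa [(isOpen_cell hU o).interior_eq]) hy
  exact h.trans interior_subset

end cell

namespace Config

variable {c : Config} {K : Bool → Set Plane}

/-- The part of `Ω` that is not covered by walls. -/
def free (c : Config) (K : Bool → Set Plane) : Set Plane := c.Ω \ c.walls K

theorem Core.isOpen_free {D : Finset Plane} (hK : Core c K D) : IsOpen (c.free K) :=
  isOpen_Ω.sdiff hK.isClosed_walls

theorem Core.visTrans (hK : Core c K c.P) : VisTrans (c.free K) := fun _ _ _ h1 h2 =>
  segment_subset_of_noDeadEnd convex_Ω hK.isClosed_walls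
    (fun x hx hxW => hK.noDeadEnd x hx hxW id) h1 h2

end Config

/-! ### Jumps of a step function -/

/-- A function on an interval that is locally constant up to jumps at finitely many places changes
by the sum of its jumps. Here `cl` is the left limit of `g`. -/
theorem sum_jumps {ι : Type*} (T : Finset ι) (ang : ι → ℝ) (col : ι → ℤ) (g cl : ℝ → ℤ) {s t : ℝ}
    (hst : s ≤ t) (hl : ∀ θ ∈ Icc s t, ∀ᶠ x in 𝓝[<] θ, g x = cl θ)
    (hr : ∀ θ ∈ Ico s t, ∀ᶠ x in 𝓝[>] θ, g x = cl θ + ∑ i ∈ T with ang i = θ, col i) :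
    cl t - cl s = ∑ i ∈ T with ang i ∈ Ico s t, col i := by
  -- Subtracting the jumps so far makes the function locally constant.
  set G : ℝ → ℤ := fun θ => cl θ - ∑ i ∈ T with ang i ∈ Ico s θ, col i with hG
  have hleft : ∀ θ ∈ Icc s t, ∀ᶠ x in 𝓝[<] θ, x ∈ Icc s t → G x = G θ := by
    intro θ hθ
    have h1 := eventually_eventually_nhdsWithin.2 (hl θ hθ)
    have h2 : ∀ᶠ x in 𝓝[<] θ, ∀ i ∈ T, (ang i < x ↔ ang i < θ) := by
      refine (T.eventually_all).2 fun i _ => ?_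
      by_cases hi : ang i < θ
      · filter_upwards [(eventually_gt_nhds hi).filter_mono nhdsWithin_le_nhds] with x hx
        simp [hx, hi]
      · filter_upwards [self_mem_nhdsWithin] with x hx
        simp only [mem_Iio] at hx
        simp only [hi, iff_false, not_lt]; linarith
    filter_upwards [h1, h2, self_mem_nhdsWithin] with x h1 h2 hx hxI
    have hcl : cl x = cl θ := by
      have h3 : ∀ᶠ y in 𝓝[<] x, g y = cl θ :=
        h1.filter_mono (nhdsWithin_mono x (Iio_subset_Iio (le_of_lt hx)))
      obtain ⟨y, hy1, hy2⟩ := ((hl x hxI).and h3).exists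
      rw [← hy1, ← hy2]
    simp only [hG, hcl]
    congr 2
    refine Finset.filter_congr fun i hi => ?_
    simp only [mem_Ico, h2 i hi]
  have hright : ∀ θ ∈ Ico s t, ∀ᶠ x in 𝓝[>] θ, x ∈ Icc s t → G x = G θ := by
    intro θ hθ
    have h1 := eventually_eventually_nhdsWithin.2 (hr θ hθ)
    have h2 : ∀ᶠ x in 𝓝[>] θ, ∀ i ∈ T, (ang i < x ↔ ang i ≤ θ) := by
      refine (T.eventually_all).2 fun i _ => ?_
      by_cases hi : ang i ≤ θ
      · filter_upwards [self_mem_nhdsWithin] with x hx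
        simp only [mem_Ioi] at hx
        simp only [hi, iff_true]; linarith
      · filter_upwards [(eventually_lt_nhds (not_le.1 hi)).filter_mono nhdsWithin_le_nhds]
          with x hx
        simp only [hi, iff_false, not_lt]; linarith
    filter_upwards [h1, h2, self_mem_nhdsWithin] with x h1 h2 hx hxI
    simp only [mem_Ioi] at hx
    have hcl : cl x = cl θ + ∑ i ∈ T with ang i = θ, col i := by
      have h3 : ∀ᶠ y in 𝓝[<] x, g y = cl θ + ∑ i ∈ T with ang i = θ, col i := by
        rw [nhdsWithin_eq_nhds.2 (Ioi_mem_nhds hx)] at h1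
        exact h1.filter_mono nhdsWithin_le_nhds
      obtain ⟨y, hy1, hy2⟩ := ((hl x hxI).and h3).exists
      rw [← hy1, ← hy2]
    simp only [hG, hcl]
    have : ∑ i ∈ T with ang i ∈ Ico s x, col i =
        (∑ i ∈ T with ang i ∈ Ico s θ, col i) + ∑ i ∈ T with ang i = θ, col i := by
      rw [Finset.sum_filter, Finset.sum_filter, Finset.sum_filter, ← Finset.sum_add_distrib]
      refine Finset.sum_congr rfl fun i hi => ?_
      simp only [mem_Ico, h2 i hi]
      rcases lt_trichotomy (ang i) θ with h | h | h
      · simp [h, h.le, h.ne]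
      · simp [h, hθ.1]
      · simp [h.not_gt, h.not_ge, h.ne']
    rw [this]; ring
  have hcont : ContinuousOn G (Icc s t) := by
    intro θ hθ
    have : ∀ᶠ x in 𝓝[Icc s t] θ, G x = G θ := by
      have h1 : ∀ᶠ x in 𝓝[<] θ, x ∈ Icc s t → G x = G θ := hleft θ hθ
      have h2 : ∀ᶠ x in 𝓝[>] θ, x ∈ Icc s t → G x = G θ := by
        rcases eq_or_lt_of_le hθ.2 with rfl | h
        · filter_upwards [self_mem_nhdsWithin] with x hx hxI
          exact absurd hxI.2 (not_le.2 hx)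
        · exact hright θ ⟨hθ.1, h⟩
      have h3 : ∀ᶠ x in 𝓝[≠] θ, x ∈ Icc s t → G x = G θ := by
        rw [← Iio_union_Ioi, nhdsWithin_union]; exact eventually_sup.2 ⟨h1, h2⟩
      have h4 : ∀ᶠ x in 𝓝 θ, x ∈ Icc s t → G x = G θ := by
        rw [eventually_nhdsWithin_iff] at h3
        filter_upwards [h3] with x hx hxI
        by_cases h : x = θ
        · rw [h]
        · exact hx h hxI
      exact eventually_nhdsWithin_iff.2 h4
    exact (tendsto_const_nhds.congr' (this.mono fun x hx => hx.symm))
  have := isPreconnected_Icc.constant hcont (right_mem_Icc.2 hst) (left_mem_Icc.2 hst)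
  simp only [hG, Ico_self, mem_empty_iff_false, Finset.filter_false, Finset.sum_empty] at this
  linarith

/-! ### Polar coordinates -/

/-- The unit vector with angle `θ`. -/
noncomputable def dir (θ : ℝ) : Plane := !₂[Real.cos θ, Real.sin θ]

theorem cross_dir (θ φ : ℝ) : cross (dir θ) (dir φ) = Real.sin (φ - θ) := by
  simp [cross, dir, Real.sin_sub]; ring

theorem continuous_dir : Continuous dir := by
  unfold dir
  refine (PiLp.continuous_toLp 2 _).comp (continuous_pi fun i => ?_)
  fin_cases i
  · simpa using Real.continuous_cos
  · simpa using Real.continuous_sin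

theorem norm_dir (θ : ℝ) : ‖dir θ‖ = 1 := by
  simp [dir, EuclideanSpace.norm_eq]

theorem dir_ne_zero (θ : ℝ) : dir θ ≠ 0 := by
  intro h; have := norm_dir θ; simp [h] at this

theorem dir_add_two_pi (θ : ℝ) : dir (θ + 2 * Real.pi) = dir θ := by simp [dir]

theorem exists_polar (s : ℝ) (x : Plane) :
    ∃ θ ∈ Ico s (s + 2 * Real.pi), x = ‖x‖ • dir θ := by
  set z : ℂ := ⟨x 0, x 1⟩ with hz
  have hzn : ‖z‖ = ‖x‖ := by
    rw [EuclideanSpace.norm_eq, Complex.norm_def, Complex.normSq_apply]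
    simp [hz, Fin.sum_univ_two, sq]
  have hx : x = ‖x‖ • dir z.arg := by
    ext i; fin_cases i
    · have h := (Complex.norm_mul_cos_arg z).symm
      rw [hzn] at h
      exact h
    · have h := (Complex.norm_mul_sin_arg z).symm
      rw [hzn] at h
      exact h
  refine ⟨toIcoMod Real.two_pi_pos s z.arg, toIcoMod_mem_Ico _ _ _, ?_⟩
  have h1 : toIcoMod Real.two_pi_pos s z.arg =
      z.arg - (toIcoDiv Real.two_pi_pos s z.arg) * (2 * Real.pi) := by
    rw [toIcoMod, zsmul_eq_mul]
  have h2 : dir (toIcoMod Real.two_pi_pos s z.arg) = dir z.arg := by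
    rw [h1]; simp only [dir, Real.cos_sub_int_mul_two_pi, Real.sin_sub_int_mul_two_pi]
  rw [h2]; exact hx

theorem polar_unique {s θ φ r r' : ℝ} (hθ : θ ∈ Ico s (s + 2 * Real.pi))
    (hφ : φ ∈ Ico s (s + 2 * Real.pi)) (hr : 0 < r) (hr' : 0 < r')
    (h : r • dir θ = r' • dir φ) : θ = φ := by
  have h1 : r = r' := by
    have := congrArg norm h
    rwa [norm_smul, norm_smul, norm_dir, norm_dir, Real.norm_of_nonneg hr.le,
      Real.norm_of_nonneg hr'.le, mul_one, mul_one] at this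
  subst h1
  have h2 : dir θ = dir φ := smul_right_injective _ hr.ne' h
  have hc : Real.cos θ = Real.cos φ := by simpa [dir] using congrArg (fun x : Plane => x 0) h2
  have hs : Real.sin θ = Real.sin φ := by simpa [dir] using congrArg (fun x : Plane => x 1) h2
  have h3 : Real.cos (θ - φ) = 1 := by
    rw [Real.cos_sub, hc, hs]; nlinarith [Real.sin_sq_add_cos_sq φ]
  have := (Real.cos_eq_one_iff_of_lt_of_lt (by linarith [hθ.1, hφ.2])
    (by linarith [hθ.2, hφ.1])).1 h3
  linarith

/-- The boundary of a bounded open convex set, in polar coordinates around a point of this set. The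
radius is the inverse of the gauge. -/
theorem exists_radial {C : Set Plane} (hC : IsOpen C) (hconv : Convex ℝ C)
    (hb : Bornology.IsBounded C) {o : Plane} (ho : o ∈ C) :
    ∃ ρ : ℝ → ℝ, Continuous ρ ∧ (∀ θ, 0 < ρ θ) ∧ (∀ θ, ρ (θ + 2 * Real.pi) = ρ θ) ∧
      ∀ θ t, 0 ≤ t → (o + t • dir θ ∈ C ↔ t < ρ θ) := by
  set S : Set Plane := (fun z => o + z) ⁻¹' C with hS
  have hSo : IsOpen S := hC.preimage (by fun_prop)
  have hSc : Convex ℝ S := hconv.translate_preimage_right o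
  have h0 : (0 : Plane) ∈ S := by simpa [hS] using ho
  have hSn : S ∈ 𝓝 (0 : Plane) := hSo.mem_nhds h0
  have hSb : Bornology.IsBounded S := by
    have : S = (fun z => -o + z) '' C := by
      ext z; constructor
      · intro hz; exact ⟨o + z, hz, by simp⟩
      · rintro ⟨y, hy, rfl⟩; simpa [hS] using hy
    rw [this]
    exact (LipschitzWith.of_dist_le_mul (K := 1) fun x y => by simp).isBounded_image hb
  have hpos : ∀ θ, 0 < gauge S (dir θ) := fun θ =>
    (gauge_pos (absorbent_nhds_zero hSn) (NormedSpace.isVonNBounded_of_isBounded ℝ hSb)).2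
      (dir_ne_zero θ)
  refine ⟨fun θ => (gauge S (dir θ))⁻¹, ?_, fun θ => inv_pos.2 (hpos θ), fun θ => ?_, ?_⟩
  · exact ((continuous_gauge hSc hSn).comp continuous_dir).inv₀ fun θ => (hpos θ).ne'
  · simp only [dir_add_two_pi]
  · intro θ t ht
    have h1 : o + t • dir θ ∈ C ↔ t • dir θ ∈ S := Iff.rfl
    have h2 : t • dir θ ∈ S ↔ gauge S (t • dir θ) < 1 := by
      rw [← mem_ofPred_eq (p := fun x => gauge S x < 1),
        setOfPred_gauge_lt_one_eq_self_of_isOpen hSc h0 hSo]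
    rw [h1, h2, gauge_smul_of_nonneg ht, smul_eq_mul]
    change _ ↔ t < (gauge S (dir θ))⁻¹
    rw [← one_div, lt_div_iff₀ (hpos θ)]

namespace Config

variable {c : Config} {K : Bool → Set Plane}

/-! ### Labels around a cell -/

/-- The parameter of the orthogonal projection of `y` to the line of the edge at `v`. -/
noncomputable def param (c : Config) (v y : Plane) : ℝ :=
  inner ℝ (v - c.π v) (y - v) / inner ℝ (v - c.π v) (v - c.π v)

theorem continuous_param (v : Plane) : Continuous (c.param v) := by
  unfold param; fun_prop

theorem param_add_smul {v : Plane} (hv : v ∈ c.P) (t : ℝ) :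
    c.param v (v + t • (v - c.π v)) = t := by
  have : inner ℝ (v - c.π v) (v - c.π v) ≠ 0 :=
    inner_self_ne_zero.2 (sub_ne_zero.2 (c.partner_ne v hv).symm)
  rw [param, add_sub_cancel_left, inner_smul_right, mul_div_cancel_right₀ _ this]

theorem mem_edge_iff {v : Plane} (hv : v ∈ c.P) (t : ℝ) :
    v + t • (v - c.π v) ∈ c.edge v ↔ -1 ≤ t ∧ t ≤ 0 := by
  unfold edge
  rw [mem_segment_iff]
  constructor
  · rintro ⟨s, h0, h1, h⟩
    have : v + s • (c.π v - v) = v + (-s) • (v - c.π v) := by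
      rw [neg_smul, ← smul_neg, neg_sub]
    rw [this] at h
    have h2 := congrArg (c.param v) h
    rw [param_add_smul hv, param_add_smul hv] at h2
    constructor <;> linarith
  · rintro ⟨h1, h2⟩
    refine ⟨-t, by linarith, by linarith, ?_⟩
    rw [neg_smul, ← smul_neg, neg_sub]

theorem eventually_mem_edge_of_side {v x : Plane} (hv : v ∈ c.P)
    (hx : x ∈ openSegment ℝ v (c.π v)) : ∀ᶠ y in 𝓝 x, c.side v y = 0 → y ∈ c.edge v := by
  obtain ⟨s, h0, h1, rfl⟩ := mem_openSegment_iff.1 hx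
  have hs : v + s • (c.π v - v) = v + (-s) • (v - c.π v) := by
    rw [neg_smul, ← smul_neg, neg_sub]
  have ht := (continuous_param (c := c) v).tendsto (v + s • (c.π v - v))
  rw [hs, param_add_smul hv] at ht
  rw [hs]
  filter_upwards [ht.eventually (Ioo_mem_nhds (a := -1) (b := 0) (by linarith) (by linarith))]
    with y hy h
  obtain ⟨t, rfl⟩ := (side_eq_zero_iff hv).1 h
  rw [param_add_smul hv] at hy
  exact (mem_edge_iff hv t).2 ⟨hy.1.le, hy.2.le⟩

/-- Let the walls contain a neighbourhood of `x` in the line of the edge at `v`. An observer who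
sees `x` is not on this line, and only sees points near `x` that are not beyond this line. -/
theorem side_of_visible {o v x : Plane} (hx : c.side v x = 0)
    (hline : ∀ᶠ y in 𝓝 x, c.side v y = 0 → y ∉ c.free K) (hox : openSegment ℝ o x ⊆ c.free K) :
    c.side v o ≠ 0 ∧ ∀ᶠ y in 𝓝 x, openSegment ℝ o y ⊆ c.free K →
      0 ≤ c.side v y * c.side v o := by
  have h0 : c.side v o ≠ 0 := by
    intro h0
    have h1 := ((tendsto_add_smul x (o - x)).eventually hline).filter_mono
      (nhdsWithin_le_nhds (s := Ioi 0))
    have h2 : ∀ᶠ t : ℝ in 𝓝[>] 0, t < 1 :=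
      (eventually_lt_nhds (by norm_num)).filter_mono nhdsWithin_le_nhds
    obtain ⟨t, ht, ht1, ht0⟩ := (h1.and (h2.and self_mem_nhdsWithin)).exists
    refine ht ?_ (hox ?_)
    · rw [side_add_smul, hx, h0]; ring
    · rw [openSegment_symm]; exact mem_openSegment_iff.2 ⟨t, ht0, ht1, rfl⟩
  refine ⟨h0, ?_⟩
  -- The point where the segment from `y` to `o` crosses the line.
  have hcont : Tendsto (fun y => y + (-(c.side v y) / (c.side v o - c.side v y)) • (o - y)) (𝓝 x)
      (𝓝 x) := by
    have h1 := (continuous_side (c := c) v).tendsto x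
    rw [hx] at h1
    have h2 : Tendsto (fun y => -(c.side v y) / (c.side v o - c.side v y)) (𝓝 x) (𝓝 0) := by
      have hc : Tendsto (fun _ : Plane => c.side v o) (𝓝 x) (𝓝 (c.side v o)) := tendsto_const_nhds
      have := h1.neg.div (hc.sub h1) (by simpa using h0)
      rw [neg_zero, sub_zero, zero_div] at this
      exact this
    have h3 : Tendsto (fun y : Plane => y) (𝓝 x) (𝓝 x) := tendsto_id
    have := h3.add (h2.smul ((tendsto_const_nhds (x := o)).sub h3))
    simpa using this
  filter_upwards [hcont.eventually hline] with y hy hoy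
  by_contra! hneg
  have hne : c.side v o - c.side v y ≠ 0 := by
    intro h
    rw [sub_eq_zero] at h
    rw [h] at hneg; nlinarith [mul_self_nonneg (c.side v y)]
  refine hy ?_ (hoy ?_)
  · rw [side_add_smul, div_mul_cancel₀ _ hne]; ring
  · rw [openSegment_symm]
    refine mem_openSegment_iff.2 ⟨_, ?_, ?_, rfl⟩
    · rcases mul_neg_iff.1 hneg with ⟨h1, h2⟩ | ⟨h1, h2⟩
      · exact div_pos_of_neg_of_neg (by linarith) (by linarith)
      · exact div_pos (by linarith) (by linarith)
    · rcases mul_neg_iff.1 hneg with ⟨h1, h2⟩ | ⟨h1, h2⟩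
      · rw [div_lt_one_of_neg (by linarith)]; linarith
      · rw [div_lt_one (by linarith)]; linarith

theorem not_mem_free_of_mem_edge {v y : Plane} (hv : v ∈ c.P) (hy : y ∈ c.edge v) :
    y ∉ c.free K := fun h => h.2 (Or.inl (mem_edges.2 ⟨v, hv, hy⟩))

theorem mem_walls_of_not_mem_free {x : Plane} (hx : x ∉ c.free K) : x ∈ c.Ω → x ∈ c.walls K := by
  intro h; by_contra h'; exact hx ⟨h, h'⟩

theorem Core.lab_unique {D : Finset Plane} (hK : Core c K D) {o x : Plane} {a b : Bool}
    (ha : c.Lab K o x a) (hb : c.Lab K o x b) : a = b := by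
  by_cases hx : x ∈ c.Ω
  · by_cases hM : x ∈ c.edges
    · obtain ⟨v, hv, hxv⟩ := mem_edges.1 hM
      have := (ha.side_iff hv hxv).symm.trans (hb.side_iff hv hxv)
      revert this; cases a <;> cases b <;> simp
    · exact hK.uniq x hx hM _ _ (ha.mem_of_not_mem_edges hx hM) (hb.mem_of_not_mem_edges hx hM)
  · rw [ha.eq_of_not_mem hx, hb.eq_of_not_mem hx]

/-- What an observer sees near a wall point has constant label, unless this point is in `P`. -/
theorem Core.exists_eventually_lab (hK : Core c K c.P) {o x : Plane} (hx : x ∉ c.free K)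
    (hxP : x ∉ c.P) (hox : openSegment ℝ o x ⊆ c.free K) :
    ∃ a, ∀ᶠ y in 𝓝 x, y ∉ c.free K → openSegment ℝ o y ⊆ c.free K → c.Lab K o y a := by
  by_cases hM : x ∈ c.edges
  · obtain ⟨v, hv, hxv⟩ := mem_edges.1 hM
    have hxo : x ∈ openSegment ℝ v (c.π v) := by
      rcases mem_segment_cases hxv with rfl | rfl | h
      · exact absurd hv hxP
      · exact absurd (c.partner_mem v hv) hxP
      · exact h
    have hline : ∀ᶠ y in 𝓝 x, c.side v y = 0 → y ∈ c.edge v := eventually_mem_edge_of_side hv hxo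
    obtain ⟨h0, hside⟩ := side_of_visible (side_of_mem_edge hxv)
      (hline.mono fun y hy h => not_mem_free_of_mem_edge hv (hy h)) hox
    -- The label is that of the side of the edge which the observer sees. Plain walls near `x` that
    -- are visible are on the same side, and so have the same label.
    refine ⟨decide (0 < c.side v o), ?_⟩
    have hKs : ∀ᶠ y in 𝓝 x, ∀ b, y ∈ K b → c.side v y ≠ 0 → (0 < c.side v y ↔ b = true) :=
      eventually_all.2 fun b => hK.side v hv x hxo b
    filter_upwards [eventually_edges_near hv hxv, hline, hside, hKs,
      isOpen_Ω.mem_nhds (edge_subset_Ω hv hxv)] with y h1 h2 h3 h4 h5 hyf hoy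
    rcases mem_walls_iff.1 (mem_walls_of_not_mem_free hyf h5) with h | ⟨b, hb⟩
    · exact Or.inr (Or.inl ⟨h5, v, hv, h1 h, by simp⟩)
    · by_cases hyM : y ∈ c.edges
      · exact Or.inr (Or.inl ⟨h5, v, hv, h1 hyM, by simp⟩)
      · have hs : c.side v y ≠ 0 := fun h => hyM (mem_edges.2 ⟨v, hv, h2 h⟩)
        have hb' : (0 < c.side v o ↔ b = true) := by
          rw [← h4 b hb hs]
          have h6 : 0 < c.side v y * c.side v o :=
            lt_of_le_of_ne (h3 hoy) (mul_ne_zero hs h0).symm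
          rcases mul_pos_iff.1 h6 with h | h
          · simp [h.1, h.2]
          · simp [h.1.not_gt, h.2.not_gt]
        have : decide (0 < c.side v o) = b := by
          cases b <;> simp_all
        rw [this]
        exact Or.inr (Or.inr ⟨h5, hyM, hb⟩)
  · -- Away from edges and from the plain walls of one label, there are only those of the other one.
    have key : ∀ a, x ∉ K (!a) → ∀ᶠ y in 𝓝 x, y ∉ c.edges ∧
        (y ∈ c.Ω → y ∈ c.walls K → y ∈ K a) := by
      intro a ha
      filter_upwards [isClosed_edges.isOpen_compl.mem_nhds hM,
        (hK.closed _).isOpen_compl.mem_nhds ha] with y h1 h2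
      refine ⟨h1, fun _ hy => ?_⟩
      rcases mem_walls_iff.1 hy with h | ⟨b, hb⟩
      · exact absurd h h1
      · have : b = a := by
          by_contra hne
          have : b = !a := by revert hne; cases a <;> cases b <;> simp
          exact h2 (this ▸ hb)
        exact this ▸ hb
    by_cases hxΩ : x ∈ c.Ω
    · obtain ⟨a, ha⟩ : ∃ a, x ∈ K a := by
        rcases mem_walls_iff.1 (mem_walls_of_not_mem_free hx hxΩ) with h | h
        · exact absurd h hM
        · exact h
      refine ⟨a, ?_⟩
      filter_upwards [key a fun h => by simpa using hK.uniq x hxΩ hM _ _ ha h,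
        isOpen_Ω.mem_nhds hxΩ] with y h1 h2 hyf _
      exact Or.inr (Or.inr ⟨h2, h1.1, h1.2 h2 (mem_walls_of_not_mem_free hyf h2)⟩)
    · refine ⟨c.ω, ?_⟩
      filter_upwards [key c.ω fun h => by simpa using hK.out _ x hxΩ h] with y h1 hyf _
      by_cases h2 : y ∈ c.Ω
      · exact Or.inr (Or.inr ⟨h2, h1.1, h1.2 h2 (mem_walls_of_not_mem_free hyf h2)⟩)
      · exact Or.inl ⟨h2, rfl⟩

/-- `dl v` is the label of the extension of the edge at `v` beyond `v`. -/
def DoorLabels (c : Config) (K : Bool → Set Plane) (dl : Plane → Bool) : Prop :=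
  ∀ v ∈ c.P, (∀ᶠ t : ℝ in 𝓝[≥] 0, v + t • (v - c.π v) ∈ K (dl v)) ∧
    ∀ᶠ y in 𝓝 v, ∀ a', y ∈ K a' → a' = dl v ∧ ∃ t : ℝ, 0 ≤ t ∧ y = v + t • (v - c.π v)

theorem Core.exists_doorLabels (hK : Core c K c.P) : ∃ dl, DoorLabels c K dl := by
  have : ∀ v, ∃ a, v ∈ c.P → ((∀ᶠ t : ℝ in 𝓝[≥] 0, v + t • (v - c.π v) ∈ K a) ∧
    ∀ᶠ y in 𝓝 v, ∀ a', y ∈ K a' → a' = a ∧ ∃ t : ℝ, 0 ≤ t ∧ y = v + t • (v - c.π v)) := by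
    intro v
    by_cases hv : v ∈ c.P
    · obtain ⟨a, ha⟩ := hK.door v hv hv
      exact ⟨a, fun _ => ha⟩
    · exact ⟨true, fun h => absurd h hv⟩
  choose dl hdl using this
  exact ⟨dl, hdl⟩

/-- The walls contain a neighbourhood of `v` in the line of its edge. -/
theorem DoorLabels.eventually_not_free {dl : Plane → Bool} (hdl : DoorLabels c K dl) {v : Plane}
    (hv : v ∈ c.P) : ∀ᶠ y in 𝓝 v, c.side v y = 0 → y ∉ c.free K := by
  have h1 := (hdl v hv).1
  rw [eventually_nhdsWithin_iff] at h1
  have ht := (continuous_param (c := c) v).tendsto v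
  have h0 : c.param v v = 0 := by simpa using param_add_smul hv 0
  rw [h0] at ht
  filter_upwards [ht.eventually h1, ht.eventually (eventually_gt_nhds (b := -1) (by norm_num))]
    with y h2 h3 hy
  obtain ⟨t, rfl⟩ := (side_eq_zero_iff hv).1 hy
  rw [param_add_smul hv] at h2 h3
  rcases le_total 0 t with h | h
  · exact fun hf => hf.2 (mem_walls_of_mem (h2 h))
  · exact not_mem_free_of_mem_edge hv ((mem_edge_iff hv t).2 ⟨h3.le, h⟩)

/-- Near the point `v` of `P`, there is nothing but its edge and the extension thereof. -/
theorem DoorLabels.eventually_side {dl : Plane → Bool} (hdl : DoorLabels c K dl) {v : Plane}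
    (hv : v ∈ c.P) : ∀ᶠ y in 𝓝 v, y ∉ c.free K → ∃ t : ℝ, y = v + t • (v - c.π v) ∧
      (0 < t → y ∈ c.Ω ∧ y ∉ c.edges ∧ y ∈ K (dl v)) ∧
      (t < 0 → y ∈ c.Ω ∧ y ∈ c.edge v) := by
  filter_upwards [(hdl v hv).2, eventually_edges_near hv (tip_mem_edge v),
    isOpen_Ω.mem_nhds (tip_mem_Ω hv)] with y h1 h2 h3 hy
  rcases mem_walls_iff.1 (mem_walls_of_not_mem_free hy h3) with h | ⟨a, ha⟩
  · have hyv := h2 h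
    obtain ⟨t, rfl⟩ := (side_eq_zero_iff hv).1 (side_of_mem_edge hyv)
    have := (mem_edge_iff hv t).1 hyv
    exact ⟨t, rfl, fun h => absurd this.2 (not_le.2 h), fun _ => ⟨h3, hyv⟩⟩
  · obtain ⟨rfl, t, ht, rfl⟩ := h1 a ha
    refine ⟨t, rfl, fun h => ⟨h3, fun hM => ?_, ha⟩, fun h => absurd ht (not_le.2 h)⟩
    exact absurd ((mem_edge_iff hv t).1 (h2 hM)).2 (not_le.2 h)

/-- The point `v` of `P` is visible from `o`, and `o` is on the side of its edge whose label differs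
from the label of the extension of the edge beyond `v`. -/
def Belongs (c : Config) (K : Bool → Set Plane) (dl : Plane → Bool) (v o : Plane) : Prop :=
  openSegment ℝ o v ⊆ c.free K ∧ (0 < c.side v o ↔ dl v = false)

open Classical in
/-- Going around the cell of a point `o`, labels jump up at the blue points that belong to the cell,
and down at the red ones. So the cell contains as many blue as red points. If `o` is on the given
line, then these numbers differ by at most one on one side of this line. -/
theorem Core.balanced (hK : Core c K c.P) {dl : Plane → Bool} (hdl : DoorLabels c K dl)
    {o : Plane} (ho : o ∈ c.free K) :
    (∑ v ∈ c.P with Belongs c K dl v o, c.σ v) = 0 ∧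
    (cross (o - c.center) c.τ = 0 →
      |∑ v ∈ c.P with Belongs c K dl v o ∧ 0 < cross (v - c.center) c.τ, c.σ v| ≤ 1) := by
  have hT := hK.visTrans
  have hU := hK.isOpen_free
  set C := cell (c.free K) o with hC
  have hCfree : C ⊆ c.free K := cell_subset o
  obtain ⟨ρ, hρc, hρ0, hρp, hρ⟩ := exists_radial (isOpen_cell hU o) (hT.convex_cell o)
    ((Metric.isBounded_ball).subset (hCfree.trans fun x hx => hx.1)) (mem_cell_self ho)
  -- The boundary of the cell, which consists of points of walls that are visible from `o`.
  set b : ℝ → Plane := fun θ => o + ρ θ • dir θ with hb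
  have hbc : Continuous b := continuous_const.add (hρc.smul continuous_dir)
  have hbo : ∀ θ, openSegment ℝ o (b θ) ⊆ c.free K := by
    intro θ x hx
    obtain ⟨t, h0, h1, rfl⟩ := mem_openSegment_iff.1 hx
    apply hCfree
    rw [hb, add_sub_cancel_left, smul_smul]
    have := hρ0 θ
    exact (hρ θ _ (by positivity)).2 (by nlinarith)
  have hbC : ∀ θ, b θ ∉ C := fun θ h => lt_irrefl _ ((hρ θ _ (hρ0 θ).le).1 h)
  have hbf : ∀ θ, b θ ∉ c.free K := by
    intro θ
    refine hT.not_mem_of_mem_closure hU ?_ (hbC θ)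
    have h1 : Tendsto (fun t : ℝ => o + t • dir θ) (𝓝[<] (ρ θ)) (𝓝 (b θ)) := by
      have : Continuous fun t : ℝ => o + t • dir θ := by fun_prop
      exact (this.tendsto _).mono_left nhdsWithin_le_nhds
    refine mem_closure_of_tendsto h1 ?_
    filter_upwards [self_mem_nhdsWithin,
      (eventually_gt_nhds (hρ0 θ)).filter_mono nhdsWithin_le_nhds] with t ht ht0
    exact (hρ θ t ht0.le).2 ht
  have hbp : ∀ θ, b (θ + 2 * Real.pi) = b θ := fun θ => by simp only [hb, hρp, dir_add_two_pi]
  -- The boundary point in the direction of a visible wall point is this point.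
  have hvis : ∀ (θ r : ℝ) (v : Plane), 0 ≤ r → v = o + r • dir θ → v ∉ c.free K →
      openSegment ℝ o v ⊆ c.free K → b θ = v := by
    intro θ r v hr hv hvf hov
    have h1 : ρ θ ≤ r := by
      by_contra! h
      exact hvf (hCfree (hv ▸ (hρ θ r hr).2 h))
    have h2 : r ≤ ρ θ := by
      by_contra! h
      apply hbf θ
      apply hov
      refine mem_openSegment_iff.2 ⟨ρ θ / r, div_pos (hρ0 θ) ((hρ0 θ).trans h), ?_, ?_⟩
      · rw [div_lt_one ((hρ0 θ).trans h)]; exact h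
      · rw [hv, add_sub_cancel_left, smul_smul, div_mul_cancel₀ _ ((hρ0 θ).trans h).ne']
    rw [hv, ← le_antisymm h1 h2]
  -- The label in direction `θ`, as a number.
  set g : ℝ → ℤ := fun θ => if c.Lab K o (b θ) true then 1 else 0 with hg
  have hgLab : ∀ θ a, c.Lab K o (b θ) a → g θ = if a = true then 1 else 0 := by
    intro θ a ha
    simp only [hg]
    cases a
    · simp only [Bool.false_eq_true, if_false, ite_eq_right_iff]
      intro h; exact absurd (hK.lab_unique ha h) (by simp)
    · simp [ha]
  have hgp : ∀ θ, g (θ + 2 * Real.pi) = g θ := fun θ => by simp only [hg, hbp]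
  -- The label jumps at the points of `P` that belong to the cell, by their signs.
  have hlocal : ∀ θ₀, ∃ cl cr : ℤ, (cl = 0 ∨ cl = 1) ∧ (∀ᶠ θ in 𝓝[<] θ₀, g θ = cl) ∧
      (∀ᶠ θ in 𝓝[>] θ₀, g θ = cr) ∧
      cr = cl + if b θ₀ ∈ c.P ∧ Belongs c K dl (b θ₀) o then c.σ (b θ₀) else 0 := by
    intro θ₀
    by_cases hP : b θ₀ ∈ c.P
    · obtain ⟨v, hv⟩ : ∃ v, v = b θ₀ := ⟨_, rfl⟩
      rw [← hv] at hP ⊢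
      have hov : openSegment ℝ o v ⊆ c.free K := hv ▸ hbo θ₀
      obtain ⟨h0, -⟩ := side_of_visible (side_of_mem_edge (tip_mem_edge v))
        (hdl.eventually_not_free hP) hov
      have hbt : Tendsto b (𝓝 θ₀) (𝓝 v) := by rw [hv]; exact hbc.tendsto θ₀
      have hev := hbt.eventually (hdl.eventually_side hP)
      -- Before `v`, the boundary runs along the edge and after `v` along its extension, or vice
      -- versa. This depends on the sign of `v` and the side on which `o` is.
      have hpar : ∀ θ t, b θ = v + t • (v - c.π v) →
          ρ θ₀ * ρ θ * Real.sin (θ - θ₀) = - (t * c.σ v * c.side v o) := by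
        intro θ t ht
        have e1 : cross (v - o) (b θ - o) = ρ θ₀ * ρ θ * Real.sin (θ - θ₀) := by
          rw [hv, hb, add_sub_cancel_left, add_sub_cancel_left, cross_smul_left, cross_smul_right,
            cross_dir]; ring
        have hσ : (c.σ v : ℝ) * c.σ v = 1 := by
          rcases c.sign_eq v hP with h | h <;> simp [h]
        rw [← e1, ht]
        have e2 : t * c.σ v * c.side v o = t * cross (c.π v - v) (o - v) := by
          unfold LabelledWalls.Config.side
          linear_combination t * cross (c.π v - v) (o - v) * hσ
        rw [e2]
        have e3 : v + t • (v - c.π v) - o = (v - o) + t • (v - c.π v) := by abel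
        rw [e3, cross_add_right, cross_self, cross_smul_right, zero_add,
          ← neg_sub o v, ← neg_sub (c.π v) v, cross_neg_left, cross_neg_right,
          cross_swap (o - v)]
        ring
      have hbefore : ∀ᶠ θ in 𝓝[<] θ₀, ∃ t : ℝ, b θ = v + t • (v - c.π v) ∧
          0 < t * c.σ v * c.side v o ∧ (0 < t → g θ = if dl v = true then 1 else 0) ∧
          (t < 0 → g θ = if 0 < c.side v o then 1 else 0) := by
        have hlt : ∀ᶠ θ in 𝓝[<] θ₀, θ₀ - Real.pi < θ :=
          (eventually_gt_nhds (by linarith [Real.pi_pos])).filter_mono nhdsWithin_le_nhds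
        filter_upwards [hev.filter_mono nhdsWithin_le_nhds, self_mem_nhdsWithin, hlt]
          with θ h1 h2 h3
        obtain ⟨t, ht, hpos, hneg⟩ := h1 (hbf θ)
        refine ⟨t, ht, ?_, fun h => hgLab θ _ (Or.inr (Or.inr (hpos h))), fun h => ?_⟩
        · have := hpar θ t ht
          have hs : Real.sin (θ - θ₀) < 0 :=
            Real.sin_neg_of_neg_of_neg_pi_lt (sub_neg.2 h2) (by linarith)
          nlinarith [mul_pos (hρ0 θ₀) (hρ0 θ)]
        · have := hgLab θ (decide (0 < c.side v o))
            (Or.inr (Or.inl ⟨(hneg h).1, v, hP, (hneg h).2, by simp⟩))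
          simpa using this
      have hafter : ∀ᶠ θ in 𝓝[>] θ₀, ∃ t : ℝ, b θ = v + t • (v - c.π v) ∧
          t * c.σ v * c.side v o < 0 ∧ (0 < t → g θ = if dl v = true then 1 else 0) ∧
          (t < 0 → g θ = if 0 < c.side v o then 1 else 0) := by
        have hlt : ∀ᶠ θ in 𝓝[>] θ₀, θ < θ₀ + Real.pi :=
          (eventually_lt_nhds (by linarith [Real.pi_pos])).filter_mono nhdsWithin_le_nhds
        filter_upwards [hev.filter_mono nhdsWithin_le_nhds, self_mem_nhdsWithin, hlt]
          with θ h1 h2 h3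
        obtain ⟨t, ht, hpos, hneg⟩ := h1 (hbf θ)
        refine ⟨t, ht, ?_, fun h => hgLab θ _ (Or.inr (Or.inr (hpos h))), fun h => ?_⟩
        · have := hpar θ t ht
          have hs : 0 < Real.sin (θ - θ₀) :=
            Real.sin_pos_of_pos_of_lt_pi (sub_pos.2 h2) (by linarith)
          nlinarith [mul_pos (hρ0 θ₀) (hρ0 θ)]
        · have := hgLab θ (decide (0 < c.side v o))
            (Or.inr (Or.inl ⟨(hneg h).1, v, hP, (hneg h).2, by simp⟩))
          simpa using this
      have hbel : Belongs c K dl v o ↔ (0 < c.side v o ↔ dl v = false) :=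
        ⟨fun h => h.2, fun h => ⟨hov, h⟩⟩
      rcases c.sign_eq v hP with hσ | hσ <;> rcases lt_or_gt_of_ne h0 with hs | hs
      · refine ⟨0, if dl v = true then 1 else 0, by simp, ?_, ?_, ?_⟩
        · filter_upwards [hbefore] with θ hθ
          obtain ⟨t, -, h1, -, h3⟩ := hθ
          rw [hσ] at h1
          rw [h3 (by push_cast at h1; nlinarith), if_neg (by linarith)]
        · filter_upwards [hafter] with θ hθ
          obtain ⟨t, -, h1, h2, -⟩ := hθ
          rw [hσ] at h1
          exact h2 (by push_cast at h1; nlinarith)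
        · rw [hbel]; cases dl v <;> simp [hP, hσ, hs.le]
      · refine ⟨if dl v = true then 1 else 0, 1, by split_ifs <;> simp, ?_, ?_, ?_⟩
        · filter_upwards [hbefore] with θ hθ
          obtain ⟨t, -, h1, h2, -⟩ := hθ
          rw [hσ] at h1
          exact h2 (by push_cast at h1; nlinarith)
        · filter_upwards [hafter] with θ hθ
          obtain ⟨t, -, h1, -, h3⟩ := hθ
          rw [hσ] at h1
          rw [h3 (by push_cast at h1; nlinarith), if_pos hs]
        · rw [hbel]; cases dl v <;> simp [hP, hσ, hs]
      · refine ⟨if dl v = true then 1 else 0, 0, by split_ifs <;> simp, ?_, ?_, ?_⟩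
        · filter_upwards [hbefore] with θ hθ
          obtain ⟨t, -, h1, h2, -⟩ := hθ
          rw [hσ] at h1
          exact h2 (by push_cast at h1; nlinarith)
        · filter_upwards [hafter] with θ hθ
          obtain ⟨t, -, h1, -, h3⟩ := hθ
          rw [hσ] at h1
          rw [h3 (by push_cast at h1; nlinarith), if_neg (by linarith)]
        · rw [hbel]; cases dl v <;> simp [hP, hσ, hs.le]
      · refine ⟨1, if dl v = true then 1 else 0, by simp, ?_, ?_, ?_⟩
        · filter_upwards [hbefore] with θ hθ
          obtain ⟨t, -, h1, -, h3⟩ := hθ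
          rw [hσ] at h1
          rw [h3 (by push_cast at h1; nlinarith), if_pos hs]
        · filter_upwards [hafter] with θ hθ
          obtain ⟨t, -, h1, h2, -⟩ := hθ
          rw [hσ] at h1
          exact h2 (by push_cast at h1; nlinarith)
        · rw [hbel]; cases dl v <;> simp [hP, hσ, hs]
    · obtain ⟨a, ha⟩ := hK.exists_eventually_lab (hbf θ₀) hP (hbo θ₀)
      have : ∀ᶠ θ in 𝓝 θ₀, g θ = if a = true then 1 else 0 := by
        filter_upwards [(hbc.tendsto θ₀).eventually ha] with θ h
        exact hgLab θ a (h (hbf θ) (hbo θ))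
      refine ⟨if a = true then 1 else 0, if a = true then 1 else 0, by split_ifs <;> simp,
        this.filter_mono nhdsWithin_le_nhds, this.filter_mono nhdsWithin_le_nhds, by simp [hP]⟩
  choose cl cr hcl01 hcl hcr hclcr using hlocal
  -- Angles are measured from the direction opposite to `τ`. So the first half of a turn sweeps the
  -- positive side of the line, if `o` is on the line.
  obtain ⟨φ, -, hφ⟩ := exists_polar 0 c.τ
  rw [c.norm_τ, one_smul] at hφ
  set s := φ - Real.pi with hs
  choose ang hangI hang using fun v => exists_polar s (v - o)
  have hang' : ∀ v, v = o + ‖v - o‖ • dir (ang v) := fun v => by rw [← hang]; abel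
  set T := c.P.filter fun v => Belongs c K dl v o with hTdef
  have hbang : ∀ v ∈ T, b (ang v) = v := by
    intro v hv
    obtain ⟨hvP, hvB⟩ := Finset.mem_filter.1 hv
    exact hvis _ _ v (norm_nonneg _) (hang' v)
      (not_mem_free_of_mem_edge hvP (tip_mem_edge v)) hvB.1
  have hjump : ∀ θ ∈ Ico s (s + 2 * Real.pi),
      (if b θ ∈ c.P ∧ Belongs c K dl (b θ) o then c.σ (b θ) else 0) =
        ∑ v ∈ T with ang v = θ, c.σ v := by
    intro θ hθ
    have hpos : b θ ∈ c.P → 0 < ‖b θ - o‖ := by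
      intro h
      rw [norm_pos_iff, sub_ne_zero]
      rintro h'
      exact hbC θ (h' ▸ mem_cell_self ho)
    split_ifs with h
    · have : T.filter (fun v => ang v = θ) = {b θ} := by
        ext v
        simp only [Finset.mem_filter, Finset.mem_singleton]
        constructor
        · rintro ⟨hv, rfl⟩; exact (hbang v hv).symm
        · rintro rfl
          refine ⟨Finset.mem_filter.2 h, ?_⟩
          refine polar_unique (hangI _) hθ (hpos h.1) (hρ0 θ) ?_
          rw [← hang, hb, add_sub_cancel_left]
      rw [this, Finset.sum_singleton]
    · have : T.filter (fun v => ang v = θ) = ∅ := by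
        rw [Finset.filter_eq_empty_iff]
        rintro v hv rfl
        rw [hbang v hv] at h
        exact h (Finset.mem_filter.1 hv)
      rw [this, Finset.sum_empty]
  have hsum : ∀ t ∈ Icc s (s + 2 * Real.pi), cl t - cl s = ∑ v ∈ T with ang v ∈ Ico s t, c.σ v := by
    intro t ht
    refine sum_jumps T ang c.σ g cl ht.1 (fun θ _ => hcl θ) fun θ hθ => ?_
    filter_upwards [hcr θ] with x hx
    rw [hx, hclcr, hjump θ ⟨hθ.1, hθ.2.trans_le ht.2⟩]
  have hπ := Real.pi_pos
  constructor
  · have h1 := hsum (s + 2 * Real.pi) ⟨by linarith, le_rfl⟩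
    have h2 : cl (s + 2 * Real.pi) = cl s := by
      have h3 : Tendsto (fun θ => θ + 2 * Real.pi) (𝓝[<] s) (𝓝[<] (s + 2 * Real.pi)) := by
        refine tendsto_nhdsWithin_of_tendsto_nhds_of_eventually_within _ ?_ ?_
        · have : Continuous fun θ : ℝ => θ + 2 * Real.pi := by fun_prop
          exact (this.tendsto s).mono_left nhdsWithin_le_nhds
        · filter_upwards [self_mem_nhdsWithin] with θ hθ
          simp only [mem_Iio] at hθ ⊢; linarith
      obtain ⟨θ, h4, h5⟩ := ((h3.eventually (hcl (s + 2 * Real.pi))).and (hcl s)).exists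
      rw [← h4, ← h5, hgp]
    rw [h2, sub_self] at h1
    rw [h1, Finset.filter_true_of_mem fun v _ => hangI v]
  · intro hoL
    have h1 := hsum φ ⟨by linarith, by linarith⟩
    have h2 : (c.P.filter fun v => Belongs c K dl v o ∧ 0 < cross (v - c.center) c.τ) =
        T.filter fun v => ang v ∈ Ico s φ := by
      ext v
      simp only [hTdef, Finset.mem_filter, and_assoc]
      refine and_congr_right fun hvP => and_congr_right fun hvB => ?_
      have e1 : cross (v - c.center) c.τ = ‖v - o‖ * Real.sin (φ - ang v) := by
        have : v - c.center = (o - c.center) + (v - o) := by abel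
        rw [this, cross_add_left, hoL, zero_add, hang, cross_smul_left]
        conv_lhs => rw [hφ, cross_dir]
        rw [← hang]
      have hI := hangI v
      have hne := c.cross_τ_ne v hvP
      constructor
      · intro hpos
        refine ⟨hI.1, ?_⟩
        by_contra! h
        have : Real.sin (φ - ang v) ≤ 0 :=
          Real.sin_nonpos_of_nonpos_of_neg_pi_le (by linarith) (by linarith [hI.2])
        rw [e1] at hpos
        nlinarith [norm_nonneg (v - o)]
      · intro hmem
        refine lt_of_le_of_ne ?_ hne.symm
        rw [e1]
        exact mul_nonneg (norm_nonneg _)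
          (Real.sin_nonneg_of_nonneg_of_le_pi (by linarith [hmem.2]) (by linarith [hmem.1]))
    -- The labels at the beginning and the end of the half turn are `0` or `1`.
    rw [h2, ← h1, abs_le]
    rcases hcl01 φ with h | h <;> rcases hcl01 s with h' | h' <;> rw [h, h'] <;> norm_num

end Config

namespace Config

variable {c : Config} {K : Bool → Set Plane} {dl : Plane → Bool}

/-! ### The cell of a point of the matching -/

theorem side_add_smul_tip (v y : Plane) (t : ℝ) :
    c.side v (v + t • (y - v)) = t * c.side v y := by
  rw [side_add_smul, side_of_mem_edge (tip_mem_edge v)]; ring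

/-- Near `v`, all points that are not on the line of the edge are free. -/
theorem DoorLabels.eventually_free (hdl : DoorLabels c K dl) {v : Plane} (hv : v ∈ c.P) :
    ∃ ε > 0, ∀ y ∈ Metric.ball v ε, c.side v y ≠ 0 → y ∈ c.free K := by
  obtain ⟨ε, hε, h⟩ := Metric.eventually_nhds_iff_ball.1 (hdl.eventually_side hv)
  refine ⟨ε, hε, fun y hy hs => ?_⟩
  by_contra hyf
  obtain ⟨t, ht, -⟩ := h y hy hyf
  exact hs ((side_eq_zero_iff hv).2 ⟨t, ht⟩)

theorem Belongs.side_ne (hdl : DoorLabels c K dl) {v o : Plane} (hv : v ∈ c.P)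
    (h : Belongs c K dl v o) : c.side v o ≠ 0 :=
  (side_of_visible (side_of_mem_edge (tip_mem_edge v)) (hdl.eventually_not_free hv) h.1).1

theorem exists_small_smul (v y : Plane) {ε : ℝ} (hε : 0 < ε) :
    ∃ t₀ : ℝ, 0 < t₀ ∧ ∀ t : ℝ, 0 < t → t < t₀ → v + t • y ∈ Metric.ball v ε := by
  obtain ⟨δ, hδ, h⟩ := Metric.eventually_nhds_iff.1
    ((tendsto_add_smul v y).eventually (Metric.ball_mem_nhds v hε))
  refine ⟨δ, hδ, fun t h0 h1 => h ?_⟩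
  rwa [Real.dist_eq, sub_zero, abs_of_pos h0]

/-- A point near `v` that is on the right side of its edge has `v` belong to it. -/
theorem DoorLabels.belongs_of_near (hdl : DoorLabels c K dl) {v : Plane} (hv : v ∈ c.P) :
    ∃ ε > 0, ∀ y ∈ Metric.ball v ε, c.side v y ≠ 0 → (0 < c.side v y ↔ dl v = false) →
      y ∈ c.free K ∧ Belongs c K dl v y := by
  obtain ⟨ε, hε, h⟩ := hdl.eventually_free hv
  refine ⟨ε, hε, fun y hy hs hs' => ⟨h y hy hs, fun x hx => ?_, hs'⟩⟩
  rw [openSegment_symm] at hx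
  have hxb : x ∈ Metric.ball v ε := (convex_ball v ε).segment_subset (Metric.mem_ball_self hε) hy
    (openSegment_subset_segment _ _ _ hx)
  obtain ⟨t, h0, h1, rfl⟩ := mem_openSegment_iff.1 hx
  refine h _ hxb ?_
  rw [side_add_smul_tip]
  exact mul_ne_zero h0.ne' hs

theorem DoorLabels.exists_belongs (hdl : DoorLabels c K dl) {v : Plane} (hv : v ∈ c.P) :
    ∃ o ∈ c.free K, Belongs c K dl v o := by
  obtain ⟨ε, hε, h⟩ := hdl.belongs_of_near hv
  obtain ⟨e, he⟩ : ∃ e : Plane, c.σ v * cross (c.π v - v) e = if dl v then -1 else 1 := by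
    set d := c.π v - v with hd
    have hd0 : cross d !₂[-d 1, d 0] ≠ 0 := by
      have h1 : cross d !₂[-d 1, d 0] = d 0 * d 0 + d 1 * d 1 := by simp [cross]
      have hne : d ≠ 0 := sub_ne_zero.2 (c.partner_ne v hv)
      rw [h1]
      intro h0
      apply hne
      ext i; fin_cases i
      · simp; nlinarith [mul_self_nonneg (d 0), mul_self_nonneg (d 1)]
      · simp; nlinarith [mul_self_nonneg (d 0), mul_self_nonneg (d 1)]
    have hσ := sign_ne_zero hv
    refine ⟨((if dl v then -1 else 1) / (c.σ v * cross d !₂[-d 1, d 0])) • !₂[-d 1, d 0], ?_⟩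
    rw [cross_smul_right]
    field_simp
  obtain ⟨t₀, ht₀, ht⟩ := exists_small_smul v e hε
  have hs : c.side v (v + (t₀ / 2) • e) = t₀ / 2 * if dl v then -1 else 1 := by
    rw [side_add_smul', side_of_mem_edge (tip_mem_edge v), he]; ring
  refine ⟨_, h _ (ht (t₀ / 2) (by linarith) (by linarith)) ?_ ?_⟩
  · rw [hs]; split_ifs <;> simp [ht₀.ne']
  · rw [hs]
    cases dl v
    · simp [ht₀]
    · simp only [if_true, Bool.true_eq_false, iff_false]; linarith

/-- All points that see `v` on the same side of its edge are in the same cell. -/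
theorem Belongs.mem_cell (hT : VisTrans (c.free K)) (hdl : DoorLabels c K dl) {v o o' : Plane}
    (hv : v ∈ c.P) (ho : o ∈ c.free K) (ho' : o' ∈ c.free K) (h : Belongs c K dl v o)
    (h' : Belongs c K dl v o') : o' ∈ cell (c.free K) o := by
  obtain ⟨ε, hε, hfree⟩ := hdl.eventually_free hv
  obtain ⟨t₀, ht₀, ht⟩ := exists_small_smul v (o - v) hε
  obtain ⟨t₁, ht₁, ht'⟩ := exists_small_smul v (o' - v) hε
  have hs := h.side_ne hdl hv
  have hs' := h'.side_ne hdl hv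
  obtain ⟨t, h0, htt₀, htt₁, h1⟩ : ∃ t : ℝ, 0 < t ∧ t < t₀ ∧ t < t₁ ∧ t < 1 := by
    obtain ⟨t, h0, h1⟩ := exists_between (show (0 : ℝ) < min (min t₀ t₁) 1 by positivity)
    exact ⟨t, h0, h1.trans_le ((min_le_left _ _).trans (min_le_left _ _)),
      h1.trans_le ((min_le_left _ _).trans (min_le_right _ _)), h1.trans_le (min_le_right _ _)⟩
  have aux : ∀ {p : Plane}, p ∈ c.free K → Belongs c K dl v p →
      v + t • (p - v) ∈ cell (c.free K) p := by
    intro p hp hB x hx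
    have hmem : v + t • (p - v) ∈ openSegment ℝ p v := by
      rw [openSegment_symm]; exact mem_openSegment_iff.2 ⟨t, h0, h1, rfl⟩
    rcases mem_segment_cases hx with rfl | rfl | hx
    · exact hp
    · exact hB.1 hmem
    · obtain ⟨r, hr0, hr1, rfl⟩ := mem_openSegment_iff.1 hx
      refine hB.1 (mem_openSegment_iff.2 ⟨r * (1 - t), by nlinarith, by nlinarith, ?_⟩)
      have : v + t • (p - v) - p = (1 - t) • (v - p) := by
        rw [sub_smul, one_smul, ← neg_sub v p, smul_neg]; abel
      rw [this, smul_smul]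
  have hyy' : v + t • (o' - v) ∈ cell (c.free K) (v + t • (o - v)) := by
    intro x hx
    have hxb : x ∈ Metric.ball v ε :=
      (convex_ball v ε).segment_subset (ht t h0 htt₀) (ht' t h0 htt₁) hx
    refine hfree x hxb ?_
    obtain ⟨r, hr0, hr1, rfl⟩ := mem_segment_iff.1 hx
    rw [side_add_smul, side_add_smul_tip, side_add_smul_tip]
    have e : t * c.side v o + r * (t * c.side v o' - t * c.side v o) =
      t * ((1 - r) * c.side v o + r * c.side v o') := by ring
    rw [e]
    refine mul_ne_zero h0.ne' ?_
    rcases lt_or_gt_of_ne hs with h2 | h2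
    · have h3 : c.side v o' < 0 := by
        refine lt_of_le_of_ne (not_lt.1 fun h4 => ?_) hs'
        exact absurd (h.2.2 (h'.2.1 h4)) (not_lt.2 h2.le)
      rcases eq_or_lt_of_le hr0 with rfl | hr
      · simpa using h2.ne
      · nlinarith
    · have h3 : 0 < c.side v o' := h'.2.2 (h.2.1 h2)
      rcases eq_or_lt_of_le hr0 with rfl | hr
      · simpa using h2.ne'
      · nlinarith
  exact hT (hT (aux ho h) hyy') (mem_cell_comm.1 (aux ho' h'))

theorem Belongs.openSegment_subset_cell {v o : Plane} (ho : o ∈ c.free K)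
    (h : Belongs c K dl v o) : openSegment ℝ o v ⊆ cell (c.free K) o := by
  intro x hx y hy
  obtain ⟨t, h0, h1, rfl⟩ := mem_openSegment_iff.1 hx
  rcases mem_segment_cases hy with rfl | rfl | hy
  · exact ho
  · exact h.1 hx
  · obtain ⟨r, hr0, hr1, rfl⟩ := mem_openSegment_iff.1 hy
    refine h.1 (mem_openSegment_iff.2 ⟨r * t, by positivity, by nlinarith, ?_⟩)
    rw [add_sub_cancel_left, smul_smul]

theorem Belongs.mem_closure {v o : Plane} (ho : o ∈ c.free K) (h : Belongs c K dl v o) :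
    v ∈ closure (cell (c.free K) o) := by
  refine closure_mono (h.openSegment_subset_cell ho) ?_
  rw [closure_openSegment]; exact right_mem_segment _ _ _

theorem Belongs.of_mem_cell (hK : Core c K c.P) (hdl : DoorLabels c K dl) {v o o' : Plane}
    (hv : v ∈ c.P) (ho : o ∈ c.free K) (h : Belongs c K dl v o) (ho' : o' ∈ cell (c.free K) o) :
    Belongs c K dl v o' := by
  have hT := hK.visTrans
  have hsub := hT.openSegment_subset hK.isOpen_free ho' (h.mem_closure ho)
  have hsub' : openSegment ℝ o' v ⊆ c.free K := hsub.trans (cell_subset o)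
  refine ⟨hsub', ?_⟩
  have hline := hdl.eventually_not_free hv
  obtain ⟨hs, hev⟩ := side_of_visible (side_of_mem_edge (tip_mem_edge v)) hline h.1
  obtain ⟨hs', -⟩ := side_of_visible (side_of_mem_edge (tip_mem_edge v)) hline hsub'
  have h1 := ((tendsto_add_smul v (o' - v)).eventually hev).filter_mono
      (nhdsWithin_le_nhds (s := Ioi 0))
  have h2 : ∀ᶠ t : ℝ in 𝓝[>] 0, t < 1 :=
    (eventually_lt_nhds (by norm_num)).filter_mono nhdsWithin_le_nhds
  obtain ⟨t, ht, ht1, ht0⟩ := (h1.and (h2.and self_mem_nhdsWithin)).exists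
  have hy : v + t • (o' - v) ∈ cell (c.free K) o := by
    apply hsub
    rw [openSegment_symm]; exact mem_openSegment_iff.2 ⟨t, ht0, ht1, rfl⟩
  have h3 := ht ((openSegment_subset_segment _ _ _).trans hy)
  rw [side_add_smul_tip] at h3
  have h4 : 0 < c.side v o' * c.side v o := by
    refine lt_of_le_of_ne ?_ (mul_ne_zero hs' hs).symm
    have : 0 < t := ht0
    by_contra! h5
    nlinarith
  rw [← h.2]
  rcases mul_pos_iff.1 h4 with h5 | h5
  · simp [h5.1, h5.2]
  · simp [h5.1.not_gt, h5.2.not_gt]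

/-- Unless it is the edge at `v`, a segment between two points that belong to the same cell runs
within this cell. -/
theorem Belongs.openSegment_subset (hK : Core c K c.P) (hdl : DoorLabels c K dl) {v w o : Plane}
    (hv : v ∈ c.P) (hw : w ∈ c.P) (hvw : w ≠ v) (hπ : w ≠ c.π v) (ho : o ∈ c.free K)
    (hvo : Belongs c K dl v o) (hwo : Belongs c K dl w o) :
    openSegment ℝ v w ⊆ cell (c.free K) o := by
  have hT := hK.visTrans
  have hs : c.side v w ≠ 0 := side_tip_ne hv hw hvw hπ
  have hsign : 0 < c.side v w ↔ dl v = false := by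
    have h1 : ∀ y ∈ cell (c.free K) o, (0 < c.side v y ↔ dl v = false) := fun y hy =>
      (hvo.of_mem_cell hK hdl hv ho hy).2
    have hcont := continuous_side (c := c) v
    have hcl := hwo.mem_closure ho
    cases hd : dl v
    · simp only [hd, iff_true] at h1 ⊢
      have : w ∈ closure {y | 0 ≤ c.side v y} := closure_mono (fun y hy => (h1 y hy).le) hcl
      rw [(isClosed_le continuous_const hcont).closure_eq] at this
      exact lt_of_le_of_ne this hs.symm
    · simp only [hd, Bool.true_eq_false, iff_false, not_lt] at h1 ⊢
      have : w ∈ closure {y | c.side v y ≤ 0} := closure_mono (fun y hy => h1 y hy) hcl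
      rwa [(isClosed_le hcont continuous_const).closure_eq] at this
  obtain ⟨ε, hε, h⟩ := hdl.belongs_of_near hv
  obtain ⟨t₀, ht₀, ht⟩ := exists_small_smul v (w - v) hε
  intro x hx
  obtain ⟨r, hr0, hr1, rfl⟩ := mem_openSegment_iff.1 hx
  obtain ⟨t, h0, h1⟩ := exists_between (show 0 < min t₀ r by positivity)
  have htr : t < r := h1.trans_le (min_le_right _ _)
  have hside : c.side v (v + t • (w - v)) = t * c.side v w := side_add_smul_tip v w t
  obtain ⟨hpf, hpB⟩ := h _ (ht t h0 (h1.trans_le (min_le_left _ _)))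
    (by rw [hside]; exact mul_ne_zero h0.ne' hs)
    (by rw [hside, ← hsign]; exact mul_pos_iff_of_pos_left h0)
  have hp := hvo.mem_cell hT hdl hv ho hpf hpB
  refine hT.openSegment_subset hK.isOpen_free hp (hwo.mem_closure ho) ?_
  have ht1 : 0 < 1 - t := by linarith
  refine mem_openSegment_iff.2 ⟨(r - t) / (1 - t), div_pos (by linarith) ht1,
    (div_lt_one ht1).2 (by linarith), ?_⟩
  have : w - (v + t • (w - v)) = (1 - t) • (w - v) := by rw [sub_smul, one_smul]; abel
  rw [this, smul_smul, div_mul_cancel₀ _ ht1.ne', sub_smul]; abel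

/-- A cell with points of `P` on both sides of the given line meets this line. -/
theorem exists_line_mem_cell (hT : VisTrans (c.free K)) {v w o : Plane} (ho : o ∈ c.free K)
    (hvo : Belongs c K dl v o) (hwo : Belongs c K dl w o)
    (hv : 0 < cross (v - c.center) c.τ) (hw : cross (w - c.center) c.τ < 0) :
    ∃ s, c.line s ∈ cell (c.free K) o := by
  have hcont : Continuous fun y : Plane => cross (y - c.center) c.τ :=
    Continuous.cross (by fun_prop) continuous_const
  obtain ⟨y, hy, hyC⟩ := mem_closure_iff.1 (hvo.mem_closure ho) _
    (isOpen_lt continuous_const hcont) hv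
  obtain ⟨z, hz, hzC⟩ := mem_closure_iff.1 (hwo.mem_closure ho) _
    (isOpen_lt hcont continuous_const) hw
  simp only [mem_ofPred_eq] at hy hz
  set a := cross (y - c.center) c.τ
  set b := cross (z - c.center) c.τ
  have hab : 0 < a - b := by linarith
  have hmem : y + (a / (a - b)) • (z - y) ∈ cell (c.free K) o :=
    (hT.convex_cell o).segment_subset hyC hzC (mem_segment_iff.2
      ⟨a / (a - b), by positivity, (div_le_one hab).2 (by linarith), rfl⟩)
  have h0 : cross (y + (a / (a - b)) • (z - y) - c.center) c.τ = 0 := by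
    have e1 : y + (a / (a - b)) • (z - y) - c.center = (y - c.center) +
      (a / (a - b)) • ((z - c.center) - (y - c.center)) := by rw [sub_sub_sub_cancel_right]; abel
    rw [e1, cross_add_left, cross_smul_left, cross_sub_left (z - c.center)]
    change a + a / (a - b) * (b - a) = 0
    field_simp; ring
  obtain ⟨s, hs⟩ := exists_smul_of_cross_eq_zero τ_ne_zero
    (x := y + (a / (a - b)) • (z - y) - c.center) (by rw [cross_swap, h0, neg_zero])
  refine ⟨s, ?_⟩
  rwa [line, ← hs, add_sub_cancel]

/-! ### The gaps between the edges that cross the line -/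

/-- `v` is on the positive side of the given line. -/
def Pos (c : Config) (v : Plane) : Prop := 0 < cross (v - c.center) c.τ

open Classical in
/-- The blue points whose edges cross the given line. -/
noncomputable def crossing (c : Config) : Finset Plane :=
  c.P.filter fun v => c.σ v = 1 ∧ ¬ (c.Pos v ↔ c.Pos (c.π v))

/-- The parameter of the point of the given line on the line of the edge at `v`, provided that these
lines are not parallel. -/
noncomputable def pos (c : Config) (v : Plane) : ℝ :=
  - c.side v c.center / (c.σ v * cross (c.π v - v) c.τ)

theorem mem_crossing {v : Plane} :
    v ∈ c.crossing ↔ v ∈ c.P ∧ c.σ v = 1 ∧ ¬ (c.Pos v ↔ c.Pos (c.π v)) := by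
  simp [crossing]

theorem side_line (v : Plane) (s : ℝ) :
    c.side v (c.line s) = c.side v c.center + s * (c.σ v * cross (c.π v - v) c.τ) :=
  side_add_smul' v _ _ s

theorem cross_partner_sub (v : Plane) : cross (c.π v - v) c.τ =
    cross (c.π v - c.center) c.τ - cross (v - c.center) c.τ := by
  rw [← cross_sub_left, sub_sub_sub_cancel_right]

/-- The direction in which an edge crosses the line. -/
theorem slope_pos_iff {v : Plane} (hv : v ∈ c.crossing) :
    c.σ v * cross (c.π v - v) c.τ ≠ 0 ∧ (0 < c.σ v * cross (c.π v - v) c.τ ↔ ¬ c.Pos v) := by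
  obtain ⟨hP, hσ, h⟩ := mem_crossing.1 hv
  have h1 := c.cross_τ_ne v hP
  have h2 := c.cross_τ_ne _ (c.partner_mem v hP)
  rw [hσ, cross_partner_sub]
  simp only [Pos] at h ⊢
  rcases lt_or_gt_of_ne h1 with h1 | h1 <;> rcases lt_or_gt_of_ne h2 with h2 | h2
  · exact absurd (by simp [h1.not_gt, h2.not_gt]) h
  · push_cast
    exact ⟨by linarith, by simp only [h1.not_gt, not_false_eq_true, iff_true]; linarith⟩
  · push_cast
    exact ⟨by linarith, by simp only [h1, not_true_eq_false, iff_false]; linarith⟩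
  · exact absurd (by simp [h1, h2]) h

theorem side_line_eq {v : Plane} (hv : v ∈ c.crossing) (s : ℝ) :
    c.side v (c.line s) = (s - c.pos v) * (c.σ v * cross (c.π v - v) c.τ) := by
  rw [side_line, pos, sub_mul, div_mul_cancel₀ _ (slope_pos_iff hv).1]; ring

theorem line_pos_mem_edge {v : Plane} (hv : v ∈ c.crossing) : c.line (c.pos v) ∈ c.edge v := by
  have hP := (mem_crossing.1 hv).1
  obtain ⟨t, ht⟩ := (side_eq_zero_iff hP).1
    (show c.side v (c.line (c.pos v)) = 0 by rw [side_line_eq hv]; ring)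
  rw [ht, mem_edge_iff hP]
  have h1 := cross_line (c := c) (c.pos v)
  have e1 : v + t • (v - c.π v) - c.center =
      (v - c.center) + t • ((v - c.center) - (c.π v - c.center)) := by
    rw [sub_sub_sub_cancel_right]; abel
  rw [ht, e1, cross_add_left, cross_smul_left, cross_sub_left (v - c.center)] at h1
  have h2 := c.cross_τ_ne v hP
  have h3 := c.cross_τ_ne _ (c.partner_mem v hP)
  have h := (mem_crossing.1 hv).2.2
  simp only [Pos] at h
  set a := cross (v - c.center) c.τ
  set b := cross (c.π v - c.center) c.τ
  rcases lt_or_gt_of_ne h2 with h2 | h2 <;> rcases lt_or_gt_of_ne h3 with h3 | h3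
  · exact absurd (by simp [h2.not_gt, h3.not_gt]) h
  · constructor <;> nlinarith
  · constructor <;> nlinarith
  · exact absurd (by simp [h2, h3]) h

/-- The points of the line on edges are given by `pos`. -/
theorem line_mem_edges_iff {s : ℝ} : c.line s ∈ c.edges ↔ ∃ v ∈ c.crossing, c.pos v = s := by
  constructor
  · intro h
    obtain ⟨v, hv, hσ, hs⟩ : ∃ v ∈ c.P, c.σ v = 1 ∧ c.line s ∈ c.edge v := by
      obtain ⟨v, hv, hs⟩ := mem_edges.1 h
      rcases c.sign_eq v hv with hσ | hσ
      · exact ⟨v, hv, hσ, hs⟩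
      · exact ⟨c.π v, c.partner_mem v hv, by rw [c.sign_partner v hv, hσ, neg_neg],
          by rwa [edge_partner hv]⟩
    have hvX : v ∈ c.crossing := by
      refine mem_crossing.2 ⟨hv, hσ, fun hpos => ?_⟩
      obtain ⟨t, h0, h1, ht⟩ := mem_segment_iff.1 hs
      have h2 := cross_line (c := c) s
      have e1 : v + t • (c.π v - v) - c.center =
          (v - c.center) + t • ((c.π v - c.center) - (v - c.center)) := by
        rw [sub_sub_sub_cancel_right]; abel
      rw [ht, e1, cross_add_left, cross_smul_left, cross_sub_left (c.π v - c.center)] at h2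
      have h3 := c.cross_τ_ne v hv
      have h4 := c.cross_τ_ne _ (c.partner_mem v hv)
      simp only [Pos] at hpos
      set a := cross (v - c.center) c.τ
      set b := cross (c.π v - c.center) c.τ
      rcases lt_or_gt_of_ne h3 with h3 | h3
      · have h4 : b < 0 := lt_of_le_of_ne (not_lt.1 fun h => absurd (hpos.2 h) h3.not_gt) h4
        rcases eq_or_lt_of_le h0 with rfl | h0 <;> nlinarith
      · have h4 : 0 < b := hpos.1 h3
        rcases eq_or_lt_of_le h0 with rfl | h0 <;> nlinarith
    exact ⟨v, hvX, line_eq_of_side_eq_zero hv (side_of_mem_edge (line_pos_mem_edge hvX))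
      (side_of_mem_edge hs)⟩
  · rintro ⟨v, hv, rfl⟩
    exact mem_edges.2 ⟨v, (mem_crossing.1 hv).1, line_pos_mem_edge hv⟩

theorem pos_injOn : Set.InjOn c.pos c.crossing := by
  intro v hv w hw h
  obtain ⟨hv1, hv2, -⟩ := mem_crossing.1 hv
  obtain ⟨hw1, hw2, -⟩ := mem_crossing.1 hw
  have h1 := line_pos_mem_edge hw
  rw [← h] at h1
  rcases eq_or_eq_partner hv1 hw1 (line_pos_mem_edge hv) h1 with h2 | h2
  · exact h2
  · rw [h2, c.sign_partner w hw1, hw2] at hv2; norm_num at hv2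

theorem line_mem_Ω {s : ℝ} : c.line s ∈ c.Ω ↔ |s| < c.radius := by
  rw [Ω, Metric.mem_ball, dist_eq_norm, line, add_sub_cancel_left, norm_smul, c.norm_τ, mul_one,
    Real.norm_eq_abs]

open Classical in
/-- The parameters at which edges cross the line. -/
noncomputable def marks (c : Config) : Finset ℝ := c.crossing.image c.pos

theorem mem_marks {p : ℝ} : p ∈ c.marks ↔ ∃ v ∈ c.crossing, c.pos v = p := by simp [marks]

/-- The predecessor of `u` among the crossings, or the lower end of the line in `Ω`. -/
noncomputable def pred (c : Config) (u : ℝ) : ℝ :=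
  if h : (c.marks.filter (· < u)).Nonempty then (c.marks.filter (· < u)).max' h else - c.radius

theorem pred_cases (u : ℝ) :
    (c.pred u = - c.radius ∨ (c.pred u ∈ c.marks ∧ c.pred u < u)) ∧
      ∀ p ∈ c.marks, p < u → p ≤ c.pred u := by
  unfold pred
  split_ifs with h
  · have := Finset.max'_mem _ h
    exact ⟨Or.inr (Finset.mem_filter.1 this), fun p hp hpu =>
      Finset.le_max' _ _ (Finset.mem_filter.2 ⟨hp, hpu⟩)⟩
  · refine ⟨Or.inl rfl, fun p hp hpu => absurd ⟨p, Finset.mem_filter.2 ⟨hp, hpu⟩⟩ h⟩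

open Classical in
/-- The label of the line just below the crossing at `p`: `true` for edges directed from the
positive to the negative side. Above the crossing, the label is the opposite one. -/
noncomputable def markLabel (c : Config) (p : ℝ) : Bool :=
  decide (∃ v ∈ c.crossing, c.pos v = p ∧ c.Pos v)

open Classical in
/-- The label just above `p`, where all `p` other than crossings stand for the ends of the line in
`Ω`, and have the outer label `ω`. -/
noncomputable def labelAbove (c : Config) (p : ℝ) : Bool :=
  if p ∈ c.marks then !c.markLabel p else c.ω

open Classical in
/-- The label just below `p`, with the same convention as in `labelAbove`. -/
noncomputable def labelBelow (c : Config) (p : ℝ) : Bool :=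
  if p ∈ c.marks then c.markLabel p else c.ω

theorem abs_lt_of_mem_marks {p : ℝ} (hp : p ∈ c.marks) : |p| < c.radius := by
  obtain ⟨v, hv, rfl⟩ := mem_marks.1 hp
  exact line_mem_Ω.1 (edge_subset_Ω (mem_crossing.1 hv).1 (line_pos_mem_edge hv))

theorem markLabel_pos {v : Plane} (hv : v ∈ c.crossing) :
    c.markLabel (c.pos v) = true ↔ c.Pos v := by
  simp only [markLabel, decide_eq_true_eq]
  constructor
  · rintro ⟨w, hw, h, hP⟩; rwa [← pos_injOn hw hv h]
  · exact fun h => ⟨v, hv, rfl, h⟩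

theorem lab_above (K : Bool → Set Plane) {p s : ℝ} (hp : p ∈ c.marks ∨ p = -c.radius)
    (hps : p < s) : c.Lab K (c.line s) (c.line p) (c.labelAbove p) := by
  unfold labelAbove
  split_ifs with h
  · obtain ⟨v, hv, rfl⟩ := mem_marks.1 h
    refine Or.inr (Or.inl ⟨line_mem_Ω.2 (abs_lt_of_mem_marks h), v, (mem_crossing.1 hv).1,
      line_pos_mem_edge hv, ?_⟩)
    rw [side_line_eq hv, mul_pos_iff_of_pos_left (sub_pos.2 hps), (slope_pos_iff hv).2,
      ← markLabel_pos hv]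
    simp
  · refine Or.inl ⟨?_, rfl⟩
    rw [hp.resolve_left h, line_mem_Ω, abs_neg, not_lt]
    exact le_abs_self _

theorem lab_below (K : Bool → Set Plane) {p s : ℝ} (hp : p ∈ c.marks ∨ p = c.radius)
    (hps : s < p) : c.Lab K (c.line s) (c.line p) (c.labelBelow p) := by
  unfold labelBelow
  split_ifs with h
  · obtain ⟨v, hv, rfl⟩ := mem_marks.1 h
    refine Or.inr (Or.inl ⟨line_mem_Ω.2 (abs_lt_of_mem_marks h), v, (mem_crossing.1 hv).1,
      line_pos_mem_edge hv, ?_⟩)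
    have h1 := slope_pos_iff hv
    rw [side_line_eq hv, markLabel_pos hv]
    have h2 : s - c.pos v < 0 := sub_neg.2 hps
    rcases lt_or_gt_of_ne h1.1 with h3 | h3
    · simp only [mul_pos_of_neg_of_neg h2 h3, true_iff]
      by_contra h4
      exact absurd (h1.2.2 h4) h3.not_gt
    · simp only [(mul_neg_of_neg_of_pos h2 h3).not_gt, false_iff]
      exact h1.2.1 h3
  · refine Or.inl ⟨?_, rfl⟩
    rw [hp.resolve_left h, line_mem_Ω, not_lt]
    exact le_abs_self _

/-- Without plain walls, the gaps are the intervals between consecutive crossings. They are indexed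
by their upper ends. -/
theorem gaps_empty (hr : 0 < c.radius) : Gaps c (fun _ => ∅) (fun u => c.labelAbove (c.pred u))
    c.labelBelow (insert c.radius c.marks) c.pred id := by
  have hJ : ∀ u ∈ insert c.radius c.marks, u ∈ c.marks ∨ u = c.radius := fun u hu =>
    (Finset.mem_insert.1 hu).symm
  have hJr : ∀ u ∈ insert c.radius c.marks, -c.radius < u ∧ u ≤ c.radius := by
    intro u hu
    rcases hJ u hu with h | rfl
    · have := abs_lt.1 (abs_lt_of_mem_marks h)
      exact ⟨this.1, this.2.le⟩
    · exact ⟨by linarith, le_rfl⟩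
  have hpred : ∀ u ∈ insert c.radius c.marks, -c.radius ≤ c.pred u ∧ c.pred u < u := by
    intro u hu
    rcases (pred_cases (c := c) u).1 with h | h
    · rw [h]; exact ⟨le_rfl, (hJr u hu).1⟩
    · exact ⟨(abs_lt.1 (abs_lt_of_mem_marks h.1)).1.le, h.2⟩
  have hwalls : ∀ s, c.line s ∈ c.walls (fun _ => ∅) ↔ s ∈ c.marks := by
    intro s
    rw [mem_walls_iff, line_mem_edges_iff, mem_marks]; simp
  constructor
  case lt => exact fun u hu => (hpred u hu).2
  case free =>
    intro u hu s hs
    simp only [id] at hs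
    refine ⟨line_mem_Ω.2 (abs_lt.2 ⟨(hpred u hu).1.trans_lt hs.1, hs.2.trans_le (hJr u hu).2⟩), ?_⟩
    rw [hwalls]
    exact fun h => absurd ((pred_cases u).2 s h hs.2) (not_le.2 hs.1)
  case cover =>
    intro s hs hsK
    rw [hwalls] at hsK
    rw [line_mem_Ω, abs_lt] at hs
    have hne : ((insert c.radius c.marks).filter (s < ·)).Nonempty :=
      ⟨c.radius, Finset.mem_filter.2 ⟨Finset.mem_insert_self _ _, hs.2⟩⟩
    obtain ⟨u, hu, hmin⟩ := Finset.exists_min_image _ id hne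
    obtain ⟨hu, hsu⟩ := Finset.mem_filter.1 hu
    refine ⟨u, hu, ?_, hsu⟩
    rcases (pred_cases (c := c) u).1 with h | ⟨h1, h2⟩
    · rw [h]; exact hs.1
    · by_contra! h
      have h3 : s < c.pred u := lt_of_le_of_ne h fun h => hsK (h ▸ h1)
      exact absurd (hmin _ (Finset.mem_filter.2 ⟨Finset.mem_insert_of_mem h1, h3⟩)) (not_le.2 h2)
  case low =>
    intro u hu s hs
    refine lab_above _ ?_ hs.1
    rcases (pred_cases (c := c) u).1 with h | h
    · exact Or.inr h
    · exact Or.inl h.1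
  case up => exact fun u hu s hs => lab_below _ (hJ u hu) hs.2
  case disjoint =>
    have key : ∀ u ∈ insert c.radius c.marks, ∀ w ∈ insert c.radius c.marks, u < w →
        Disjoint (Ioo (c.pred u) (id u)) (Ioo (c.pred w) (id w)) := by
      intro u hu w hw huw
      have hum : u ∈ c.marks := by
        rcases hJ u hu with h | rfl
        · exact h
        · exact absurd (hJr w hw).2 (not_le.2 huw)
      rw [Set.disjoint_left]
      intro s hs hs'
      exact absurd ((pred_cases (c := c) w).2 u hum huw) (not_le.2 (hs'.1.trans hs.2))
    intro u hu w hw huw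
    rcases lt_or_gt_of_ne huw with h | h
    · exact key u hu w hw h
    · exact (key w hw u hu h).symm

/-- If edges cross the line in both directions, then two consecutive ones do so in different
directions. If the label at the ends of the line is the one above the uppermost crossing, this gives
two gaps with equal labels at both ends, where the top gap is one of them. -/
theorem card_gaps_lt
    (hω : ∀ v ∈ c.crossing, (∀ w ∈ c.crossing, c.pos w ≤ c.pos v) → (c.ω = false ↔ c.Pos v))
    {v w : Plane} (hv : v ∈ c.crossing) (hw : w ∈ c.crossing) (hvp : c.Pos v) (hwp : ¬ c.Pos w) :
    ((insert c.radius c.marks).filter fun u => c.labelAbove (c.pred u) ≠ c.labelBelow u).card <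
      c.crossing.card := by
  classical
  have hcard : c.marks.card = c.crossing.card := Finset.card_image_of_injOn pos_injOn
  rw [← hcard]
  have hrad : c.radius ∉ c.marks := fun h =>
    absurd (abs_lt_of_mem_marks h) (not_lt.2 (le_abs_self _))
  have hnrad : - c.radius ∉ c.marks := fun h => by
    have := abs_lt_of_mem_marks h
    rw [abs_neg] at this
    exact absurd this (not_lt.2 (le_abs_self _))
  have hsub : ((insert c.radius c.marks).filter fun u =>
      c.labelAbove (c.pred u) ≠ c.labelBelow u) ⊆ c.marks := by
    intro u hu
    obtain ⟨hu, hne⟩ := Finset.mem_filter.1 hu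
    rcases Finset.mem_insert.1 hu with rfl | hu
    · exfalso
      apply hne
      obtain ⟨x, hx, hmax⟩ := Finset.exists_max_image c.crossing c.pos ⟨v, hv⟩
      have hxm : c.pos x ∈ c.marks := mem_marks.2 ⟨x, hx, rfl⟩
      have hxr := (abs_lt.1 (abs_lt_of_mem_marks hxm)).2
      have hle := (pred_cases (c := c) c.radius).2 _ hxm hxr
      have : c.pred c.radius = c.pos x := by
        rcases (pred_cases (c := c) c.radius).1 with h | h
        · have := (abs_lt.1 (abs_lt_of_mem_marks hxm)).1
          linarith
        · obtain ⟨y, hy, hy'⟩ := mem_marks.1 h.1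
          rw [← hy'] at hle ⊢
          exact le_antisymm (hmax y hy) hle
      rw [this, labelAbove, if_pos hxm, labelBelow, if_neg hrad]
      have h1 := hω x hx hmax
      have h2 := markLabel_pos hx
      rw [← h1] at h2
      revert h2; cases c.ω <;> cases c.markLabel (c.pos x) <;> simp
    · exact hu
  refine Finset.card_lt_card (Finset.ssubset_iff_subset_ne.2 ⟨hsub, fun heq => ?_⟩)
  have hdiff : ∀ u ∈ c.marks, c.labelAbove (c.pred u) ≠ c.markLabel u := by
    intro u hu
    have h1 := hu
    rw [← heq] at h1
    have := (Finset.mem_filter.1 h1).2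
    rwa [labelBelow, if_pos hu] at this
  -- Otherwise, all edges cross the line in the same direction: this holds for the lowest one by the
  -- label of the lower end of the line, and is passed on across each gap with different labels.
  have hall : ∀ u ∈ c.marks, c.markLabel u = !c.ω := by
    by_contra! hne
    obtain ⟨u₀, hu₀, hne⟩ := hne
    obtain ⟨u, hu, hmin⟩ := Finset.exists_min_image (c.marks.filter fun u => c.markLabel u ≠ !c.ω)
      id ⟨u₀, Finset.mem_filter.2 ⟨hu₀, hne⟩⟩
    obtain ⟨hu, hune⟩ := Finset.mem_filter.1 hu
    have hd := hdiff u hu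
    rcases (pred_cases (c := c) u).1 with h | ⟨h1, h2⟩
    · rw [h, labelAbove, if_neg hnrad] at hd
      revert hd hune; cases c.ω <;> cases c.markLabel u <;> simp
    · have h3 : c.markLabel (c.pred u) = !c.ω := by
        by_contra h3
        exact absurd (hmin _ (Finset.mem_filter.2 ⟨h1, h3⟩)) (not_le.2 h2)
      rw [labelAbove, if_pos h1, h3] at hd
      revert hd hune; cases c.ω <;> cases c.markLabel u <;> simp
  have h1 := hall _ (mem_marks.2 ⟨v, hv, rfl⟩)
  have h2 := hall _ (mem_marks.2 ⟨w, hw, rfl⟩)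
  rw [(markLabel_pos hv).2 hvp] at h1
  rw [← h1, markLabel_pos hw] at h2
  exact hwp h2

/-- If edges cross the line in both directions, there is a system of walls without dead ends that
leaves fewer gaps in the line than there are crossings. -/
theorem exists_core
    (hω : ∀ v ∈ c.crossing, (∀ w ∈ c.crossing, c.pos w ≤ c.pos v) → (c.ω = false ↔ c.Pos v))
    {v w : Plane} (hv : v ∈ c.crossing) (hw : w ∈ c.crossing) (hvp : c.Pos v) (hwp : ¬ c.Pos w) :
    ∃ (K : Bool → Set Plane) (J : Finset ℝ) (A A' : ℝ → Bool) (α β : ℝ → ℝ),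
      Core c K c.P ∧ Gaps c K A A' J α β ∧ J.card < c.crossing.card := by
  have hr : 0 < c.radius := Metric.pos_of_mem_ball (tip_mem_Ω (mem_crossing.1 hv).1)
  obtain ⟨K, hK, hG⟩ := (gaps_empty hr).close_all core_empty
  obtain ⟨K', α', β', hK', hG'⟩ := hG.extend_all hK fun j hj => (Finset.mem_filter.1 hj).2
  exact ⟨K', _, _, _, α', β', hK', hG', card_gaps_lt hω hv hw hvp hwp⟩

end Config

/-! ### A shortest matching within the cells -/

theorem sum_swap {α β : Type*} [Fintype α] [DecidableEq α] (F : α → β → ℝ) (e : α ≃ β) {a b : α}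
    (hab : a ≠ b) : ∑ x, F x (((Equiv.swap a b).trans e) x) =
      ∑ x, F x (e x) + (F a (e b) + F b (e a) - F a (e a) - F b (e b)) := by
  have h : ∀ x, F x (((Equiv.swap a b).trans e) x) = F x (e x) +
      ((if x = a then F a (e b) - F a (e a) else 0) +
        (if x = b then F b (e a) - F b (e b) else 0)) := by
    intro x
    by_cases h1 : x = a
    · subst h1; simp [hab]
    · by_cases h2 : x = b
      · subst h2; simp [h1]
      · simp [h1, h2, Equiv.swap_apply_of_ne_of_ne h1 h2]
  simp_rw [h, Finset.sum_add_distrib, Finset.sum_ite_eq' Finset.univ, Finset.mem_univ, if_true]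
  ring

/-- A matching that respects the classes given by `k` and `l` and has the least cost `F`, and the
least cost `G` among those, cannot be improved by an exchange. -/
theorem exists_optimal_equiv {α β γ : Type*} [Finite α] [Finite β] (k : α → γ) (l : β → γ)
    (h : ∀ c, Nat.card {a // k a = c} = Nat.card {b // l b = c}) (F G : α → β → ℝ) :
    ∃ e : α ≃ β, (∀ a, l (e a) = k a) ∧ ∀ a b, a ≠ b → k a = k b →
      0 ≤ F a (e b) + F b (e a) - F a (e a) - F b (e b) ∧
      (F a (e b) + F b (e a) - F a (e a) - F b (e b) = 0 →
        0 ≤ G a (e b) + G b (e a) - G a (e a) - G b (e b)) := by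
  classical
  have := Fintype.ofFinite α
  have hne : Nonempty {e : α ≃ β // ∀ a, l (e a) = k a} := by
    have h' : ∀ c, Nonempty ({a // k a = c} ≃ {b // l b = c}) := fun c =>
      ⟨(Finite.equivFinOfCardEq (h c)).trans (Finite.equivFin _).symm⟩
    exact ⟨Equiv.ofFiberEquiv fun c => (h' c).some, fun a => Equiv.ofFiberEquiv_map _ a⟩
  obtain ⟨⟨e, he⟩, hmin⟩ := Finite.exists_min
    fun e : {e : α ≃ β // ∀ a, l (e a) = k a} => toLex (∑ x, F x (e.1 x), ∑ x, G x (e.1 x))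
  refine ⟨e, he, fun a b hab hk => ?_⟩
  have h1 := hmin ⟨(Equiv.swap a b).trans e, fun x => by
    by_cases h1 : x = a
    · subst h1; simp [he, hk]
    · by_cases h2 : x = b
      · subst h2; simp [he, hk]
      · simp [Equiv.swap_apply_of_ne_of_ne h1 h2, he]⟩
  simp only [sum_swap _ e hab, Prod.Lex.toLex_le_toLex] at h1
  rcases h1 with h1 | ⟨h1, h2⟩
  · exact ⟨by linarith, fun h0 => by linarith⟩
  · exact ⟨by linarith, fun _ => by linarith⟩

theorem sum_signs {α : Type*} (P : Finset α) (σ : α → ℤ) (hσ : ∀ v ∈ P, σ v = 1 ∨ σ v = -1)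
    (p : α → Prop) [DecidablePred p] : ∑ v ∈ P with p v, σ v =
      (Nat.card {b : {v // v ∈ P ∧ σ v = 1} // p b} : ℤ) -
        Nat.card {r : {v // v ∈ P ∧ σ v = -1} // p r} := by
  classical
  have key : ∀ i : ℤ, Nat.card {b : {v // v ∈ P ∧ σ v = i} // p b} =
      ((P.filter p).filter (fun v => σ v = i)).card := by
    intro i
    have e : {b : {v // v ∈ P ∧ σ v = i} // p b} ≃
        {v // v ∈ (P.filter p).filter (fun v => σ v = i)} :=
      (Equiv.subtypeSubtypeEquivSubtypeInter (fun v => v ∈ P ∧ σ v = i) p).trans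
        (Equiv.subtypeEquivRight fun v => by simp [and_comm, and_left_comm])
    rw [Nat.card_congr e, Nat.card_eq_fintype_card, Fintype.card_coe]
  rw [key, key, ← Finset.sum_filter_add_sum_filter_not (P.filter p) (fun v => σ v = 1)]
  have h1 : (P.filter p).filter (fun v => ¬ σ v = 1) = (P.filter p).filter (fun v => σ v = -1) := by
    refine Finset.filter_congr fun v hv => ?_
    rcases hσ v (Finset.mem_filter.1 hv).1 with h | h <;> simp [h]
  rw [h1, Finset.sum_congr rfl fun v hv => (Finset.mem_filter.1 hv).2,
    Finset.sum_congr (s₁ := (P.filter p).filter (fun v => σ v = -1)) rfl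
      fun v hv => (Finset.mem_filter.1 hv).2]
  simp [sub_eq_add_neg]

theorem card_add_two_le {α : Type*} [Finite α] {p q : α → Prop} (h : ∀ x, p x → q x) {a b : α}
    (hab : a ≠ b) (hpa : ¬ p a) (hpb : ¬ p b) (hqa : q a) (hqb : q b) :
    Nat.card {x // p x} + 2 ≤ Nat.card {x // q x} := by
  have h1 := Set.ncard_insert_of_notMem (a := b) (s := {x | p x}) hpb
  have h2 := Set.ncard_insert_of_notMem (a := a) (s := insert b {x | p x}) (by
    rintro (h | h)
    · exact hab h
    · exact hpa h)
  have h3 : insert a (insert b {x | p x}) ⊆ {x | q x} := by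
    rintro x (rfl | rfl | hx)
    · exact hqa
    · exact hqb
    · exact h x hx
  have h4 := Set.ncard_le_ncard h3
  rw [h2, h1] at h4
  exact h4

namespace Config

variable {c : Config} {K : Bool → Set Plane}

open Classical in
/-- The cells that the walls leave: `key v` is the cell to which the point `v` of `P` belongs, and
`gap j` is the cell around the gap `j` of the line. A segment between points of the same cell, other
than an edge, runs within this cell. Each cell has as many blue as red points. If it
contains a gap, then the numbers of its blue and its red points on the positive side of the line
differ by at most one. -/
theorem Core.exists_cells (hK : Core c K c.P) {A A' : ℝ → Bool} {J : Finset ℝ} {α β : ℝ → ℝ}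
    (hG : Gaps c K A A' J α β) : ∃ (key : Plane → Set Plane) (gap : ℝ → Set Plane),
      (∀ v ∈ c.P, ∀ w ∈ c.P, w ≠ v → w ≠ c.π v → key v = key w → openSegment ℝ v w ⊆ key v) ∧
      (∀ v ∈ c.P, ∀ w ∈ c.P, key v ≠ key w → Disjoint (key v) (key w)) ∧
      (∀ v ∈ c.P, Disjoint (key v) c.edges) ∧
      (∀ v ∈ c.P, ∀ w ∈ c.P, c.Pos v → ¬ c.Pos w → key v = key w → ∃ j ∈ J, key v = gap j) ∧
      (∀ C, ∑ v ∈ c.P with key v = C, c.σ v = 0) ∧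
      ∀ j ∈ J, |∑ v ∈ c.P with key v = gap j ∧ c.Pos v, c.σ v| ≤ 1 := by
  have hT := hK.visTrans
  obtain ⟨dl, hdl⟩ := hK.exists_doorLabels
  choose! q hq hB using fun v (hv : v ∈ c.P) => hdl.exists_belongs hv
  have hkey : ∀ v ∈ c.P, ∀ o ∈ c.free K,
      (cell (c.free K) (q v) = cell (c.free K) o ↔ Belongs c K dl v o) := by
    intro v hv o ho
    constructor
    · intro h
      refine (hB v hv).of_mem_cell hK hdl hv (hq v hv) ?_
      rw [h]; exact mem_cell_self ho
    · intro h
      exact (hT.cell_eq ((hB v hv).mem_cell hT hdl hv (hq v hv) ho h)).symm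
  have hmid : ∀ j ∈ J, c.line ((α j + β j) / 2) ∈ c.free K := fun j hj =>
    hG.free j hj _ (hG.mid_mem hj)
  refine ⟨fun v => cell (c.free K) (q v), fun j => cell (c.free K) (c.line ((α j + β j) / 2)),
    ?_, ?_, ?_, ?_, ?_, ?_⟩
  · intro v hv w hw hvw hπ h
    exact (hB v hv).openSegment_subset hK hdl hv hw hvw hπ (hq v hv)
      ((hkey w hw _ (hq v hv)).1 h.symm)
  · intro v _ w _ h
    rw [Set.disjoint_left]
    intro y hy hy'
    exact h ((hT.cell_eq hy).symm.trans (hT.cell_eq hy'))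
  · intro v _
    rw [Set.disjoint_left]
    exact fun y hy hy' => (cell_subset _ hy).2 (Or.inl hy')
  · intro v hv w hw hvp hwp h
    obtain ⟨s, hs⟩ := exists_line_mem_cell hT (hq v hv) (hB v hv)
      ((hkey w hw _ (hq v hv)).1 h.symm) hvp
      (lt_of_le_of_ne (not_lt.1 hwp) (c.cross_τ_ne w hw))
    obtain ⟨j, hj, hsj⟩ := hG.cover s (cell_subset _ hs).1 (cell_subset _ hs).2
    refine ⟨j, hj, ?_⟩
    have h1 : c.line ((α j + β j) / 2) ∈ cell (c.free K) (c.line s) := by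
      intro x hx
      obtain ⟨r, hr, rfl⟩ : ∃ r ∈ Ioo (α j) (β j), c.line r = x := by
        rw [segment_eq_image] at hx
        obtain ⟨t, ht, rfl⟩ := hx
        refine ⟨(1 - t) • s + t • ((α j + β j) / 2),
          (convex_Ioo (𝕜 := ℝ) (α j) (β j)).segment_subset hsj (hG.mid_mem hj) ?_, ?_⟩
        · rw [segment_eq_image]; exact ⟨t, ht, rfl⟩
        · simp only [line, smul_eq_mul]; module
      exact hG.free j hj r hr
    exact (hT.cell_eq (hT hs h1)).symm
  · intro C
    by_cases hC : ∃ v ∈ c.P, cell (c.free K) (q v) = C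
    · obtain ⟨u, hu, rfl⟩ := hC
      rw [← (hK.balanced hdl (hq u hu)).1]
      refine Finset.sum_congr (Finset.filter_congr fun v hv => ?_) fun _ _ => rfl
      exact hkey v hv _ (hq u hu)
    · push Not at hC
      rw [Finset.filter_false_of_mem hC, Finset.sum_empty]
  · intro j hj
    have h := (hK.balanced hdl (hmid j hj)).2 (cross_line _)
    convert h using 3
    refine Finset.filter_congr fun v hv => ?_
    rw [hkey v hv _ (hmid j hj)]; rfl

/-- Two segments with a common interior point can be exchanged for two with a smaller total
length. -/
theorem dist_add_dist_lt {a b p q x : Plane} (h : cross (p - a) (q - a) ≠ 0)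
    (hp : x ∈ openSegment ℝ a p) (hq : x ∈ openSegment ℝ b q) :
    dist a q + dist b p < dist a p + dist b q := by
  have h1 := dist_add_dist_of_mem_segment (openSegment_subset_segment _ _ _ hp)
  have h2 := dist_add_dist_of_mem_segment (openSegment_subset_segment _ _ _ hq)
  have h3 : dist a q < dist a x + dist x q := by
    refine lt_of_le_of_ne (dist_triangle _ _ _) fun heq => h ?_
    obtain ⟨t, h0, h1, rfl⟩ := mem_openSegment_iff.1 hp
    obtain ⟨s, -, -, hs⟩ := mem_segment_iff.1 (dist_add_dist_eq_iff.1 heq.symm).mem_segment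
    have h4 : t • (p - a) = s • (q - a) := by
      have := congrArg (· - a) hs
      simpa using this
    have h5 : t * cross (p - a) (q - a) = 0 := by
      rw [← cross_smul_left, h4, cross_smul_left, cross_self, mul_zero]
    exact (mul_eq_zero.1 h5).resolve_left h0.ne'
  have h4 := dist_triangle b x p
  rw [dist_comm x p] at h4
  rw [dist_comm x p] at h1
  linarith

open Classical in
/-- Suppose that edges cross the line in both directions. Then some compatible matching has fewer
crossings with the line. It is the shortest one among the matchings with the fewest crossings that
match points within their cells. -/
theorem exists_fewer_crossings
    (hω : ∀ v ∈ c.crossing, (∀ w ∈ c.crossing, c.pos w ≤ c.pos v) → (c.ω = false ↔ c.Pos v))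
    {v w : Plane} (hv : v ∈ c.crossing) (hw : w ∈ c.crossing) (hvp : c.Pos v) (hwp : ¬ c.Pos w) :
    ∃ e : {v // v ∈ c.P ∧ c.σ v = 1} ≃ {v // v ∈ c.P ∧ c.σ v = -1},
      Nat.card {b : {v // v ∈ c.P ∧ c.σ v = 1} // ¬ (c.Pos b ↔ c.Pos (e b))} < c.crossing.card ∧
      (∀ b : {v // v ∈ c.P ∧ c.σ v = 1}, (e b : Plane) ≠ c.π b →
        Disjoint (openSegment ℝ (b : Plane) (e b)) c.edges) ∧
      ∀ a b, a ≠ b → Disjoint (openSegment ℝ a.1 (e a).1) (openSegment ℝ b.1 (e b).1) := by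
  obtain ⟨K, J, A, A', α, β, hK, hG, hJ⟩ := exists_core hω hv hw hvp hwp
  obtain ⟨key, gap, hsub, hdis, hfree, hgap, hbal, hhalf⟩ := hK.exists_cells hG
  set F : {v // v ∈ c.P ∧ c.σ v = 1} → {v // v ∈ c.P ∧ c.σ v = -1} → ℝ :=
    fun a b => if (c.Pos a ↔ c.Pos b) then 0 else 1 with hF
  have hfin : ∀ i : ℤ, Finite {v // v ∈ c.P ∧ c.σ v = i} := fun i =>
    Finite.of_injective (fun v => (⟨v.1, v.2.1⟩ : c.P)) fun v w h =>
      Subtype.ext (by simpa using h)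
  obtain ⟨e, he, hopt⟩ := exists_optimal_equiv
    (fun a : {v // v ∈ c.P ∧ c.σ v = 1} => key a) (fun b : {v // v ∈ c.P ∧ c.σ v = -1} => key b)
    (fun C => by
      have h := hbal C
      rw [sum_signs c.P c.σ c.sign_eq] at h
      exact_mod_cast sub_eq_zero.1 h) F (fun a b => dist (a : Plane) b)
  have hne : ∀ (a : {v // v ∈ c.P ∧ c.σ v = 1}) (b : {v // v ∈ c.P ∧ c.σ v = -1}),
      (a : Plane) ≠ b := by
    intro a b h
    have h1 := a.2.2
    rw [h, b.2.2] at h1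
    norm_num at h1
  have hcell : ∀ b : {v // v ∈ c.P ∧ c.σ v = 1}, (e b : Plane) ≠ c.π b →
      openSegment ℝ (b : Plane) (e b) ⊆ key b := fun b hb =>
    hsub _ b.2.1 _ (e b).2.1 (hne _ _).symm hb (he b).symm
  refine ⟨e, lt_of_le_of_lt ?_ hJ, fun b hb => (hfree _ b.2.1).mono_left (hcell b hb), ?_⟩
  · -- Edges of the new matching that cross the line do so in different gaps.
    have hj : ∀ b : {b : {v // v ∈ c.P ∧ c.σ v = 1} // ¬ (c.Pos b ↔ c.Pos (e b))},
        ∃ j ∈ J, key b = gap j := by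
      rintro ⟨b, hb⟩
      by_cases hp : c.Pos b
      · exact hgap _ b.2.1 _ (e b).2.1 hp (fun h => hb (by simp [hp, h])) (he b).symm
      · obtain ⟨j, hj, h⟩ := hgap _ (e b).2.1 _ b.2.1
          (by by_contra h; exact hb (by simp [hp, h])) hp (he b)
        exact ⟨j, hj, (he b).symm.trans h⟩
    choose g hgJ hg using hj
    have hinj : Function.Injective g := by
      rintro ⟨a, ha⟩ ⟨b, hb⟩ hab
      by_contra hne
      rw [Subtype.mk.injEq] at hne
      have hka := hg ⟨a, ha⟩
      have hkb := hg ⟨b, hb⟩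
      rw [← hab] at hkb
      set C := gap (g ⟨a, ha⟩)
      -- By the choice of the matching, edges of one cell cross the line in the same direction.
      have hdir : ∀ z : {v // v ∈ c.P ∧ c.σ v = 1}, key z = C →
          ¬ (c.Pos z ↔ c.Pos (e z)) → (c.Pos z ↔ c.Pos a) := by
        intro z hz hzc
        by_cases hza : a = z
        · rw [hza]
        · have h1 := (hopt a z hza (hka.trans hz.symm)).1
          simp only [hF] at h1
          grind
      set N := Nat.card {b : {v // v ∈ c.P ∧ c.σ v = 1} // key b = C ∧ c.Pos b} with hN
      set N' := Nat.card {b : {v // v ∈ c.P ∧ c.σ v = 1} // key b = C ∧ c.Pos (e b)} with hN'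
      have h1 : |(N : ℤ) - N'| ≤ 1 := by
        have h1 := hhalf _ (hgJ ⟨a, ha⟩)
        rw [sum_signs c.P c.σ c.sign_eq] at h1
        rw [hN', Nat.card_congr (e.subtypeEquiv
          (q := fun r : {v // v ∈ c.P ∧ c.σ v = -1} => key r = C ∧ c.Pos r)
          fun b => by rw [← he b])]
        exact h1
      have h2 := hdir b hkb hb
      rw [abs_le] at h1
      by_cases hp : c.Pos a
      · have h3 : N' + 2 ≤ N := card_add_two_le
          (p := fun b : {v // v ∈ c.P ∧ c.σ v = 1} => key b = C ∧ c.Pos (e b))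
          (q := fun b : {v // v ∈ c.P ∧ c.σ v = 1} => key b = C ∧ c.Pos b)
          (fun z hz => ⟨hz.1, by by_contra h; exact h ((hdir z hz.1 (by simp [h, hz.2])).2 hp)⟩)
          hne (fun h => ha (by simp [hp, h.2])) (fun h => hb (by simp [h2, hp, h.2]))
          ⟨hka, hp⟩ ⟨hkb, h2.2 hp⟩
        omega
      · have h3 : N + 2 ≤ N' := card_add_two_le
          (q := fun b : {v // v ∈ c.P ∧ c.σ v = 1} => key b = C ∧ c.Pos (e b))
          (p := fun b : {v // v ∈ c.P ∧ c.σ v = 1} => key b = C ∧ c.Pos b)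
          (fun z hz => ⟨hz.1, by
            by_contra h; exact hp ((hdir z hz.1 (by simp [h, hz.2])).1 hz.2)⟩)
          hne (fun h => hp h.2) (fun h => hp (h2.1 h.2))
          ⟨hka, by by_contra h; exact ha (by simp [hp, h])⟩
          ⟨hkb, by by_contra h; exact hb (by simp [h2, hp, h])⟩
        omega
    have h1 := Nat.card_le_card_of_injective (fun b => (⟨g b, hgJ b⟩ : J))
      fun a b h => hinj (congrArg Subtype.val h)
    simpa using h1
  · intro a b hab
    by_cases hk : key a = key b
    · rw [Set.disjoint_left]
      intro x hxa hxb
      obtain ⟨h1, h2⟩ := hopt a b hab hk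
      have hab' : (a : Plane) ≠ b := fun h => hab (Subtype.ext h)
      have heab : (e a : Plane) ≠ e b := fun h => hab (e.injective (Subtype.ext h))
      have hlt := dist_add_dist_lt (c.cross_ne _ a.2.1 _ (e a).2.1 _ (e b).2.1 (hne _ _) (hne _ _)
        heab) hxa hxb
      have h3 : ¬ (F a (e b) + F b (e a) - F a (e a) - F b (e b) = 0) := fun h => by
        have := h2 h
        linarith
      -- The exchange makes both edges cross the line. So they are on different sides of it.
      have hconv : ∀ u z : Plane, x ∈ openSegment ℝ u z → ∃ t : ℝ, 0 < t ∧ t < 1 ∧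
          cross (x - c.center) c.τ =
            (1 - t) * cross (u - c.center) c.τ + t * cross (z - c.center) c.τ := by
        intro u z hx
        obtain ⟨t, h0, h1, rfl⟩ := mem_openSegment_iff.1 hx
        refine ⟨t, h0, h1, ?_⟩
        have e1 : u + t • (z - u) - c.center =
            (1 - t) • (u - c.center) + t • (z - c.center) := by module
        rw [e1, cross_add_left, cross_smul_left, cross_smul_left]
      obtain ⟨t, ht0, ht1, ht⟩ := hconv _ _ hxa
      obtain ⟨s, hs0, hs1, hs⟩ := hconv _ _ hxb
      simp only [hF] at h1 h3
      have hpos : ∀ u z : Plane, c.Pos u → c.Pos z → ∀ t : ℝ, 0 < t → t < 1 →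
          0 < (1 - t) * cross (u - c.center) c.τ + t * cross (z - c.center) c.τ := by
        intro u z hu hz t h0 h1
        exact add_pos (mul_pos (sub_pos.2 h1) hu) (mul_pos h0 hz)
      have hneg : ∀ u z : Plane, ¬ c.Pos u → ¬ c.Pos z → ∀ t : ℝ, 0 < t → t < 1 →
          (1 - t) * cross (u - c.center) c.τ + t * cross (z - c.center) c.τ ≤ 0 := by
        intro u z hu hz t h0 h1
        exact add_nonpos (mul_nonpos_of_nonneg_of_nonpos (sub_pos.2 h1).le (not_lt.1 hu))
          (mul_nonpos_of_nonneg_of_nonpos h0.le (not_lt.1 hz))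
      have h4 : (c.Pos a ↔ c.Pos (e a)) ∧ (c.Pos b ↔ c.Pos (e b)) ∧ (c.Pos a ↔ ¬ c.Pos b) := by
        grind
      by_cases p1 : c.Pos a
      · have p3 := h4.1.1 p1
        have p2 := h4.2.2.1 p1
        have p4 := mt h4.2.1.2 p2
        have h4 := hpos _ _ p1 p3 t ht0 ht1
        have h5 := hneg _ _ p2 p4 s hs0 hs1
        linarith
      · have p3 := mt h4.1.2 p1
        have p2 := not_not.1 (mt h4.2.2.2 p1)
        have p4 := h4.2.1.1 p2
        have h4 := hneg _ _ p1 p3 t ht0 ht1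
        have h5 := hpos _ _ p2 p4 s hs0 hs1
        linarith
    · by_cases ha : (e a : Plane) = c.π a
      · by_cases hb : (e b : Plane) = c.π b
        · rw [ha, hb]
          refine (c.disjoint_edges _ a.2.1 _ b.2.1 (fun h => hab (Subtype.ext h)) fun h => ?_).mono
            (openSegment_subset_segment _ _ _) (openSegment_subset_segment _ _ _)
          exact hne a (e b) (by rw [hb, h])
        · refine ((hfree _ b.2.1).mono (hcell b hb) ?_).symm
          intro x hx
          rw [ha] at hx
          exact mem_edges.2 ⟨a, a.2.1, openSegment_subset_segment _ _ _ hx⟩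
      · by_cases hb : (e b : Plane) = c.π b
        · refine (hfree _ a.2.1).mono (hcell a ha) ?_
          intro x hx
          rw [hb] at hx
          exact mem_edges.2 ⟨b, b.2.1, openSegment_subset_segment _ _ _ hx⟩
        · exact (hdis _ a.2.1 _ b.2.1 hk).mono (hcell a ha) (hcell b hb)

end Config

/-! ### Matchings as bijections -/

theorem edgeSegment_mk (a b : Plane) : edgeSegment s(a, b) = segment ℝ a b := by
  have : {p : Plane | p ∈ s(a, b)} = {a, b} := by ext p; simp [Sym2.mem_iff]
  rw [edgeSegment, this, convexHull_pair]

theorem _root_.IsPlane.mono {E F : Set (Sym2 Plane)} (h : IsPlane F) (hEF : E ⊆ F) : IsPlane E :=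
  fun e he f hf => h e (hEF he) f (hEF hf)

variable {B R : Finset Plane}

/-- The edge set of the matching that joins each blue point `b` to `m b`. -/
def graph (m : {v // v ∈ B} ≃ {v // v ∈ R}) : Set (Sym2 Plane) := {e | ∃ b, e = s(b.1, (m b).1)}

theorem mk_mem_graph (m : {v // v ∈ B} ≃ {v // v ∈ R}) (b : {v // v ∈ B}) :
    s(b.1, (m b).1) ∈ graph m := ⟨b, rfl⟩

theorem isBRMatching_graph (hdisj : Disjoint B R) {m : {v // v ∈ B} ≃ {v // v ∈ R}}
    (h : IsPlane (graph m)) : IsBRMatching B R (graph m) where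
  perfectMatching :=
    { graph := by
        rintro _ ⟨b, rfl⟩
        refine ⟨fun h => ?_, fun p hp => ?_⟩
        · rw [Sym2.mk_isDiag_iff] at h
          exact Finset.disjoint_left.1 hdisj b.2 (h ▸ (m b).2)
        · rcases Sym2.mem_iff.1 hp with rfl | rfl
          · exact Or.inl b.2
          · exact Or.inr (m b).2
      plane := h
      perfect := by
        rintro p (hp | hp)
        · refine ⟨_, ⟨mk_mem_graph m ⟨p, hp⟩, Sym2.mem_mk_left _ _⟩, ?_⟩
          rintro _ ⟨⟨b, rfl⟩, hb⟩
          rcases Sym2.mem_iff.1 hb with rfl | rfl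
          · rfl
          · exact absurd (m b).2 (Finset.disjoint_left.1 hdisj hp)
        · refine ⟨_, ⟨mk_mem_graph m (m.symm ⟨p, hp⟩), by simp⟩, ?_⟩
          rintro _ ⟨⟨b, rfl⟩, hb⟩
          rcases Sym2.mem_iff.1 hb with rfl | rfl
          · exact absurd hp (Finset.disjoint_left.1 hdisj b.2)
          · simp }
  bichromatic := by
    rintro _ ⟨b, rfl⟩
    exact ⟨b, b.2, m b, (m b).2, rfl⟩

theorem exists_graph_eq (hdisj : Disjoint B R) {M : Set (Sym2 Plane)} (hM : IsBRMatching B R M) :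
    ∃ m : {v // v ∈ B} ≃ {v // v ∈ R}, M = graph m := by
  have huniq : ∀ {p q r : Plane}, p ∈ B ∨ p ∈ R → s(p, q) ∈ M → s(p, r) ∈ M → q = r := by
    intro p q r hp h1 h2
    have := (hM.perfectMatching.perfect p hp).unique ⟨h1, Sym2.mem_mk_left _ _⟩
      ⟨h2, Sym2.mem_mk_left _ _⟩
    exact Sym2.congr_right.1 this
  have hB : ∀ b : {v // v ∈ B}, ∃ r : {v // v ∈ R}, s(b.1, r.1) ∈ M := by
    rintro ⟨b, hb⟩
    obtain ⟨e, ⟨he, hbe⟩, -⟩ := hM.perfectMatching.perfect b (Or.inl hb)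
    obtain ⟨b', hb', r, hr, rfl⟩ := hM.bichromatic e he
    rcases Sym2.mem_iff.1 hbe with rfl | rfl
    · exact ⟨⟨r, hr⟩, he⟩
    · exact absurd hr (Finset.disjoint_left.1 hdisj hb)
  have hR : ∀ r : {v // v ∈ R}, ∃ b : {v // v ∈ B}, s(b.1, r.1) ∈ M := by
    rintro ⟨r, hr⟩
    obtain ⟨e, ⟨he, hre⟩, -⟩ := hM.perfectMatching.perfect r (Or.inr hr)
    obtain ⟨b, hb, r', hr', rfl⟩ := hM.bichromatic e he
    rcases Sym2.mem_iff.1 hre with rfl | rfl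
    · exact absurd hr (Finset.disjoint_left.1 hdisj hb)
    · exact ⟨⟨b, hb⟩, he⟩
  choose f hf using hB
  choose g hg using hR
  refine ⟨⟨f, g, fun b => ?_, fun r => ?_⟩, ?_⟩
  · refine Subtype.ext (huniq (p := (f b).1) (Or.inr (f b).2) ?_ ?_)
    · rw [Sym2.eq_swap]; exact hg _
    · rw [Sym2.eq_swap]; exact hf _
  · exact Subtype.ext (huniq (Or.inl (g r).2) (hf _) (hg _))
  · ext e
    constructor
    · intro he
      obtain ⟨b, hb, r, hr, rfl⟩ := hM.bichromatic e he
      exact ⟨⟨b, hb⟩, congrArg (fun x => s(b, x)) (huniq (Or.inl hb) he (hf ⟨b, hb⟩))⟩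
    · rintro ⟨b, rfl⟩
      exact hf b

/-! ### The configuration of a matching and a line -/

open Classical in
/-- The partner of a point in the matching given by `m`. Points outside of `B ∪ R` are their own
partners. -/
noncomputable def partner (m : {v // v ∈ B} ≃ {v // v ∈ R}) (v : Plane) : Plane :=
  if h : v ∈ B then m ⟨v, h⟩ else if h : v ∈ R then m.symm ⟨v, h⟩ else v

theorem partner_blue (m : {v // v ∈ B} ≃ {v // v ∈ R}) (b : {v // v ∈ B}) :
    partner m b = m b := by simp [partner]

theorem partner_red (hdisj : Disjoint B R) (m : {v // v ∈ B} ≃ {v // v ∈ R}) (r : {v // v ∈ R}) :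
    partner m r = m.symm r := by
  have : r.1 ∉ B := Finset.disjoint_right.1 hdisj r.2
  simp [partner, this]

theorem mk_partner_mem_graph (hdisj : Disjoint B R) (m : {v // v ∈ B} ≃ {v // v ∈ R}) {v : Plane}
    (hv : v ∈ B ∨ v ∈ R) : s(v, partner m v) ∈ graph m := by
  rcases hv with hv | hv
  · rw [partner_blue m ⟨v, hv⟩]; exact mk_mem_graph m ⟨v, hv⟩
  · rw [partner_red hdisj m ⟨v, hv⟩, Sym2.eq_swap]
    exact ⟨m.symm ⟨v, hv⟩, by simp⟩

/-- The equation of a line in terms of its direction. -/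
theorem exists_direction (ℓ : PlaneLine) : ∃ o τ : Plane, ‖τ‖ = 1 ∧
    ∀ x, inner ℝ ℓ.normal x - ℓ.offset = ‖ℓ.normal‖ * cross (x - o) τ := by
  set n := ℓ.normal with hn
  have hn0 : ‖n‖ ≠ 0 := norm_ne_zero_iff.2 ℓ.normal_ne_zero
  have hsq : ‖n‖ ^ 2 = n 0 ^ 2 + n 1 ^ 2 := by
    rw [EuclideanSpace.norm_sq_eq]; simp
  have h1 : ‖(!₂[-n 1, n 0] : Plane)‖ = ‖n‖ := by
    rw [EuclideanSpace.norm_eq, EuclideanSpace.norm_eq]; simp [add_comm]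
  refine ⟨(ℓ.offset / ‖n‖ ^ 2) • n, (‖n‖)⁻¹ • !₂[-n 1, n 0], ?_, fun x => ?_⟩
  · rw [norm_smul, h1, norm_inv, norm_norm, inv_mul_cancel₀ hn0]
  · have h2 : inner ℝ n x = n 0 * x 0 + n 1 * x 1 := by
      simp [PiLp.inner_apply]; ring
    rw [h2, cross_smul_right, cross_sub_left, cross_smul_left]
    have h3 : cross n !₂[-n 1, n 0] = ‖n‖ ^ 2 := by rw [hsq]; simp [cross]; ring
    rw [h3, div_mul_cancel₀ _ (pow_ne_zero 2 hn0), mul_inv_cancel_left₀ hn0]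
    simp [cross]; ring

/-- A plane matching and a line that avoids its points give a configuration, in which the positive
side of the line is the given one. -/
theorem exists_config (hdisj : Disjoint B R)
    (hgen : GeneralPosition ((B : Set Plane) ∪ (R : Set Plane)))
    {m : {v // v ∈ B} ≃ {v // v ∈ R}} (hm : IsPlane (graph m)) (ℓ : PlaneLine)
    (hℓ : ∀ v, v ∈ B ∨ v ∈ R → inner ℝ ℓ.normal v ≠ ℓ.offset) :
    ∃ c : Config, (∀ v, v ∈ c.P ↔ v ∈ B ∨ v ∈ R) ∧ (∀ v, v ∈ c.P ∧ c.σ v = 1 ↔ v ∈ B) ∧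
      (∀ v, v ∈ c.P ∧ c.σ v = -1 ↔ v ∈ R) ∧ c.π = partner m ∧
      ∀ v, c.Pos v ↔ ℓ.offset < inner ℝ ℓ.normal v := by
  classical
  obtain ⟨o, τ, hτ, hline⟩ := exists_direction ℓ
  have hpar : ∀ v, v ∈ B ∨ v ∈ R → (v ∈ B ∧ partner m v ∈ R ∨ v ∈ R ∧ partner m v ∈ B) ∧
      partner m (partner m v) = v := by
    rintro v (hv | hv)
    · rw [partner_blue m ⟨v, hv⟩, partner_red hdisj]
      exact ⟨Or.inl ⟨hv, (m _).2⟩, by simp⟩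
    · rw [partner_red hdisj m ⟨v, hv⟩, partner_blue]
      exact ⟨Or.inr ⟨hv, (m.symm _).2⟩, by simp⟩
  have hBR : ∀ v ∈ R, v ∉ B := fun v hv => Finset.disjoint_right.1 hdisj hv
  have hmem : ∀ v, v ∈ B ∪ R ↔ v ∈ B ∨ v ∈ R := fun v => Finset.mem_union
  have hbr := isBRMatching_graph hdisj hm
  refine ⟨⟨B ∪ R, partner m, fun v => if v ∈ B then 1 else -1, o, τ,
    1 + ∑ v ∈ B ∪ R, dist v o, true, ?_, ?_, ?_, ?_, ?_, ?_, ?_, hτ, ?_, ?_⟩, hmem, ?_, ?_, rfl, ?_⟩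
  · intro v hv
    rw [hmem] at hv ⊢
    rcases (hpar v hv).1 with h | h
    exacts [Or.inr h.2, Or.inl h.2]
  · exact fun v hv => (hpar v ((hmem v).1 hv)).2
  · intro v hv h
    rcases (hpar v ((hmem v).1 hv)).1 with h1 | h1
    · exact hBR _ h1.2 (by rw [h]; exact h1.1)
    · exact hBR _ h1.1 (by rw [← h]; exact h1.2)
  · intro v hv
    rcases (hpar v ((hmem v).1 hv)).1 with h1 | h1
    · simp [h1.1, hBR _ h1.2]
    · simp [h1.2, hBR _ h1.1]
  · intro v _
    by_cases h : v ∈ B <;> simp [h]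
  · intro u hu v hv w hw huv huw hvw h
    refine hgen u ?_ v ?_ w ?_ huv huw hvw (collinear_of_cross_eq_zero h)
    exacts [(hmem u).1 hu, (hmem v).1 hv, (hmem w).1 hw]
  · intro u hu v hv huv huv'
    rw [Set.disjoint_left]
    intro x hx hx'
    rw [hmem] at hu hv
    rw [← edgeSegment_mk] at hx hx'
    have h1 := mk_partner_mem_graph hdisj m hu
    have h2 := mk_partner_mem_graph hdisj m hv
    have hne : s(u, partner m u) ≠ s(v, partner m v) := by
      intro h
      rcases Sym2.mem_iff.1 (h ▸ Sym2.mem_mk_left u (partner m u)) with h | h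
      exacts [huv h, huv' h]
    obtain ⟨h3, h4⟩ := hm _ h1 _ h2 hne x ⟨hx, hx'⟩
    exact hne ((hbr.perfectMatching.perfect x
      ((hbr.perfectMatching.graph _ h1).2 x h3)).unique ⟨h1, h3⟩ ⟨h2, h4⟩)
  · intro v hv h
    have := hline v
    rw [h, mul_zero, sub_eq_zero] at this
    exact hℓ v ((hmem v).1 hv) this
  · intro v hv
    rw [Metric.mem_ball]
    have := Finset.single_le_sum (fun x _ => dist_nonneg (x := x) (y := o)) hv
    linarith
  · intro v
    by_cases h : v ∈ B
    · simp [h]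
    · simp only [h, if_false, iff_false, not_and]; norm_num
  · intro v
    by_cases h : v ∈ B
    · simp only [h, if_true, iff_false_intro (Finset.disjoint_left.1 hdisj h), iff_false, not_and]
      norm_num
    · simp [h]
  · intro v
    change 0 < cross (v - o) τ ↔ _
    rw [← sub_pos (b := ℓ.offset), hline v,
      mul_pos_iff_of_pos_left (norm_pos_iff.2 ℓ.normal_ne_zero)]

/-- The label of the outside can be chosen as the one above the uppermost crossing. -/
theorem Config.exists_outer_label (c : Config) : ∃ a : Bool, ∀ v ∈ c.crossing,
    (∀ w ∈ c.crossing, c.pos w ≤ c.pos v) → (a = false ↔ c.Pos v) := by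
  classical
  by_cases h : c.crossing.Nonempty
  · obtain ⟨x, hx, hmax⟩ := Finset.exists_max_image c.crossing c.pos h
    refine ⟨decide (¬ c.Pos x), fun v hv hv' => ?_⟩
    have : x = v := Config.pos_injOn hx hv (le_antisymm (hv' x hx) (hmax v hv))
    simp [this]
  · exact ⟨true, fun v hv => absurd ⟨v, hv⟩ h⟩

/-! ### Compatible matchings with fewer crossings -/

/-- The point `v` is strictly on the positive side of `ℓ`. -/
def Above (ℓ : PlaneLine) (v : Plane) : Prop := ℓ.offset < inner ℝ ℓ.normal v

/-- The number of edges of the matching `m` that cross `ℓ`. -/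
noncomputable def crossNum (ℓ : PlaneLine) (m : {v // v ∈ B} ≃ {v // v ∈ R}) : ℕ :=
  Nat.card {b : {v // v ∈ B} // ¬ (Above ℓ b ↔ Above ℓ (m b))}

/-- If edges cross `ℓ` in both directions, then there is a compatible matching with fewer
crossings. -/
theorem exists_compatible_crossNum_lt (hdisj : Disjoint B R)
    (hgen : GeneralPosition ((B : Set Plane) ∪ (R : Set Plane)))
    {m : {v // v ∈ B} ≃ {v // v ∈ R}} (hm : IsPlane (graph m)) {ℓ : PlaneLine}
    (hℓ : ∀ v, v ∈ B ∨ v ∈ R → inner ℝ ℓ.normal v ≠ ℓ.offset) {v w : {v // v ∈ B}}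
    (hv : Above ℓ v) (hv' : ¬ Above ℓ (m v)) (hw : ¬ Above ℓ w) (hw' : Above ℓ (m w)) :
    ∃ m' : {v // v ∈ B} ≃ {v // v ∈ R}, Compatible (graph m) (graph m') ∧
      crossNum ℓ m' < crossNum ℓ m := by
  obtain ⟨c, hω, hP, hB, hR, hπ, hPos⟩ : ∃ c : Config,
      (∀ v ∈ c.crossing, (∀ w ∈ c.crossing, c.pos w ≤ c.pos v) → (c.ω = false ↔ c.Pos v)) ∧
      (∀ v, v ∈ c.P ↔ v ∈ B ∨ v ∈ R) ∧ (∀ v, v ∈ c.P ∧ c.σ v = 1 ↔ v ∈ B) ∧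
      (∀ v, v ∈ c.P ∧ c.σ v = -1 ↔ v ∈ R) ∧ c.π = partner m ∧ ∀ v, c.Pos v ↔ Above ℓ v := by
    obtain ⟨c, hc⟩ := exists_config hdisj hgen hm ℓ hℓ
    obtain ⟨a, ha⟩ := c.exists_outer_label
    exact ⟨{c with ω := a}, ha, hc⟩
  have hcr : ∀ v : {v // v ∈ B}, v.1 ∈ c.crossing ↔ ¬ (Above ℓ v ↔ Above ℓ (m v)) := by
    intro v
    rw [Config.mem_crossing, ← and_assoc, hB, hPos, hPos, hπ, partner_blue]
    simp
  obtain ⟨e, hcard, hfree, hdis⟩ := Config.exists_fewer_crossings hω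
    ((hcr v).2 (by simp [hv, hv'])) ((hcr w).2 (by simp [hw, hw'])) ((hPos v).2 hv)
    (fun h => hw ((hPos w).1 h))
  set m' : {v // v ∈ B} ≃ {v // v ∈ R} := (Equiv.subtypeEquivRight fun v => (hB v).symm).trans
    (e.trans (Equiv.subtypeEquivRight hR)) with hm'
  have hm'e : ∀ b, (m' ⟨b.1, (hB b.1).1 b.2⟩ : Plane) = e b := fun b => rfl
  have hfree' : ∀ b, (m' b : Plane) ≠ m b → Disjoint (openSegment ℝ b.1 (m' b).1) c.edges := by
    intro b hb
    refine hfree ⟨b, (hB b).2 b.2⟩ ?_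
    rwa [hπ, partner_blue]
  have hdis' : ∀ a b, a ≠ b → Disjoint (openSegment ℝ a.1 (m' a).1) (openSegment ℝ b.1 (m' b).1) :=
    fun a b hab => hdis ⟨a, (hB a).2 a.2⟩ ⟨b, (hB b).2 b.2⟩
      fun h => hab (Subtype.ext (congrArg (fun x => x.1) h))
  refine ⟨m', ?_, ?_⟩
  · have hedges : ∀ b : {v // v ∈ B}, edgeSegment s(b.1, (m b).1) = c.edge b := by
      intro b; rw [edgeSegment_mk, Config.edge, hπ, partner_blue]
    have hPB : ∀ b : {v // v ∈ B}, b.1 ∈ c.P := fun b => (hP _).2 (Or.inl b.2)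
    have hPR : ∀ b : {v // v ∈ R}, b.1 ∈ c.P := fun b => (hP _).2 (Or.inr b.2)
    have hold : ∀ (b : {v // v ∈ B}) {x}, x ∈ c.P → x ∈ edgeSegment s(b.1, (m b).1) →
        x ∈ s(b.1, (m b).1) := by
      intro b x hx h
      rw [hedges] at h
      have := Config.tip_of_mem_edge hx (hPB b) h
      rw [hπ, partner_blue] at this
      exact Sym2.mem_iff.2 this
    -- New edges meet the edges of the matching `m` in their endpoints only.
    have hnew : ∀ (b : {v // v ∈ B}) {x}, x ∈ c.edges → (m' b : Plane) ≠ m b →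
        x ∈ edgeSegment s(b.1, (m' b).1) → x ∈ s(b.1, (m' b).1) := by
      intro b x hx hb h
      rw [edgeSegment_mk] at h
      rw [Sym2.mem_iff]
      rcases mem_segment_cases h with h | h | h
      · exact Or.inl h
      · exact Or.inr h
      · exact absurd hx (Set.disjoint_left.1 (hfree' b hb) h)
    have hnewP : ∀ (b : {v // v ∈ B}) {x}, x ∈ c.P → x ∈ edgeSegment s(b.1, (m' b).1) →
        x ∈ s(b.1, (m' b).1) := by
      intro b x hx h
      by_cases hb : (m' b : Plane) = m b
      · rw [hb] at h ⊢; exact hold b hx h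
      · exact hnew b (Config.tip_mem_edges hx) hb h
    have hendP : ∀ (b : {v // v ∈ B}) {x}, x ∈ s(b.1, (m' b).1) → x ∈ c.P := by
      intro b x h
      rcases Sym2.mem_iff.1 h with rfl | rfl
      exacts [hPB _, hPR _]
    have hcomp : ∀ u b : {v // v ∈ B}, s(u.1, (m u).1) ≠ s(b.1, (m' b).1) →
        ∀ x ∈ edgeSegment s(u.1, (m u).1) ∩ edgeSegment s(b.1, (m' b).1),
          x ∈ s(u.1, (m u).1) ∧ x ∈ s(b.1, (m' b).1) := by
      rintro u b hne x ⟨hx1, hx2⟩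
      by_cases hb : (m' b : Plane) = m b
      · rw [hb] at hne hx2 ⊢
        exact hm _ (mk_mem_graph m u) _ (mk_mem_graph m b) hne x ⟨hx1, hx2⟩
      · have h1 := hnew b (Config.mem_edges.2 ⟨u, hPB u, (hedges u) ▸ hx1⟩) hb hx2
        exact ⟨hold u (hendP b h1) hx1, h1⟩
    rintro _ (⟨u, rfl⟩ | ⟨u, rfl⟩) _ (⟨b, rfl⟩ | ⟨b, rfl⟩) hne x hx
    · exact hm _ (mk_mem_graph m u) _ (mk_mem_graph m b) hne x hx
    · exact hcomp u b hne x hx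
    · exact (hcomp b u hne.symm x hx.symm).symm
    · have hub : u ≠ b := fun h => hne (by rw [h])
      obtain ⟨hx1, hx2⟩ := hx
      by_cases hx : x ∈ c.P
      · exact ⟨hnewP u hx hx1, hnewP b hx hx2⟩
      · exfalso
        have hopen : ∀ z : {v // v ∈ B}, x ∈ edgeSegment s(z.1, (m' z).1) →
            x ∈ openSegment ℝ z.1 (m' z).1 := by
          intro z hz
          rw [edgeSegment_mk] at hz
          rcases mem_segment_cases hz with h | h | h
          · exact absurd (h ▸ hPB z) hx
          · exact absurd (h ▸ hPR _) hx
          · exact h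
        exact Set.disjoint_left.1 (hdis' u b hub) (hopen u hx1) (hopen b hx2)
  · have h1 : crossNum ℓ m' = Nat.card
        {b : {v // v ∈ c.P ∧ c.σ v = 1} // ¬ (c.Pos b ↔ c.Pos (e b))} := by
      refine Nat.card_congr ((Equiv.subtypeEquivRight hB).subtypeEquiv fun b => ?_).symm
      rw [hPos, hPos]; rfl
    rw [h1]
    refine lt_of_lt_of_le hcard ?_
    have h2 : ∀ v : c.crossing, v.1 ∈ B := fun v => (hB v).1
      ⟨(Config.mem_crossing.1 v.2).1, (Config.mem_crossing.1 v.2).2.1⟩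
    have h3 := Nat.card_le_card_of_injective (fun v : c.crossing =>
      (⟨⟨v, h2 v⟩, (hcr ⟨v, h2 v⟩).1 v.2⟩ : {b : {v // v ∈ B} // ¬ (Above ℓ b ↔ Above ℓ (m b))}))
      fun v w h => Subtype.ext (congrArg (fun x => x.1.1) h)
    rwa [Nat.card_eq_fintype_card, Fintype.card_coe] at h3

theorem crossNum_eq (ℓ : PlaneLine) (m : {v // v ∈ B} ≃ {v // v ∈ R}) :
    crossNum ℓ m = ({b : {v // v ∈ B} | Above ℓ b} \ {b | Above ℓ (m b)}).ncard +
      ({b : {v // v ∈ B} | Above ℓ (m b)} \ {b | Above ℓ b}).ncard := by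
  rw [← Set.ncard_union_eq disjoint_sdiff_sdiff, crossNum]
  refine congrArg Set.ncard (?_ : {b : {v // v ∈ B} | ¬ (Above ℓ b ↔ Above ℓ (m b))} = _)
  ext b
  simp only [mem_ofPred_eq, mem_union, Set.mem_sdiff]
  tauto

theorem ncard_above (ℓ : PlaneLine) (S : Finset Plane) :
    {b : {v // v ∈ S} | Above ℓ b}.ncard = (ℓ.posPart S).card := by
  rw [← Set.ncard_image_of_injective _ Subtype.val_injective, ← Set.ncard_coe_finset]
  congr 1
  ext v
  simp only [mem_image, mem_ofPred_eq, Subtype.exists, exists_and_left, exists_prop,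
    PlaneLine.posPart, Finset.coe_filter, Above]
  constructor
  · rintro ⟨w, h1, h2, rfl⟩; exact ⟨h2, h1⟩
  · rintro ⟨h1, h2⟩; exact ⟨v, h2, h1, rfl⟩

theorem ncard_above_partner (ℓ : PlaneLine) (m : {v // v ∈ B} ≃ {v // v ∈ R}) :
    {b | Above ℓ (m b)}.ncard = (ℓ.posPart R).card := by
  rw [← ncard_above, ← Set.ncard_image_of_injective _ m.injective]
  congr 1
  ext r
  simp only [mem_image, mem_ofPred_eq]
  constructor
  · rintro ⟨b, h, rfl⟩; exact h
  · exact fun h => ⟨m.symm r, by simpa using h, by simp⟩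

/-- If a line has as many blue as red points on its positive side, then as many edges cross it in
the one direction as in the other. -/
theorem ncard_up_eq_down {ℓ : PlaneLine} (h : (ℓ.posPart B).card = (ℓ.posPart R).card)
    (m : {v // v ∈ B} ≃ {v // v ∈ R}) :
    ({b : {v // v ∈ B} | Above ℓ b} \ {b | Above ℓ (m b)}).ncard =
      ({b : {v // v ∈ B} | Above ℓ (m b)} \ {b | Above ℓ b}).ncard := by
  refine (Set.ncard_eq_ncard_iff_ncard_sdiff_eq_ncard_sdiff).1 ?_
  rw [ncard_above, ncard_above_partner, h]

theorem ne_of_card_add_card {ℓ : PlaneLine} {S : Finset Plane}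
    (h : (ℓ.negPart S).card + (ℓ.posPart S).card = S.card) :
    ∀ v ∈ S, inner ℝ ℓ.normal v ≠ ℓ.offset := by
  classical
  intro v hv hℓ
  have hdisj : Disjoint (ℓ.negPart S) (ℓ.posPart S) := by
    rw [Finset.disjoint_left]
    intro p hp hp'
    exact lt_asymm (Finset.mem_filter.1 hp).2 (Finset.mem_filter.1 hp').2
  rw [← Finset.card_union_of_disjoint hdisj] at h
  have hsub : ℓ.negPart S ∪ ℓ.posPart S ⊆ S :=
    Finset.union_subset (Finset.filter_subset _ _) (Finset.filter_subset _ _)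
  rw [← Finset.eq_of_subset_of_card_le hsub h.ge] at hv
  rcases Finset.mem_union.1 hv with hv | hv
  · exact (Finset.mem_filter.1 hv).2.ne hℓ
  · exact (Finset.mem_filter.1 hv).2.ne' hℓ

/-! ### Transformations -/

theorem _root_.HasTransformation.refl {M : Set (Sym2 Plane)} (hM : IsBRMatching B R M) :
    HasTransformation B R 0 M M :=
  ⟨fun _ => M, rfl, rfl, fun _ _ => hM, fun _ h => absurd h (Nat.not_lt_zero _)⟩

theorem _root_.HasTransformation.trans {k l : ℕ} {M M' M'' : Set (Sym2 Plane)}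
    (h : HasTransformation B R k M M') (h' : HasTransformation B R l M' M'') :
    HasTransformation B R (k + l) M M'' := by
  obtain ⟨Ms, h0, hk, hM, hc⟩ := h
  obtain ⟨Ns, h0', hl, hN, hc'⟩ := h'
  refine ⟨fun i => if i ≤ k then Ms i else Ns (i - k), by simpa using h0, ?_, ?_, ?_⟩
  · rcases Nat.eq_zero_or_pos l with rfl | hl0
    · simp [hk, ← hl, h0']
    · simp [hl, hl0.ne']
  · intro i hi
    dsimp only
    split_ifs with h
    · exact hM i h
    · exact hN _ (by omega)
  · intro i hi
    dsimp only
    rcases lt_trichotomy i k with h | rfl | h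
    · rw [if_pos h.le, if_pos (Nat.succ_le_of_lt h)]; exact hc i h
    · rw [if_pos le_rfl, if_neg (by omega), hk, ← h0']
      have := hc' 0 (by omega)
      simpa using this
    · rw [if_neg (by omega), if_neg (by omega)]
      have := hc' (i - k) (by omega)
      rwa [show i - k + 1 = i + 1 - k by omega] at this

theorem _root_.HasTransformation.of_compatible {M M' : Set (Sym2 Plane)} (hM : IsBRMatching B R M)
    (hM' : IsBRMatching B R M') (h : Compatible M M') : HasTransformation B R 1 M M' := by
  refine ⟨fun i => if i = 0 then M else M', by simp, by simp, fun i _ => ?_, fun i hi => ?_⟩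
  · dsimp only; split_ifs <;> assumption
  · obtain rfl : i = 0 := by omega
    simpa using h

/-- Repeatedly passing to a compatible matching with fewer crossings ends with a matching that does
not cross the given line. As the number of crossings is even, this takes at most half as many
steps as there are crossings. -/
theorem exists_uncrossed (hdisj : Disjoint B R)
    (hgen : GeneralPosition ((B : Set Plane) ∪ (R : Set Plane))) {ℓ : PlaneLine}
    (hℓ : ∀ v, v ∈ B ∨ v ∈ R → inner ℝ ℓ.normal v ≠ ℓ.offset)
    (hbal : (ℓ.posPart B).card = (ℓ.posPart R).card) (k : ℕ) :
    ∀ m : {v // v ∈ B} ≃ {v // v ∈ R}, IsPlane (graph m) → crossNum ℓ m ≤ 2 * k →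
      ∃ m' : {v // v ∈ B} ≃ {v // v ∈ R}, IsPlane (graph m') ∧ crossNum ℓ m' = 0 ∧
        ∃ l ≤ k, HasTransformation B R l (graph m) (graph m') := by
  induction k with
  | zero => exact fun m hm h => ⟨m, hm, by omega, 0, le_rfl,
      HasTransformation.refl (isBRMatching_graph hdisj hm)⟩
  | succ k ih =>
    intro m hm h
    have h1 := crossNum_eq ℓ m
    have h2 := ncard_up_eq_down hbal m
    by_cases h0 : crossNum ℓ m = 0
    · exact ⟨m, hm, h0, 0, Nat.zero_le _, HasTransformation.refl (isBRMatching_graph hdisj hm)⟩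
    obtain ⟨v, hv, hv'⟩ := Set.nonempty_of_ncard_ne_zero
      (show ({b : {v // v ∈ B} | Above ℓ b} \ {b | Above ℓ (m b)}).ncard ≠ 0 by omega)
    obtain ⟨w, hw', hw⟩ := Set.nonempty_of_ncard_ne_zero
      (show ({b : {v // v ∈ B} | Above ℓ (m b)} \ {b | Above ℓ b}).ncard ≠ 0 by omega)
    obtain ⟨m₁, hc, hlt⟩ := exists_compatible_crossNum_lt hdisj hgen hm hℓ hv hv' hw hw'
    have hm₁ : IsPlane (graph m₁) := IsPlane.mono hc Set.subset_union_right
    have h3 := crossNum_eq ℓ m₁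
    have h4 := ncard_up_eq_down hbal m₁
    obtain ⟨m', hm', h0', l, hl, ht⟩ := ih m₁ hm₁ (by omega)
    refine ⟨m', hm', h0', 1 + l, by omega, HasTransformation.trans
      (HasTransformation.of_compatible (isBRMatching_graph hdisj hm)
        (isBRMatching_graph hdisj hm₁) hc) ht⟩

/-! ### The two sides of a line -/

theorem isPlane_union {ℓ : PlaneLine} {E F : Set (Sym2 Plane)} (hE : IsPlane E) (hF : IsPlane F)
    (hE' : ∀ e ∈ E, ∀ p ∈ e, inner ℝ ℓ.normal p < ℓ.offset)
    (hF' : ∀ e ∈ F, ∀ p ∈ e, ℓ.offset < inner ℝ ℓ.normal p) : IsPlane (E ∪ F) := by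
  have hlin : IsLinearMap ℝ fun x : Plane => inner ℝ ℓ.normal x :=
    (innerSL ℝ ℓ.normal).toLinearMap.isLinear
  have hsep : ∀ e ∈ E, ∀ f ∈ F, ∀ x, x ∈ edgeSegment e → x ∉ edgeSegment f := by
    intro e he f hf x hx hx'
    have h1 := convexHull_min (t := {x | inner ℝ ℓ.normal x < ℓ.offset}) (hE' e he)
      (convex_halfSpace_lt hlin _) hx
    have h2 := convexHull_min (t := {x | ℓ.offset < inner ℝ ℓ.normal x}) (hF' f hf)
      (convex_halfSpace_gt hlin _) hx'
    exact lt_asymm (show inner ℝ ℓ.normal x < ℓ.offset from h1) h2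
  rintro e (he | he) f (hf | hf) hef x hx
  · exact hE e he f hf hef x hx
  · exact absurd hx.2 (hsep e he f hf x hx.1)
  · exact absurd hx.1 (hsep f hf e he x hx.2)
  · exact hF e he f hf hef x hx

open Classical in
theorem _root_.IsBRMatching.filter {M : Set (Sym2 Plane)} (hM : IsBRMatching B R M)
    {p : Plane → Prop}
    (hp : ∀ e ∈ M, ∀ u ∈ e, ∀ w ∈ e, p u → p w) :
    IsBRMatching (B.filter p) (R.filter p) {e ∈ M | ∀ u ∈ e, p u} where
  perfectMatching :=
    { graph := by
        rintro e ⟨he, hep⟩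
        refine ⟨(hM.perfectMatching.graph e he).1, fun v hv => ?_⟩
        rcases (hM.perfectMatching.graph e he).2 v hv with h | h
        · exact Or.inl (Finset.mem_coe.2 (Finset.mem_filter.2 ⟨h, hep v hv⟩))
        · exact Or.inr (Finset.mem_coe.2 (Finset.mem_filter.2 ⟨h, hep v hv⟩))
      plane := IsPlane.mono hM.perfectMatching.plane fun e he => he.1
      perfect := by
        intro v hv
        have hv' : (v ∈ (B : Set Plane) ∪ (R : Set Plane)) ∧ p v := by
          rcases hv with h | h
          · exact ⟨Or.inl (Finset.mem_filter.1 h).1, (Finset.mem_filter.1 h).2⟩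
          · exact ⟨Or.inr (Finset.mem_filter.1 h).1, (Finset.mem_filter.1 h).2⟩
        obtain ⟨e, ⟨he, hve⟩, huniq⟩ := hM.perfectMatching.perfect v hv'.1
        exact ⟨e, ⟨⟨he, fun u hu => hp e he v hve u hu hv'.2⟩, hve⟩, fun f hf =>
          huniq f ⟨hf.1.1, hf.2⟩⟩ }
  bichromatic := by
    rintro e ⟨he, hep⟩
    obtain ⟨b, hb, r, hr, rfl⟩ := hM.bichromatic e he
    exact ⟨b, Finset.mem_coe.2 (Finset.mem_filter.2 ⟨hb, hep b (by simp)⟩), r,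
      Finset.mem_coe.2 (Finset.mem_filter.2 ⟨hr, hep r (by simp)⟩), rfl⟩

section sides

variable {ℓ : PlaneLine} {M₁ M₂ : Set (Sym2 Plane)}

theorem _root_.IsBRMatching.lt_of_negPart (h : IsBRMatching (ℓ.negPart B) (ℓ.negPart R) M₁) :
    ∀ e ∈ M₁, ∀ p ∈ e, inner ℝ ℓ.normal p < ℓ.offset := by
  intro e he p hp
  rcases (h.perfectMatching.graph e he).2 p hp with h | h <;> exact (Finset.mem_filter.1 h).2

theorem _root_.IsBRMatching.lt_of_posPart (h : IsBRMatching (ℓ.posPart B) (ℓ.posPart R) M₂) :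
    ∀ e ∈ M₂, ∀ p ∈ e, ℓ.offset < inner ℝ ℓ.normal p := by
  intro e he p hp
  rcases (h.perfectMatching.graph e he).2 p hp with h | h <;> exact (Finset.mem_filter.1 h).2

theorem _root_.IsBRMatching.union (hℓ : ∀ v, v ∈ B ∨ v ∈ R → inner ℝ ℓ.normal v ≠ ℓ.offset)
    (h₁ : IsBRMatching (ℓ.negPart B) (ℓ.negPart R) M₁)
    (h₂ : IsBRMatching (ℓ.posPart B) (ℓ.posPart R) M₂) : IsBRMatching B R (M₁ ∪ M₂) where
  perfectMatching :=
    { graph := by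
        rintro e (he | he)
        · refine ⟨(h₁.perfectMatching.graph e he).1, fun v hv => ?_⟩
          rcases (h₁.perfectMatching.graph e he).2 v hv with h | h
          exacts [Or.inl (Finset.mem_filter.1 h).1, Or.inr (Finset.mem_filter.1 h).1]
        · refine ⟨(h₂.perfectMatching.graph e he).1, fun v hv => ?_⟩
          rcases (h₂.perfectMatching.graph e he).2 v hv with h | h
          exacts [Or.inl (Finset.mem_filter.1 h).1, Or.inr (Finset.mem_filter.1 h).1]
      plane := isPlane_union h₁.perfectMatching.plane h₂.perfectMatching.plane
        h₁.lt_of_negPart h₂.lt_of_posPart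
      perfect := by
        intro v hv
        rcases lt_or_gt_of_ne (hℓ v hv) with hlt | hlt
        · obtain ⟨e, ⟨he, hve⟩, huniq⟩ := h₁.perfectMatching.perfect v
            (hv.imp (fun h => Finset.mem_coe.2 (Finset.mem_filter.2 ⟨h, hlt⟩))
              fun h => Finset.mem_coe.2 (Finset.mem_filter.2 ⟨h, hlt⟩))
          refine ⟨e, ⟨Or.inl he, hve⟩, ?_⟩
          rintro f ⟨hf | hf, hvf⟩
          · exact huniq f ⟨hf, hvf⟩
          · exact absurd (h₂.lt_of_posPart f hf v hvf) hlt.not_gt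
        · obtain ⟨e, ⟨he, hve⟩, huniq⟩ := h₂.perfectMatching.perfect v
            (hv.imp (fun h => Finset.mem_coe.2 (Finset.mem_filter.2 ⟨h, hlt⟩))
              fun h => Finset.mem_coe.2 (Finset.mem_filter.2 ⟨h, hlt⟩))
          refine ⟨e, ⟨Or.inr he, hve⟩, ?_⟩
          rintro f ⟨hf | hf, hvf⟩
          · exact absurd (h₁.lt_of_negPart f hf v hvf) (lt_asymm hlt)
          · exact huniq f ⟨hf, hvf⟩ }
  bichromatic := by
    rintro e (he | he)
    · obtain ⟨b, hb, r, hr, rfl⟩ := h₁.bichromatic e he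
      exact ⟨b, (Finset.mem_filter.1 hb).1, r, (Finset.mem_filter.1 hr).1, rfl⟩
    · obtain ⟨b, hb, r, hr, rfl⟩ := h₂.bichromatic e he
      exact ⟨b, (Finset.mem_filter.1 hb).1, r, (Finset.mem_filter.1 hr).1, rfl⟩

/-- The two sides of a line can be transformed in parallel, where the shorter of the transformations
is padded with repetitions of its last matching. -/
theorem _root_.HasTransformation.union (hℓ : ∀ v, v ∈ B ∨ v ∈ R → inner ℝ ℓ.normal v ≠ ℓ.offset)
    {k₁ k₂ : ℕ} {H₁ H₂ : Set (Sym2 Plane)}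
    (h₁ : HasTransformation (ℓ.negPart B) (ℓ.negPart R) k₁ M₁ H₁)
    (h₂ : HasTransformation (ℓ.posPart B) (ℓ.posPart R) k₂ M₂ H₂) :
    HasTransformation B R (max k₁ k₂) (M₁ ∪ M₂) (H₁ ∪ H₂) := by
  obtain ⟨Ms, hM0, hMk, hM, hMc⟩ := h₁
  obtain ⟨Ns, hN0, hNk, hN, hNc⟩ := h₂
  have hstep : ∀ {B R : Finset Plane} {k : ℕ} {Ms : ℕ → Set (Sym2 Plane)},
      (∀ i, i ≤ k → IsBRMatching B R (Ms i)) → (∀ i, i < k → Compatible (Ms i) (Ms (i + 1))) →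
      ∀ i, IsPlane (Ms (min i k) ∪ Ms (min (i + 1) k)) := by
    intro B R k Ms hM hMc i
    rcases lt_or_ge i k with h | h
    · rw [min_eq_left h.le, min_eq_left h]; exact hMc i h
    · rw [min_eq_right h, min_eq_right (by omega), Set.union_self]
      exact (hM k le_rfl).perfectMatching.plane
  refine ⟨fun i => Ms (min i k₁) ∪ Ns (min i k₂), by simp [hM0, hN0], by simp [hMk, hNk],
    fun i _ => IsBRMatching.union hℓ (hM _ (min_le_right _ _)) (hN _ (min_le_right _ _)),
    fun i _ => ?_⟩
  rw [Compatible, Set.union_union_union_comm]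
  refine isPlane_union (ℓ := ℓ) (hstep hM hMc i) (hstep hN hNc i) ?_ ?_
  · rintro e (he | he)
    exacts [(hM _ (min_le_right _ _)).lt_of_negPart e he,
      (hM _ (min_le_right _ _)).lt_of_negPart e he]
  · rintro e (he | he)
    exacts [(hN _ (min_le_right _ _)).lt_of_posPart e he,
      (hN _ (min_le_right _ _)).lt_of_posPart e he]

end sides

/-- It takes at most `n / 2` steps to reach a matching without edges across the ham-sandwich cut,
and at most `(n + 1) / 2` further ones to transform both sides in parallel. -/
theorem exists_hasTransformation {H : Set (Sym2 Plane)} (hH : IsHamSandwichMatching B R H) :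
    Disjoint B R → GeneralPosition ((B : Set Plane) ∪ (R : Set Plane)) →
      ∀ M, IsBRMatching B R M → ∃ k ≤ B.card, HasTransformation B R k M H := by
  induction hH with
  | pair b r =>
    intro hdisj _ M hM
    obtain ⟨m, rfl⟩ := exists_graph_eq hdisj hM
    refine ⟨0, Nat.zero_le _, ?_⟩
    have : graph m = {s(b, r)} := by
      have h1 : ∀ x : {v // v ∈ ({b} : Finset Plane)}, s(x.1, (m x).1) = s(b, r) := fun x => by
        rw [Finset.mem_singleton.1 x.2, Finset.mem_singleton.1 (m x).2]
      ext e
      constructor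
      · rintro ⟨x, rfl⟩; exact h1 x
      · rintro rfl; exact ⟨⟨b, by simp⟩, (h1 _).symm⟩
    rw [this] at hM ⊢
    exact HasTransformation.refl hM
  | cut n hn B R ℓ hcut H₁ H₂ _ _ ih₁ ih₂ =>
    intro hdisj hgen M hM
    obtain ⟨m, rfl⟩ := exists_graph_eq hdisj hM
    obtain ⟨hB, hR, hcut⟩ := hcut
    -- The two sides of the cut contain all points. So none is on the line.
    have hBℓ := ne_of_card_add_card (ℓ := ℓ) (S := B) (by omega)
    have hRℓ := ne_of_card_add_card (ℓ := ℓ) (S := R) (by omega)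
    have hℓ : ∀ v, v ∈ B ∨ v ∈ R → inner ℝ ℓ.normal v ≠ ℓ.offset := fun v hv =>
      hv.elim (hBℓ v) (hRℓ v)
    have hbal : (ℓ.posPart B).card = (ℓ.posPart R).card := by omega
    have hcr : crossNum ℓ m ≤ 2 * (n / 2) := by
      have h1 := crossNum_eq ℓ m
      have h2 := ncard_up_eq_down hbal m
      have h3 : ({b : {v // v ∈ B} | Above ℓ b} \ {b | Above ℓ (m b)}).ncard ≤
          (ℓ.posPart B).card := (Set.ncard_le_ncard Set.sdiff_subset).trans (ncard_above ℓ B).le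
      have h4 : ({b : {v // v ∈ B} | Above ℓ (m b)} \ {b | Above ℓ b}).ncard ≤
          (ℓ.negPart B).card := by
        rw [← Set.ncard_coe_finset, ← Set.ncard_image_of_injective _ Subtype.val_injective]
        refine Set.ncard_le_ncard ?_ (Finset.finite_toSet _)
        rintro _ ⟨b, ⟨-, hb⟩, rfl⟩
        exact Finset.mem_coe.2 (Finset.mem_filter.2
          ⟨b.2, lt_of_le_of_ne (not_lt.1 hb) (hBℓ b b.2)⟩)
      omega
    obtain ⟨m', hm', h0, l, hl, ht⟩ := exists_uncrossed hdisj hgen hℓ hbal (n / 2) m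
      hM.perfectMatching.plane hcr
    have hM' := isBRMatching_graph hdisj hm'
    have hside : ∀ b, Above ℓ b.1 ↔ Above ℓ (m' b).1 := by
      intro b
      by_contra h
      rw [crossNum, Nat.card_eq_zero] at h0
      rcases h0 with h0 | h0
      · exact h0.elim ⟨b, h⟩
      · exact h0.not_finite inferInstance
    have hpos : ∀ e ∈ graph m', ∀ u ∈ e, ∀ w ∈ e, Above ℓ u → Above ℓ w := by
      rintro _ ⟨b, rfl⟩ u hu w hw h
      have := hside b
      rcases Sym2.mem_iff.1 hu with rfl | rfl <;> rcases Sym2.mem_iff.1 hw with rfl | rfl <;> tauto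
    have hmem : ∀ e ∈ graph m', ∀ u ∈ e, inner ℝ ℓ.normal u ≠ ℓ.offset := fun e he u hu =>
      hℓ u ((hM'.perfectMatching.graph e he).2 u hu)
    have hneg : ∀ e ∈ graph m', ∀ u ∈ e, ∀ w ∈ e, inner ℝ ℓ.normal u < ℓ.offset →
        inner ℝ ℓ.normal w < ℓ.offset := by
      intro e he u hu w hw h
      refine lt_of_le_of_ne (not_lt.1 fun h' => ?_) (hmem e he w hw)
      exact lt_asymm h (hpos e he w hw u hu h')
    have hunion : graph m' = {e ∈ graph m' | ∀ u ∈ e, inner ℝ ℓ.normal u < ℓ.offset} ∪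
        {e ∈ graph m' | ∀ u ∈ e, ℓ.offset < inner ℝ ℓ.normal u} := by
      ext e
      constructor
      · intro he
        obtain ⟨b, rfl⟩ := id he
        rcases lt_or_gt_of_ne (hBℓ b b.2) with h | h
        · exact Or.inl ⟨he, fun u hu => hneg _ he b (Sym2.mem_mk_left _ _) u hu h⟩
        · exact Or.inr ⟨he, fun u hu => hpos _ he b (Sym2.mem_mk_left _ _) u hu h⟩
      · rintro (he | he) <;> exact he.1
    have hsub : ∀ {B' R' : Finset Plane}, B' ⊆ B → R' ⊆ R → Disjoint B' R' ∧
        GeneralPosition ((B' : Set Plane) ∪ (R' : Set Plane)) := by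
      intro B' R' hB' hR'
      have hS : (B' : Set Plane) ∪ (R' : Set Plane) ⊆ (B : Set Plane) ∪ (R : Set Plane) :=
        Set.union_subset_union (Finset.coe_subset.2 hB') (Finset.coe_subset.2 hR')
      exact ⟨hdisj.mono hB' hR', fun p hp q hq r hr => hgen p (hS hp) q (hS hq) r (hS hr)⟩
    obtain ⟨k₁, hk₁, ht₁⟩ := ih₁
      (hsub (Finset.filter_subset _ _) (Finset.filter_subset _ _)).1
      (hsub (Finset.filter_subset _ _) (Finset.filter_subset _ _)).2 _ (hM'.filter hneg)
    obtain ⟨k₂, hk₂, ht₂⟩ := ih₂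
      (hsub (Finset.filter_subset _ _) (Finset.filter_subset _ _)).1
      (hsub (Finset.filter_subset _ _) (Finset.filter_subset _ _)).2 _ (hM'.filter hpos)
    have ht' := HasTransformation.union hℓ ht₁ ht₂
    rw [← hunion] at ht'
    exact ⟨_, by omega, HasTransformation.trans ht ht'⟩

end LabelledWalls

theorem theorem1 (n : ℕ) (B R : Finset Plane) (hdisj : Disjoint B R)
    (hB : B.card = n) (hR : R.card = n)
    (hgen : GeneralPosition ((B : Set Plane) ∪ (R : Set Plane)))
    (M H : Set (Sym2 Plane)) (hM : IsBRMatching B R M)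
    (hH : IsHamSandwichMatching B R H) :
    TCompatible B R n M H := by
  obtain ⟨k, hk, h⟩ := LabelledWalls.exists_hasTransformation hH hdisj hgen M hM
  exact ⟨k, hB ▸ hk, h⟩
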